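/- **Setting.** Let $\mathbb S=\{I\in\mathbb H: I^2=-1\}$ and $\mathbb C_I=\{x+Iy: x,y\in\mathbb R\}$ for $I\in\mathbb S$. A circular domain $\Omega\subseteq\mathbb H$ is a nonempty connected open set which contains the whole sphere $\mathbb S_q=\{x+Jy: J\in\mathbb S\}$ whenever it contains $q=x+Iy$ ($I\in\mathbb S$). It is a product domain if $\Omega\cap\mathbb R=\emptyset$, and a slice domain otherwise. On a circular open set $U$, a function $f:U\to\mathbb H$ is slice regular if it is a slice function, $f(x+Iy)=\alpha(x,y)+I\beta(x,y)$ with $\alpha,\beta$ independent of $I\in\mathbb S$, and if each restriction $f_I$ to $U\cap\mathbb C_I$ is real differentiable with $(\partial_x+I\partial_y)f_I(x+Iy)=0$. It is slice preserving if $f(U\cap\mathbb C_I)\subseteq\mathbb C_I$ for all $I\in\mathbb S$. A function $f$ is slice semi-regular on $\Omega$ if it is slice regular on a circular open set $\tilde\Omega\subseteq\Omega$ and every $p\in\Omega\setminus\tilde\Omega$ is a pole or a removable singularity, i.e. there are a circular open neighbourhood $V$ of $p$ with $V\setminus\mathbb S_p\subseteq\tilde\Omega$ and an $n\ge 0$ such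 that $\Delta_p^n f$, with $\Delta_p(q)=q^2-2\,\mathrm{Re}(p)\,q+|p|^2$, extends from $V\setminus\mathbb S_p$ to a slice regular function on $V$. Semi-regular functions that agree on a circular open dense subset of $\Omega$ are identified. The set $\mathcal{SEM}(\Omega)$ of these functions is a ring under pointwise addition and the $*$-product $$(f*g)(q)=\begin{cases}0,& f(q)=0,\\ f(q)\,g\big(f(q)^{-1}q f(q)\big),& f(q)\neq0,\end{cases}$$ and $\mathcal{SEM}_{\mathbb R}(\Omega)$ denotes its subset of slice preserving functions, which is a central subfield, so that $\mathcal{SEM}(\Omega)$ is a vector space over $\mathcal{SEM}_{\mathbb R}(\Omega)$. If $f(x+Iy)=\alpha+I\beta$, let $f^c(x+Iy)=\bar\alpha+I\bar\beta$ (quaternionic conjugates), and put $f_0=\tfrac12(f+f^c)$, $f_v=f-f_0$, $f^s=f*f^c$, and $f_v^s=(f_v)^s$. Write $f\simeq g$ if there is a $*$-invertible $h\in\mathcal{SEM}(\Omega)$ with $f=h^{-*}*g*h$. A zero divisor is an $f\not\equiv0$ such that $f*g\equiv0$ or $g*f\equiv 0$ for some $g\not\equiv0$. **Theorem.** Let $\Omega\subseteq\mathbb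 H$ be a circular domain, let $f,g\in\mathcal{SEM}(\Omega)\setminus\mathcal{SEM}_{\mathbb R}(\Omega)$, let $\mathcal S_{f,g}:\mathcal{SEM}(\Omega)\to\mathcal{SEM}(\Omega)$ be the $\mathcal{SEM}_{\mathbb R}(\Omega)$-linear operator $\mathcal S_{f,g}(\chi)=f*\chi+\chi*g$, and put $$D=(f_0+g_0)^2\big[(f_0+g_0)^2+2(f_v^s+g_v^s)\big]+(f_v^s-g_v^s)^2 .$$ Then $\operatorname{rk}\mathcal S_{f,g}>1$, and: 1. $\operatorname{rk}\mathcal S_{f,g}=4$ if and only if $D\not\equiv0$. 2. $\operatorname{rk}\mathcal S_{f,g}=3$ if and only if $D\equiv0$ and $f_0+g_0\not\equiv0$; equivalently, if and only if $\ker\mathcal S_{f,g}\neq\{0\}$ and every nonzero element of $\ker\mathcal S_{f,g}$ is a zero divisor. This can occur only if $\Omega$ is a product domain. 3. $\operatorname{rk}\mathcal S_{f,g}=2$ if and only if $f\simeq-g$; equivalently, if and only if $f_0+g_0\equiv0$ and $f_v^s\equiv g_v^s$; equivalently, if and only if $\ker\mathcal S_{f,g}$ contains an element that is $*$-invertible in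 $\mathcal{SEM}(\Omega)$. 4. If $\operatorname{rk}\mathcal S_{f,g}=2$, then $\ker\mathcal S_{f,g}$ contains a zero divisor if and only if $\Omega$ is a product domain and one of the following holds: (a) $f_v=g_v$ and $f_v^s$ has a square root in $\mathcal{SEM}_{\mathbb R}(\Omega)$; (b) $f_v\neq g_v$ and $(f_v-g_v)^s\equiv0$; (c) $(f_v-g_v)^s\not\equiv0$ and $f_v^s$ has a square root in $\mathcal{SEM}_{\mathbb R}(\Omega)$. Here a square root of $f_v^s$ in $\mathcal{SEM}_{\mathbb R}(\Omega)$ is a $\rho\in\mathcal{SEM}_{\mathbb R}(\Omega)$ with $\rho^2\equiv f_v^s$. -/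

import Mathlib

open scoped Quaternion

noncomputable section

namespace SliceFun

/-! ### Slices and circular sets -/

/-- The sphere `𝕊` of imaginary units of the quaternions. -/
def imagUnits : Set ℍ[ℝ] := {I | I ^ 2 = -1}

/-- The point `x + I y`, for `z = x + i y`. For `I ∈ 𝕊` the range of `slicePt I` is the complex
line `ℂ_I`. -/
def slicePt (I : ℍ[ℝ]) (z : ℂ) : ℍ[ℝ] := (z.re : ℍ[ℝ]) + z.im • I

/-- The complex line `ℂ_I = {x + I y}`. -/
def complexLine (I : ℍ[ℝ]) : Set ℍ[ℝ] := Set.range (slicePt I)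

/-- The sphere `𝕊_p = {x + J y | J ∈ 𝕊}` through `p = x + I y`; here `x = Re p`, `y = |p_v|`. -/
def sphereThrough (p : ℍ[ℝ]) : Set ℍ[ℝ] :=
  {q | ∃ J ∈ imagUnits, q = slicePt J ⟨p.re, ‖p.im‖⟩}

/-- A set of quaternions is circular if it contains `𝕊_p` together with any of its points `p`. -/
def IsCircular (U : Set ℍ[ℝ]) : Prop := ∀ p ∈ U, sphereThrough p ⊆ U

/-- A circular domain: a nonempty connected open circular set. -/
structure CircularDomain where
  carrier : Set ℍ[ℝ]
  isOpen : IsOpen carrier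
  isConnected : IsConnected carrier
  isCircular : IsCircular carrier

/-- A product domain: a circular domain without real points. The other circular domains are called
slice domains. -/
def CircularDomain.IsProductDomain (Ω : CircularDomain) : Prop :=
  ∀ x : ℝ, (x : ℍ[ℝ]) ∉ Ω.carrier

/-! ### Slice regular functions

Functions on a subset of the quaternions are represented by total functions `ℍ → ℍ`, whose values
outside of the set are irrelevant. -/

/-- `f` is a slice function on `U`, with components `α`, `β`: `f (x + I y) = α + I β`, where `α` and
`β` depend on `x`, `y` only. -/
def HasComponents (f : ℍ[ℝ] → ℍ[ℝ]) (U : Set ℍ[ℝ]) (α β : ℂ → ℍ[ℝ]) : Prop :=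
  ∀ I ∈ imagUnits, ∀ z : ℂ, slicePt I z ∈ U → f (slicePt I z) = α z + I * β z

/-- Slice regularity on a circular open set `U`: `f` is a slice function, and each of its
restrictions `f_I` to the slices `U ∩ ℂ_I` is real differentiable and holomorphic,
`(∂/∂x + I ∂/∂y) f_I (x + I y) = 0`. -/
structure IsSliceRegular (f : ℍ[ℝ] → ℍ[ℝ]) (U : Set ℍ[ℝ]) : Prop where
  isSlice : ∃ α β : ℂ → ℍ[ℝ], HasComponents f U α β
  differentiableAt : ∀ I ∈ imagUnits, ∀ z : ℂ, slicePt I z ∈ U →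
    DifferentiableAt ℝ (fun w : ℂ => f (slicePt I w)) z
  holomorphic : ∀ I ∈ imagUnits, ∀ z : ℂ, slicePt I z ∈ U →
    fderiv ℝ (fun w : ℂ => f (slicePt I w)) z 1 +
      I * fderiv ℝ (fun w : ℂ => f (slicePt I w)) z Complex.I = 0

/-- `f` is slice preserving on `U`: it maps `U ∩ ℂ_I` to `ℂ_I`, for all `I ∈ 𝕊`. -/
def IsSlicePreserving (f : ℍ[ℝ] → ℍ[ℝ]) (U : Set ℍ[ℝ]) : Prop :=
  ∀ I ∈ imagUnits, ∀ q ∈ U ∩ complexLine I, f q ∈ complexLine I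

/-- The `*`-product of slice functions. -/
def starMul (f g : ℍ[ℝ] → ℍ[ℝ]) (q : ℍ[ℝ]) : ℍ[ℝ] :=
  open Classical in if f q = 0 then 0 else f q * g ((f q)⁻¹ * q * f q)

/-- The function `𝒥 q = q_v / |q_v|` (with the value `0` at real points, where it is not used). -/
def unitIm (q : ℍ[ℝ]) : ℍ[ℝ] := ‖q.im‖⁻¹ • q.im

/-- The regular conjugate `f^c`. If `f (x + I y) = α + I β` then `f^c (x + I y) = α^c + I β^c`,
see `HasComponents.regConj`; equivalently `f^c = f₀ - f₁ i - f₂ j - f₃ k` if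
`f = f₀ + f₁ i + f₂ j + f₃ k` with slice preserving functions `f₀`, `f₁`, `f₂`, `f₃`. In the formula
below, the two stars are applied to `α` and to `I β`. -/
def regConj (f : ℍ[ℝ] → ℍ[ℝ]) (q : ℍ[ℝ]) : ℍ[ℝ] :=
  star ((1 / 2 : ℝ) • (f q + f (star q))) +
    unitIm q * star ((1 / 2 : ℝ) • (f q - f (star q))) * unitIm q

/-! ### Semi-regular functions -/

/-- The polynomial `Δ_p (q) = q² - 2 Re(p) q + |p|²`, which vanishes on `𝕊_p`. -/
def Delta (p q : ℍ[ℝ]) : ℍ[ℝ] := q ^ 2 - (2 * p.re) • q + ((‖p‖ ^ 2 : ℝ) : ℍ[ℝ])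

/-- The points of the sphere `𝕊_p` are poles or removable singularities of `f`, a slice regular
function on `U`: some circular neighbourhood `V` of `𝕊_p` is contained in `U` except for `𝕊_p`, and
for some `n` the function `Δ_p ^ n f` extends to a slice regular function on `V`. -/
def IsPoleOrRemovable (f : ℍ[ℝ] → ℍ[ℝ]) (U : Set ℍ[ℝ]) (p : ℍ[ℝ]) : Prop :=
  ∃ V : Set ℍ[ℝ], IsOpen V ∧ IsCircular V ∧ p ∈ V ∧ V \ sphereThrough p ⊆ U ∧
    ∃ (n : ℕ) (g : ℍ[ℝ] → ℍ[ℝ]), IsSliceRegular g V ∧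
      ∀ q ∈ V \ sphereThrough p, g q = Delta p q ^ n * f q

/-- `f` is slice regular on the circular open set `U ⊆ Ω`, and all points of `Ω \ U` are poles or
removable singularities of `f`. -/
structure IsSemiRegularOn (f : ℍ[ℝ] → ℍ[ℝ]) (Ω U : Set ℍ[ℝ]) : Prop where
  subset : U ⊆ Ω
  isOpen : IsOpen U
  isCircular : IsCircular U
  isSliceRegular : IsSliceRegular f U
  isPole : ∀ p ∈ Ω \ U, IsPoleOrRemovable f U p

/-- `f` is slice semi-regular in `Ω`. -/
def IsSemiRegular (f : ℍ[ℝ] → ℍ[ℝ]) (Ω : Set ℍ[ℝ]) : Prop := ∃ U, IsSemiRegularOn f Ω U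

/-- `U` is a circular open subset of `Ω` that is dense in `Ω`. -/
structure IsCircularDense (U Ω : Set ℍ[ℝ]) : Prop where
  subset : U ⊆ Ω
  isOpen : IsOpen U
  isCircular : IsCircular U
  dense : Ω ⊆ closure U

/-! ### Basic facts on slices -/

lemma sq_of_mem {I : ℍ[ℝ]} (h : I ∈ imagUnits) : I * I = -1 := by
  have : I ^ 2 = -1 := h
  rwa [sq] at this

lemma neg_mem {I : ℍ[ℝ]} (h : I ∈ imagUnits) : -I ∈ imagUnits := by
  simpa [imagUnits] using h

lemma ne_zero_of_mem {I : ℍ[ℝ]} (h : I ∈ imagUnits) : I ≠ 0 := by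
  rintro rfl
  have := sq_of_mem h
  simp at this

/-- The quaternion `i`. -/
def unitI : ℍ[ℝ] := ⟨0, 1, 0, 0⟩

/-- The quaternion `j`. -/
def unitJ : ℍ[ℝ] := ⟨0, 0, 1, 0⟩

lemma i_mem : unitI ∈ imagUnits := by
  show unitI ^ 2 = -1
  rw [sq]; ext <;> simp <;> simp [unitI]

lemma j_mem : unitJ ∈ imagUnits := by
  show unitJ ^ 2 = -1
  rw [sq]; ext <;> simp <;> simp [unitJ]

lemma re_eq_zero_of_mem {I : ℍ[ℝ]} (h : I ∈ imagUnits) : I.re = 0 := by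
  have h2 := sq_of_mem h
  have e0 := congrArg (fun q : ℍ[ℝ] => q.re) h2
  have e1 := congrArg (fun q : ℍ[ℝ] => q.imI) h2
  have e2 := congrArg (fun q : ℍ[ℝ] => q.imJ) h2
  have e3 := congrArg (fun q : ℍ[ℝ] => q.imK) h2
  simp at e0 e1 e2 e3
  by_contra hre
  have a1 : I.imI = 0 := by
    have : I.re * I.imI = 0 := by linarith
    simpa [hre] using this
  have a2 : I.imJ = 0 := by
    have : I.re * I.imJ = 0 := by linarith
    simpa [hre] using this
  have a3 : I.imK = 0 := by
    have : I.re * I.imK = 0 := by linarith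
    simpa [hre] using this
  rw [a1, a2, a3] at e0
  nlinarith

lemma im_eq_self_of_mem {I : ℍ[ℝ]} (h : I ∈ imagUnits) : I.im = I := by
  ext <;> simp [re_eq_zero_of_mem h]

lemma star_of_mem {I : ℍ[ℝ]} (h : I ∈ imagUnits) : star I = -I := by
  ext <;> simp [re_eq_zero_of_mem h]

lemma norm_of_mem {I : ℍ[ℝ]} (h : I ∈ imagUnits) : ‖I‖ = 1 := by
  have h1 : ‖I * I‖ = 1 := by rw [sq_of_mem h]; simp
  rw [norm_mul] at h1
  nlinarith [norm_nonneg I]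

lemma slicePt_re {I : ℍ[ℝ]} (h : I ∈ imagUnits) (z : ℂ) : (slicePt I z).re = z.re := by
  simp [slicePt, re_eq_zero_of_mem h]

lemma slicePt_im {I : ℍ[ℝ]} (h : I ∈ imagUnits) (z : ℂ) : (slicePt I z).im = z.im • I := by
  simp [slicePt, im_eq_self_of_mem h]

lemma norm_slicePt_im {I : ℍ[ℝ]} (h : I ∈ imagUnits) (z : ℂ) :
    ‖(slicePt I z).im‖ = |z.im| := by
  rw [slicePt_im h, norm_smul, norm_of_mem h]; simp

lemma slicePt_neg (I : ℍ[ℝ]) (z : ℂ) : slicePt (-I) z = slicePt I (star z) := by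
  simp [slicePt]

lemma star_slicePt {I : ℍ[ℝ]} (h : I ∈ imagUnits) (z : ℂ) :
    star (slicePt I z) = slicePt (-I) z := by
  simp [slicePt, star_of_mem h]

lemma slicePt_add (I : ℍ[ℝ]) (z w : ℂ) : slicePt I (z + w) = slicePt I z + slicePt I w := by
  simp [slicePt, add_smul]; abel

lemma slicePt_mul {I : ℍ[ℝ]} (h : I ∈ imagUnits) (z w : ℂ) :
    slicePt I (z * w) = slicePt I z * slicePt I w := by
  have h2 := sq_of_mem h
  have hc : ∀ r : ℝ, (r : ℍ[ℝ]) = r • (1 : ℍ[ℝ]) := fun r => by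
    rw [← Quaternion.coe_mul_eq_smul, mul_one]
  simp only [slicePt, hc, Complex.mul_re, Complex.mul_im, add_mul, mul_add, smul_mul_assoc,
    mul_smul_comm, mul_one, one_mul, h2]
  module

lemma slicePt_one (I : ℍ[ℝ]) : slicePt I 1 = 1 := by simp [slicePt]

lemma slicePt_pow {I : ℍ[ℝ]} (h : I ∈ imagUnits) (z : ℂ) (n : ℕ) :
    slicePt I (z ^ n) = slicePt I z ^ n := by
  induction n with
  | zero => simp [slicePt_one]
  | succ n ih => rw [pow_succ, slicePt_mul h, ih, pow_succ]

/-- Every quaternion lies on a slice. -/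
lemma exists_slicePt (q : ℍ[ℝ]) : ∃ I ∈ imagUnits, q = slicePt I ⟨q.re, ‖q.im‖⟩ := by
  by_cases h : q.im = 0
  · refine ⟨_, i_mem, ?_⟩
    have := Quaternion.re_add_im q
    rw [h] at this
    rw [slicePt, h, norm_zero, zero_smul]
    exact this.symm
  · have hn : ‖q.im‖ ≠ 0 := by simpa using h
    refine ⟨‖q.im‖⁻¹ • q.im, ?_, ?_⟩
    · show (‖q.im‖⁻¹ • q.im) ^ 2 = -1
      rw [smul_pow, Quaternion.im_sq, Quaternion.normSq_eq_norm_mul_self, smul_neg,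
        ← Quaternion.coe_smul]
      congr 1
      rw [smul_eq_mul]
      field_simp
      simp
    · simp only [slicePt, smul_smul, mul_inv_cancel₀ hn, one_smul]
      exact (Quaternion.re_add_im q).symm

lemma mem_sphereThrough {p q : ℍ[ℝ]} :
    q ∈ sphereThrough p ↔ q.re = p.re ∧ ‖q.im‖ = ‖p.im‖ := by
  constructor
  · rintro ⟨J, hJ, rfl⟩
    exact ⟨slicePt_re hJ _, by rw [norm_slicePt_im hJ]; simp⟩
  · rintro ⟨h1, h2⟩
    obtain ⟨I, hI, h⟩ := exists_slicePt q
    exact ⟨I, hI, by rw [← h1, ← h2]; exact h⟩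

lemma self_mem_sphereThrough (p : ℍ[ℝ]) : p ∈ sphereThrough p := by
  simp [mem_sphereThrough]

lemma IsCircular.slicePt_mem {U : Set ℍ[ℝ]} (hU : IsCircular U) {I J : ℍ[ℝ]}
    (hI : I ∈ imagUnits) (hJ : J ∈ imagUnits) {z : ℂ} (h : slicePt I z ∈ U) :
    slicePt J z ∈ U :=
  hU _ h (mem_sphereThrough.2
    ⟨by rw [slicePt_re hI, slicePt_re hJ], by rw [norm_slicePt_im hI, norm_slicePt_im hJ]⟩)

lemma IsCircular.inter {U V : Set ℍ[ℝ]} (hU : IsCircular U) (hV : IsCircular V) :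
    IsCircular (U ∩ V) :=
  fun p hp _ hq => ⟨hU p hp.1 hq, hV p hp.2 hq⟩

lemma IsCircular.diff_sphere {V : Set ℍ[ℝ]} (hV : IsCircular V) (p : ℍ[ℝ]) :
    IsCircular (V \ sphereThrough p) := by
  intro a ha b hb
  refine ⟨hV a ha.1 hb, fun hbp => ha.2 ?_⟩
  rw [mem_sphereThrough] at *
  exact ⟨hb.1.symm.trans hbp.1, hb.2.symm.trans hbp.2⟩

lemma conj_slicePt {a : ℍ[ℝ]} (ha : a ≠ 0) (I : ℍ[ℝ]) (z : ℂ) :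
    a⁻¹ * slicePt I z * a = slicePt (a⁻¹ * I * a) z := by
  simp only [slicePt, mul_add, add_mul, mul_smul_comm, smul_mul_assoc]
  rw [← Quaternion.coe_commutes z.re a⁻¹, mul_assoc, inv_mul_cancel₀ ha, mul_one]

lemma conj_mem {a I : ℍ[ℝ]} (ha : a ≠ 0) (hI : I ∈ imagUnits) : a⁻¹ * I * a ∈ imagUnits := by
  show (a⁻¹ * I * a) ^ 2 = -1
  have h2 := sq_of_mem hI
  calc (a⁻¹ * I * a) ^ 2 = a⁻¹ * I * (a * a⁻¹) * I * a := by rw [sq]; simp only [mul_assoc]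
    _ = a⁻¹ * (I * I) * a := by rw [mul_inv_cancel₀ ha]; simp only [mul_assoc, one_mul]
    _ = -1 := by rw [h2]; simp [ha]

lemma continuous_slicePt (I : ℍ[ℝ]) : Continuous (slicePt I) := by
  unfold slicePt
  have : Continuous fun z : ℂ => ((z.re : ℝ) : ℍ[ℝ]) :=
    Quaternion.continuous_coe.comp Complex.continuous_re
  fun_prop

/-! ### The `*`-product and the conjugate in terms of components -/

lemma starMul_slicePt {f g : ℍ[ℝ] → ℍ[ℝ]} {U : Set ℍ[ℝ]} (hU : IsCircular U) {γ δ : ℂ → ℍ[ℝ]}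
    (hg : HasComponents g U γ δ) {I : ℍ[ℝ]} (hI : I ∈ imagUnits) {z : ℂ}
    (hz : slicePt I z ∈ U) :
    starMul f g (slicePt I z) = f (slicePt I z) * γ z + I * f (slicePt I z) * δ z := by
  unfold starMul
  split_ifs with h
  · simp [h]
  · have hc := conj_mem h hI
    rw [conj_slicePt h, hg _ hc z (hU.slicePt_mem hI hc hz), mul_add]
    simp only [← mul_assoc]
    rw [mul_inv_cancel₀ h, one_mul]

lemma HasComponents.starMul {f g : ℍ[ℝ] → ℍ[ℝ]} {U : Set ℍ[ℝ]} (hU : IsCircular U)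
    {α β γ δ : ℂ → ℍ[ℝ]} (hf : HasComponents f U α β) (hg : HasComponents g U γ δ) :
    HasComponents (starMul f g) U (fun z => α z * γ z - β z * δ z)
      (fun z => α z * δ z + β z * γ z) := by
  intro I hI z hz
  rw [starMul_slicePt hU hg hI hz, hf I hI z hz]
  have h2 := sq_of_mem hI
  simp only [add_mul, mul_add, ← mul_assoc, h2]
  simp only [neg_mul, one_mul]
  abel

lemma unitIm_mul {I : ℍ[ℝ]} (hI : I ∈ imagUnits) {z : ℂ} (hz : z.im ≠ 0) (a : ℍ[ℝ]) :
    unitIm (slicePt I z) * a * unitIm (slicePt I z) = I * a * I := by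
  simp only [unitIm, slicePt_im hI, norm_smul, norm_of_mem hI,
    smul_mul_assoc, mul_smul_comm, smul_smul, mul_one, Real.norm_eq_abs]
  have : |z.im|⁻¹ * z.im * (|z.im|⁻¹ * z.im) = 1 := by
    have h1 : |z.im| ≠ 0 := by simpa using hz
    field_simp
    exact (sq_abs _).symm
  rw [this, one_smul]

lemma HasComponents.regConj {f : ℍ[ℝ] → ℍ[ℝ]} {U : Set ℍ[ℝ]} (hU : IsCircular U)
    {α β : ℂ → ℍ[ℝ]} (hf : HasComponents f U α β) :
    HasComponents (regConj f) U (fun z => star (α z)) (fun z => star (β z)) := by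
  intro I hI z hz
  have hs : star (slicePt I z) = slicePt (-I) z := star_slicePt hI z
  have hz' := hU.slicePt_mem hI (neg_mem hI) hz
  have e1 := hf I hI z hz
  have e2 := hf (-I) (neg_mem hI) z hz'
  have a1 : (1 / 2 : ℝ) • (f (slicePt I z) + f (star (slicePt I z))) = α z := by
    rw [hs, e1, e2, neg_mul]
    have : α z + I * β z + (α z + -(I * β z)) = (2 : ℝ) • α z := by rw [two_smul]; abel
    rw [this, smul_smul]; norm_num
  have a2 : (1 / 2 : ℝ) • (f (slicePt I z) - f (star (slicePt I z))) = I * β z := by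
    rw [hs, e1, e2, neg_mul]
    have : α z + I * β z - (α z + -(I * β z)) = (2 : ℝ) • (I * β z) := by rw [two_smul]; abel
    rw [this, smul_smul]; norm_num
  unfold SliceFun.regConj
  rw [a1, a2]
  congr 1
  by_cases h0 : z.im = 0
  · have hb : I * β z = 0 := by
      rw [← a2, hs]
      simp [slicePt, h0]
    have hb' : β z = 0 := by
      simpa [ne_zero_of_mem hI] using hb
    simp [hb']
  · rw [unitIm_mul hI h0, star_mul, star_of_mem hI]
    have h2 := sq_of_mem hI
    simp only [mul_neg, neg_mul, mul_assoc, h2, mul_one, neg_neg]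

/-! ### Components of slice regular functions -/

/-- The Cauchy-Riemann equations for the components of a slice regular function. -/
structure IsStemAt (α β : ℂ → ℍ[ℝ]) (z : ℂ) : Prop where
  left : DifferentiableAt ℝ α z
  right : DifferentiableAt ℝ β z
  cr_one : fderiv ℝ α z 1 = fderiv ℝ β z Complex.I
  cr_I : fderiv ℝ α z Complex.I = -fderiv ℝ β z 1

lemma IsSliceRegular.exists_stem {f : ℍ[ℝ] → ℍ[ℝ]} {U : Set ℍ[ℝ]} (hU : IsCircular U)
    (h : IsSliceRegular f U) :
    ∃ α β : ℂ → ℍ[ℝ], HasComponents f U α β ∧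
      ∀ I ∈ imagUnits, ∀ z, slicePt I z ∈ U → IsStemAt α β z := by
  obtain ⟨α, β, hf⟩ := h.isSlice
  set F : ℂ → ℍ[ℝ] := fun w => f (slicePt unitI w) with hF
  set G : ℂ → ℍ[ℝ] := fun w => f (slicePt (-unitI) w) with hG
  have hii := sq_of_mem i_mem
  refine ⟨fun w => (1 / 2 : ℝ) • (F w + G w), fun w => (-(1 / 2 : ℝ)) • (unitI * (F w - G w)),
    ?_, ?_⟩
  · intro I hI z hz
    have e1 : F z = α z + unitI * β z := hf _ i_mem z (hU.slicePt_mem hI i_mem hz)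
    have e2 : G z = α z + -unitI * β z :=
      hf _ (neg_mem i_mem) z (hU.slicePt_mem hI (neg_mem i_mem) hz)
    have e3 : (1 / 2 : ℝ) • (F z + G z) = α z := by
      rw [e1, e2, neg_mul]; module
    have e4 : (-(1 / 2 : ℝ)) • (unitI * (F z - G z)) = β z := by
      have : F z - G z = (2 : ℝ) • (unitI * β z) := by rw [e1, e2, neg_mul]; module
      rw [this, mul_smul_comm, ← mul_assoc, hii, neg_one_mul]; module
    simp only [e3, e4]
    exact hf I hI z hz
  · intro I hI z hz
    have z1 := hU.slicePt_mem hI i_mem hz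
    have z2 := hU.slicePt_mem hI (neg_mem i_mem) hz
    have d1 : DifferentiableAt ℝ F z := h.differentiableAt _ i_mem z z1
    have d2 : DifferentiableAt ℝ G z := h.differentiableAt _ (neg_mem i_mem) z z2
    have c1 : fderiv ℝ F z 1 + unitI * fderiv ℝ F z Complex.I = 0 := h.holomorphic _ i_mem z z1
    have c2 : fderiv ℝ G z 1 + -unitI * fderiv ℝ G z Complex.I = 0 :=
      h.holomorphic _ (neg_mem i_mem) z z2
    have hα := (d1.hasFDerivAt.add d2.hasFDerivAt).const_smul (1 / 2 : ℝ)
    have hβ := ((d1.hasFDerivAt.sub d2.hasFDerivAt).const_mul unitI).const_smul (-(1 / 2 : ℝ))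
    have hα' : HasFDerivAt (fun w => (1 / 2 : ℝ) • (F w + G w)) _ z := hα
    have hβ' : HasFDerivAt (fun w => (-(1 / 2 : ℝ)) • (unitI * (F w - G w))) _ z := hβ
    have k1 : fderiv ℝ F z 1 = -(unitI * fderiv ℝ F z Complex.I) := eq_neg_of_add_eq_zero_left c1
    have k2 : fderiv ℝ G z 1 = unitI * fderiv ℝ G z Complex.I := by
      rw [neg_mul, ← sub_eq_add_neg, sub_eq_zero] at c2; exact c2
    refine ⟨hα'.differentiableAt, hβ'.differentiableAt, ?_, ?_⟩
    · rw [hα'.fderiv, hβ'.fderiv]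
      simp only [smul_apply, add_apply,
        sub_apply, k1, k2, smul_eq_mul, mul_sub]
      module
    · rw [hα'.fderiv, hβ'.fderiv]
      simp only [smul_apply, add_apply,
        sub_apply, k1, k2, smul_eq_mul, mul_sub, mul_neg, ← mul_assoc, hii,
        neg_one_mul]
      module

lemma eventually_slicePt_mem {U : Set ℍ[ℝ]} (hU : IsOpen U) {I : ℍ[ℝ]} {z : ℂ}
    (hz : slicePt I z ∈ U) : ∀ᶠ w in nhds z, slicePt I w ∈ U :=
  (continuous_slicePt I).continuousAt.eventually (hU.mem_nhds hz)

lemma IsSliceRegular.of_stem {f : ℍ[ℝ] → ℍ[ℝ]} {U : Set ℍ[ℝ]} (hU : IsOpen U)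
    {α β : ℂ → ℍ[ℝ]} (hf : HasComponents f U α β)
    (h : ∀ I ∈ imagUnits, ∀ z, slicePt I z ∈ U → IsStemAt α β z) : IsSliceRegular f U := by
  have key : ∀ I ∈ imagUnits, ∀ z, slicePt I z ∈ U →
      HasFDerivAt (fun w => f (slicePt I w)) (fderiv ℝ α z + I • fderiv ℝ β z) z := by
    intro I hI z hz
    have hs := h I hI z hz
    have hd := hs.left.hasFDerivAt.add (hs.right.hasFDerivAt.const_mul I)
    refine hd.congr_of_eventuallyEq ?_
    filter_upwards [eventually_slicePt_mem hU hz] with w hw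
    exact hf I hI w hw
  refine ⟨⟨α, β, hf⟩, fun I hI z hz => (key I hI z hz).differentiableAt, fun I hI z hz => ?_⟩
  have hs := h I hI z hz
  rw [(key I hI z hz).fderiv]
  simp only [add_apply, smul_apply, smul_eq_mul, hs.cr_one,
    hs.cr_I, mul_add, ← mul_assoc, sq_of_mem hI]
  simp only [mul_neg, neg_mul, one_mul]
  abel

lemma IsStemAt.add {α β γ δ : ℂ → ℍ[ℝ]} {z : ℂ} (h : IsStemAt α β z) (k : IsStemAt γ δ z) :
    IsStemAt (fun w => α w + γ w) (fun w => β w + δ w) z := by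
  refine ⟨h.left.add k.left, h.right.add k.right, ?_, ?_⟩
  · rw [fderiv_fun_add h.left k.left, fderiv_fun_add h.right k.right]
    simp [h.cr_one, k.cr_one]
  · rw [fderiv_fun_add h.left k.left, fderiv_fun_add h.right k.right]
    simp [h.cr_I, k.cr_I]; abel

lemma IsStemAt.neg {α β : ℂ → ℍ[ℝ]} {z : ℂ} (h : IsStemAt α β z) :
    IsStemAt (fun w => -α w) (fun w => -β w) z := by
  refine ⟨h.left.neg, h.right.neg, ?_, ?_⟩
  · rw [fderiv_fun_neg, fderiv_fun_neg]
    simp [h.cr_one]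
  · rw [fderiv_fun_neg, fderiv_fun_neg]
    simp [h.cr_I]

lemma IsStemAt.star {α β : ℂ → ℍ[ℝ]} {z : ℂ} (h : IsStemAt α β z) :
    IsStemAt (fun w => star (α w)) (fun w => star (β w)) z := by
  have : StarModule ℝ ℍ[ℝ] := ⟨fun r a => by ext <;> simp⟩
  have a := h.left.hasFDerivAt.star
  have b := h.right.hasFDerivAt.star
  refine ⟨a.differentiableAt, b.differentiableAt, ?_, ?_⟩
  · rw [a.fderiv, b.fderiv]
    simp [h.cr_one]
  · rw [a.fderiv, b.fderiv]
    simp [h.cr_I]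

lemma IsStemAt.mul {α β γ δ : ℂ → ℍ[ℝ]} {z : ℂ} (h : IsStemAt α β z) (k : IsStemAt γ δ z) :
    IsStemAt (fun w => α w * γ w - β w * δ w) (fun w => α w * δ w + β w * γ w) z := by
  have a := (h.left.hasFDerivAt.mul' k.left.hasFDerivAt).sub
    (h.right.hasFDerivAt.mul' k.right.hasFDerivAt)
  have b := (h.left.hasFDerivAt.mul' k.right.hasFDerivAt).add
    (h.right.hasFDerivAt.mul' k.left.hasFDerivAt)
  have a' : HasFDerivAt (fun w => α w * γ w - β w * δ w) _ z := a
  have b' : HasFDerivAt (fun w => α w * δ w + β w * γ w) _ z := b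
  refine ⟨a'.differentiableAt, b'.differentiableAt, ?_, ?_⟩
  · rw [a'.fderiv, b'.fderiv]
    simp [h.cr_one, h.cr_I, k.cr_one, k.cr_I]
    abel
  · rw [a'.fderiv, b'.fderiv]
    simp [h.cr_one, h.cr_I, k.cr_one, k.cr_I]
    abel

lemma isStemAt_const (a : ℍ[ℝ]) (z : ℂ) : IsStemAt (fun _ => a) (fun _ => 0) z := by
  refine ⟨by fun_prop, by fun_prop, ?_, ?_⟩ <;> simp

/-- A holomorphic function gives the components of a slice preserving regular function. -/
lemma isStemAt_of_holomorphic {P : ℂ → ℂ} {z : ℂ} (h : DifferentiableAt ℂ P z) :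
    IsStemAt (fun w => ((P w).re : ℍ[ℝ])) (fun w => ((P w).im : ℍ[ℝ])) z := by
  have hP : HasFDerivAt P ((fderiv ℂ P z).restrictScalars ℝ) z :=
    h.hasFDerivAt.restrictScalars ℝ
  let c : ℝ →L[ℝ] ℍ[ℝ] := (ContinuousLinearMap.id ℝ ℝ).smulRight (1 : ℍ[ℝ])
  have hc : ∀ r : ℝ, c r = (r : ℍ[ℝ]) := fun r => by
    simp only [c, ContinuousLinearMap.smulRight_apply, ContinuousLinearMap.id_apply]
    rw [← Quaternion.coe_mul_eq_smul, mul_one]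
  have h1 : HasFDerivAt (fun w => ((P w).re : ℍ[ℝ])) (c ∘L Complex.reCLM ∘L
      ((fderiv ℂ P z).restrictScalars ℝ)) z := by
    have := (c ∘L Complex.reCLM).hasFDerivAt.comp z hP
    refine this.congr_of_eventuallyEq (Filter.Eventually.of_forall fun w => ?_)
    simp [hc]
  have h2 : HasFDerivAt (fun w => ((P w).im : ℍ[ℝ])) (c ∘L Complex.imCLM ∘L
      ((fderiv ℂ P z).restrictScalars ℝ)) z := by
    have := (c ∘L Complex.imCLM).hasFDerivAt.comp z hP
    refine this.congr_of_eventuallyEq (Filter.Eventually.of_forall fun w => ?_)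
    simp [hc]
  have hI : fderiv ℂ P z Complex.I = Complex.I * fderiv ℂ P z 1 := by
    have := (fderiv ℂ P z).map_smul Complex.I 1
    simp only [smul_eq_mul, mul_one] at this
    exact this
  refine ⟨h1.differentiableAt, h2.differentiableAt, ?_, ?_⟩
  · rw [h1.fderiv, h2.fderiv]
    simp [hc, hI]
  · rw [h1.fderiv, h2.fderiv]
    simp [hc, hI]

/-! ### Operations on slice regular functions -/

lemma HasComponents.congr {f g : ℍ[ℝ] → ℍ[ℝ]} {U : Set ℍ[ℝ]} {α β : ℂ → ℍ[ℝ]}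
    (hf : HasComponents f U α β) (h : ∀ q ∈ U, g q = f q) : HasComponents g U α β :=
  fun I hI z hz => by rw [h _ hz]; exact hf I hI z hz

lemma HasComponents.mono {f : ℍ[ℝ] → ℍ[ℝ]} {U V : Set ℍ[ℝ]} {α β : ℂ → ℍ[ℝ]}
    (hf : HasComponents f U α β) (h : V ⊆ U) : HasComponents f V α β :=
  fun I hI z hz => hf I hI z (h hz)

lemma IsSliceRegular.mono {f : ℍ[ℝ] → ℍ[ℝ]} {U V : Set ℍ[ℝ]} (hf : IsSliceRegular f U)
    (h : V ⊆ U) : IsSliceRegular f V := by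
  obtain ⟨α, β, hab⟩ := hf.isSlice
  exact ⟨⟨α, β, hab.mono h⟩, fun I hI z hz => hf.differentiableAt I hI z (h hz),
    fun I hI z hz => hf.holomorphic I hI z (h hz)⟩

lemma IsSliceRegular.add {f g : ℍ[ℝ] → ℍ[ℝ]} {U : Set ℍ[ℝ]} (hO : IsOpen U) (hU : IsCircular U)
    (hf : IsSliceRegular f U) (hg : IsSliceRegular g U) :
    IsSliceRegular (fun q => f q + g q) U := by
  obtain ⟨α, β, h1, h2⟩ := hf.exists_stem hU
  obtain ⟨γ, δ, k1, k2⟩ := hg.exists_stem hU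
  refine IsSliceRegular.of_stem hO (α := fun z => α z + γ z) (β := fun z => β z + δ z) ?_
    fun I hI z hz => (h2 I hI z hz).add (k2 I hI z hz)
  intro I hI z hz
  simp only [h1 I hI z hz, k1 I hI z hz, mul_add]
  abel

lemma IsSliceRegular.neg {f : ℍ[ℝ] → ℍ[ℝ]} {U : Set ℍ[ℝ]} (hO : IsOpen U) (hU : IsCircular U)
    (hf : IsSliceRegular f U) : IsSliceRegular (fun q => -f q) U := by
  obtain ⟨α, β, h1, h2⟩ := hf.exists_stem hU
  refine IsSliceRegular.of_stem hO (α := fun z => -α z) (β := fun z => -β z) ?_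
    fun I hI z hz => (h2 I hI z hz).neg
  intro I hI z hz
  simp only [h1 I hI z hz, mul_neg]
  abel

lemma IsSliceRegular.starMul {f g : ℍ[ℝ] → ℍ[ℝ]} {U : Set ℍ[ℝ]} (hO : IsOpen U)
    (hU : IsCircular U) (hf : IsSliceRegular f U) (hg : IsSliceRegular g U) :
    IsSliceRegular (starMul f g) U := by
  obtain ⟨α, β, h1, h2⟩ := hf.exists_stem hU
  obtain ⟨γ, δ, k1, k2⟩ := hg.exists_stem hU
  exact IsSliceRegular.of_stem hO (h1.starMul hU k1)
    fun I hI z hz => (h2 I hI z hz).mul (k2 I hI z hz)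

lemma IsSliceRegular.regConj {f : ℍ[ℝ] → ℍ[ℝ]} {U : Set ℍ[ℝ]} (hO : IsOpen U)
    (hU : IsCircular U) (hf : IsSliceRegular f U) : IsSliceRegular (regConj f) U := by
  obtain ⟨α, β, h1, h2⟩ := hf.exists_stem hU
  exact IsSliceRegular.of_stem hO (h1.regConj hU) fun I hI z hz => (h2 I hI z hz).star

lemma isSliceRegular_const (a : ℍ[ℝ]) {U : Set ℍ[ℝ]} (hO : IsOpen U) :
    IsSliceRegular (fun _ => a) U :=
  IsSliceRegular.of_stem hO (α := fun _ => a) (β := fun _ => 0) (fun I _ z _ => by simp)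
    fun _ _ z _ => isStemAt_const a z

/-- The complex polynomial inducing `Delta p`. -/
def deltaPoly (p : ℍ[ℝ]) (z : ℂ) : ℂ := z ^ 2 - (2 * p.re : ℝ) * z + (‖p‖ ^ 2 : ℝ)

lemma Delta_slicePt {I : ℍ[ℝ]} (hI : I ∈ imagUnits) (p : ℍ[ℝ]) (z : ℂ) :
    Delta p (slicePt I z) = slicePt I (deltaPoly p z) := by
  have hr : ∀ r : ℝ, slicePt I (r : ℂ) = (r : ℍ[ℝ]) := fun r => by simp [slicePt]
  have hn : ∀ w : ℂ, slicePt I (-w) = -slicePt I w := fun w => by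
    simp only [slicePt, Complex.neg_re, Complex.neg_im, Quaternion.coe_neg, neg_smul]; abel
  unfold Delta deltaPoly
  rw [slicePt_add, sub_eq_add_neg (z ^ 2), slicePt_add, hn, slicePt_mul hI, slicePt_pow hI, hr, hr,
    ← sub_eq_add_neg, Quaternion.coe_mul_eq_smul]

lemma Delta_pow_slicePt {I : ℍ[ℝ]} (hI : I ∈ imagUnits) (p : ℍ[ℝ]) (z : ℂ) (n : ℕ) :
    Delta p (slicePt I z) ^ n = slicePt I (deltaPoly p z ^ n) := by
  rw [Delta_slicePt hI, slicePt_pow hI]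

lemma slicePt_eq (I : ℍ[ℝ]) (z : ℂ) : slicePt I z = (z.re : ℍ[ℝ]) + I * (z.im : ℍ[ℝ]) := by
  rw [slicePt, ← Quaternion.coe_mul_eq_smul, Quaternion.coe_commutes]

/-- Multiplication of the components by a slice preserving function. -/
lemma slicePt_mul_components {I : ℍ[ℝ]} (hI : I ∈ imagUnits) (w : ℂ) (a b : ℍ[ℝ]) :
    slicePt I w * (a + I * b) =
      ((w.re : ℍ[ℝ]) * a - (w.im : ℍ[ℝ]) * b) + I * ((w.re : ℍ[ℝ]) * b + (w.im : ℍ[ℝ]) * a) := by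
  have h2 := sq_of_mem hI
  simp only [slicePt, Quaternion.coe_mul_eq_smul]
  have hc : (w.re : ℍ[ℝ]) = w.re • (1 : ℍ[ℝ]) := by rw [← Quaternion.coe_mul_eq_smul, mul_one]
  simp only [hc, add_mul, mul_add, smul_mul_assoc, mul_smul_comm, one_mul, ← mul_assoc, h2,
    neg_one_mul]
  module

lemma isSliceRegular_Delta_mul {f : ℍ[ℝ] → ℍ[ℝ]} {U : Set ℍ[ℝ]} (hO : IsOpen U)
    (hU : IsCircular U) (hf : IsSliceRegular f U) (p : ℍ[ℝ]) (n : ℕ) :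
    IsSliceRegular (fun q => Delta p q ^ n * f q) U := by
  obtain ⟨α, β, h1, h2⟩ := hf.exists_stem hU
  refine IsSliceRegular.of_stem hO
    (α := fun z => ((deltaPoly p z ^ n).re : ℍ[ℝ]) * α z - ((deltaPoly p z ^ n).im : ℍ[ℝ]) * β z)
    (β := fun z => ((deltaPoly p z ^ n).re : ℍ[ℝ]) * β z + ((deltaPoly p z ^ n).im : ℍ[ℝ]) * α z)
    ?_ fun I hI z hz => (isStemAt_of_holomorphic (P := fun z => deltaPoly p z ^ n) ?_).mul
      (h2 I hI z hz)
  · intro I hI z hz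
    simp only [h1 I hI z hz, Delta_pow_slicePt hI, slicePt_mul_components hI]
  · unfold deltaPoly; fun_prop

/-! ### Algebraic identities for the `*`-product -/

lemma starMul_assoc {f g h : ℍ[ℝ] → ℍ[ℝ]} {U : Set ℍ[ℝ]} (hU : IsCircular U)
    (hg : ∃ α β, HasComponents g U α β) (hh : ∃ α β, HasComponents h U α β) {q : ℍ[ℝ]}
    (hq : q ∈ U) : starMul (starMul f g) h q = starMul f (starMul g h) q := by
  obtain ⟨α, β, h1⟩ := hg
  obtain ⟨γ, δ, h2⟩ := hh
  obtain ⟨I, hI, e⟩ := exists_slicePt q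
  rw [e] at hq ⊢
  rw [starMul_slicePt hU h2 hI hq, starMul_slicePt hU (h1.starMul hU h2) hI hq,
    starMul_slicePt hU h1 hI hq]
  simp only [mul_add, add_mul, mul_sub, ← mul_assoc, sq_of_mem hI, neg_mul, one_mul]
  abel

lemma starMul_add {f g h : ℍ[ℝ] → ℍ[ℝ]} (q : ℍ[ℝ]) :
    starMul f (fun q => g q + h q) q = starMul f g q + starMul f h q := by
  unfold starMul
  split_ifs <;> simp [mul_add]

lemma add_starMul {f g h : ℍ[ℝ] → ℍ[ℝ]} {U : Set ℍ[ℝ]} (hU : IsCircular U)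
    (hh : ∃ α β, HasComponents h U α β) {q : ℍ[ℝ]} (hq : q ∈ U) :
    starMul (fun q => f q + g q) h q = starMul f h q + starMul g h q := by
  obtain ⟨γ, δ, h2⟩ := hh
  obtain ⟨I, hI, e⟩ := exists_slicePt q
  rw [e] at hq ⊢
  rw [starMul_slicePt hU h2 hI hq, starMul_slicePt hU h2 hI hq, starMul_slicePt hU h2 hI hq]
  simp only [mul_add, add_mul]
  abel

lemma starMul_congr {f f' g g' : ℍ[ℝ] → ℍ[ℝ]} {U : Set ℍ[ℝ]} (hU : IsCircular U)
    (hf : ∀ q ∈ U, f q = f' q) (hg : ∀ q ∈ U, g q = g' q) {q : ℍ[ℝ]} (hq : q ∈ U) :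
    starMul f g q = starMul f' g' q := by
  unfold starMul
  rw [← hf q hq]
  split_ifs with h
  · rfl
  · obtain ⟨I, hI, e⟩ := exists_slicePt q
    congr 1
    apply hg
    rw [e] at hq h ⊢
    rw [conj_slicePt h]
    exact hU.slicePt_mem hI (conj_mem h hI) hq

lemma slicePt_commute {I : ℍ[ℝ]} (hI : I ∈ imagUnits) (z w : ℂ) :
    slicePt I z * slicePt I w = slicePt I w * slicePt I z := by
  rw [← slicePt_mul hI, mul_comm, slicePt_mul hI]

/-- On the left, `*`-multiplication by a slice preserving function is pointwise. -/
lemma IsSlicePreserving.starMul_eq {c f : ℍ[ℝ] → ℍ[ℝ]} {U : Set ℍ[ℝ]}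
    (hc : IsSlicePreserving c U) {q : ℍ[ℝ]} (hq : q ∈ U) : starMul c f q = c q * f q := by
  unfold starMul
  split_ifs with h
  · simp [h]
  · obtain ⟨I, hI, e⟩ := exists_slicePt q
    obtain ⟨w, hw⟩ := hc I hI q ⟨hq, ⟨_, e.symm⟩⟩
    have hcomm : q * c q = c q * q := by
      rw [← hw, e]; exact slicePt_commute hI _ _
    rw [mul_assoc, hcomm, ← mul_assoc, inv_mul_cancel₀ h, one_mul]

lemma mem_lines_real {a : ℍ[ℝ]} (h1 : a ∈ complexLine unitI) (h2 : a ∈ complexLine unitJ) :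
    a = (a.re : ℍ[ℝ]) := by
  obtain ⟨z, rfl⟩ := h1
  obtain ⟨w, hw⟩ := h2
  have e1 := congrArg (fun q : ℍ[ℝ] => q.imI) hw
  have i0 : unitI.imI = 1 := rfl
  have j0 : unitJ.imI = 0 := rfl
  simp [slicePt, i0, j0] at e1
  simp [slicePt, ← e1]

lemma add_mem_line {I a b : ℍ[ℝ]} (ha : a ∈ complexLine I) (hb : b ∈ complexLine I) :
    a + b ∈ complexLine I := by
  obtain ⟨z, rfl⟩ := ha
  obtain ⟨w, rfl⟩ := hb
  exact ⟨z + w, slicePt_add I z w⟩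

lemma mul_mem_line {I a b : ℍ[ℝ]} (hI : I ∈ imagUnits) (ha : a ∈ complexLine I)
    (hb : b ∈ complexLine I) : a * b ∈ complexLine I := by
  obtain ⟨z, rfl⟩ := ha
  obtain ⟨w, rfl⟩ := hb
  exact ⟨z * w, slicePt_mul hI z w⟩

lemma real_mem_line (I : ℍ[ℝ]) (r : ℝ) : (r : ℍ[ℝ]) ∈ complexLine I :=
  ⟨r, by simp [slicePt]⟩

lemma neg_mem_line {I a : ℍ[ℝ]} (ha : a ∈ complexLine I) : -a ∈ complexLine I := by
  obtain ⟨z, rfl⟩ := ha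
  refine ⟨-z, ?_⟩
  simp only [slicePt, Complex.neg_re, Complex.neg_im, Quaternion.coe_neg, neg_smul]
  abel

lemma self_mem_line (I : ℍ[ℝ]) : I ∈ complexLine I := ⟨Complex.I, by simp [slicePt]⟩

lemma complexLine_neg (I : ℍ[ℝ]) : complexLine (-I) = complexLine I := by
  ext a
  constructor
  · rintro ⟨z, rfl⟩; exact ⟨star z, (slicePt_neg I z).symm⟩
  · rintro ⟨z, rfl⟩; exact ⟨star z, by rw [slicePt_neg, star_star]⟩

/-- The components of a slice preserving slice function are real. -/
lemma HasComponents.real {c : ℍ[ℝ] → ℍ[ℝ]} {U : Set ℍ[ℝ]} (hU : IsCircular U)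
    {α β : ℂ → ℍ[ℝ]} (hc : HasComponents c U α β) (hp : IsSlicePreserving c U) {I : ℍ[ℝ]}
    (hI : I ∈ imagUnits) {z : ℂ} (hz : slicePt I z ∈ U) :
    α z = ((α z).re : ℍ[ℝ]) ∧ β z = ((β z).re : ℍ[ℝ]) := by
  have key : ∀ J ∈ imagUnits, α z ∈ complexLine J ∧ β z ∈ complexLine J := by
    intro J hJ
    have z1 := hU.slicePt_mem hI hJ hz
    have z2 := hU.slicePt_mem hI (neg_mem hJ) hz
    have m1 : c (slicePt J z) ∈ complexLine J := hp J hJ _ ⟨z1, ⟨z, rfl⟩⟩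
    have m2 : c (slicePt (-J) z) ∈ complexLine J := by
      rw [← complexLine_neg]; exact hp (-J) (neg_mem hJ) _ ⟨z2, ⟨z, rfl⟩⟩
    have e1 := hc J hJ z z1
    have e2 := hc (-J) (neg_mem hJ) z z2
    constructor
    · have : α z = ((1 / 2 : ℝ) : ℍ[ℝ]) * (c (slicePt J z) + c (slicePt (-J) z)) := by
        rw [e1, e2, neg_mul, Quaternion.coe_mul_eq_smul]; module
      rw [this]
      exact mul_mem_line hJ (real_mem_line _ _) (add_mem_line m1 m2)
    · have : β z = ((1 / 2 : ℝ) : ℍ[ℝ]) *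
          (-J * (c (slicePt J z) + -c (slicePt (-J) z))) := by
        have e3 : c (slicePt J z) + -c (slicePt (-J) z) = (2 : ℝ) • (J * β z) := by
          rw [e1, e2, neg_mul]; module
        rw [e3, Quaternion.coe_mul_eq_smul, mul_smul_comm, neg_mul, ← mul_assoc, sq_of_mem hJ,
          neg_one_mul]
        module
      rw [this]
      exact mul_mem_line hJ (real_mem_line _ _)
        (mul_mem_line hJ (neg_mem_line (self_mem_line J)) (add_mem_line m1 (neg_mem_line m2)))
  exact ⟨mem_lines_real (key _ i_mem).1 (key _ j_mem).1,
    mem_lines_real (key _ i_mem).2 (key _ j_mem).2⟩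

/-- Slice preserving regular functions are central. -/
lemma IsSlicePreserving.starMul_comm {c f : ℍ[ℝ] → ℍ[ℝ]} {U : Set ℍ[ℝ]} (hU : IsCircular U)
    (hc : IsSlicePreserving c U) (hs : ∃ α β, HasComponents c U α β) {q : ℍ[ℝ]} (hq : q ∈ U) :
    starMul c f q = starMul f c q := by
  obtain ⟨α, β, h⟩ := hs
  obtain ⟨I, hI, e⟩ := exists_slicePt q
  rw [hc.starMul_eq hq]
  rw [e] at hq ⊢
  rw [starMul_slicePt hU h hI hq, h I hI _ hq]
  obtain ⟨h1, h2⟩ := h.real hU hc hI hq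
  rw [h1, h2, add_mul, mul_assoc, mul_assoc, Quaternion.coe_commutes, Quaternion.coe_commutes]

/-! ### Operations on semi-regular functions -/

lemma IsSemiRegularOn.isPole_all {f : ℍ[ℝ] → ℍ[ℝ]} {Ω U : Set ℍ[ℝ]} (h : IsSemiRegularOn f Ω U)
    {p : ℍ[ℝ]} (hp : p ∈ Ω) : IsPoleOrRemovable f U p := by
  by_cases hU : p ∈ U
  · exact ⟨U, h.isOpen, h.isCircular, hU, Set.sdiff_subset, 0, f, h.isSliceRegular, by simp⟩
  · exact h.isPole p ⟨hp, hU⟩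

lemma IsSemiRegularOn.isCircularDense {f : ℍ[ℝ] → ℍ[ℝ]} {Ω U : Set ℍ[ℝ]}
    (h : IsSemiRegularOn f Ω U) : IsCircularDense U Ω := by
  refine ⟨h.subset, h.isOpen, h.isCircular, fun p hp => ?_⟩
  obtain ⟨V, hV, -, hpV, hVU, -⟩ := h.isPole_all hp
  rw [mem_closure_iff]
  intro W hW hpW
  have hc : Continuous fun t : ℝ => p + (t : ℍ[ℝ]) := by
    have := Quaternion.continuous_coe
    fun_prop
  have hev : ∀ᶠ t : ℝ in nhds 0, p + (t : ℍ[ℝ]) ∈ W ∩ V :=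
    hc.continuousAt.eventually ((hW.inter hV).mem_nhds (by simpa using ⟨hpW, hpV⟩))
  have hev' : ∀ᶠ t : ℝ in nhdsWithin 0 {0}ᶜ, p + (t : ℍ[ℝ]) ∈ W ∩ V :=
    hev.filter_mono nhdsWithin_le_nhds
  obtain ⟨t, ht, ht0⟩ := (hev'.and self_mem_nhdsWithin).exists
  refine ⟨p + (t : ℍ[ℝ]), ht.1, hVU ⟨ht.2, fun hs => ht0 ?_⟩⟩
  rw [mem_sphereThrough] at hs
  simpa using hs.1

lemma IsCircularDense.inter {U V Ω : Set ℍ[ℝ]} (hU : IsCircularDense U Ω)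
    (hV : IsCircularDense V Ω) : IsCircularDense (U ∩ V) Ω := by
  refine ⟨fun q hq => hU.subset hq.1, hU.isOpen.inter hV.isOpen,
    hU.isCircular.inter hV.isCircular, fun p hp => ?_⟩
  rw [mem_closure_iff]
  intro W hW hpW
  obtain ⟨a, haW, haU⟩ := mem_closure_iff.1 (hU.dense hp) W hW hpW
  obtain ⟨b, hbW, hbV⟩ := mem_closure_iff.1 (hV.dense (hU.subset haU)) (W ∩ U)
    (hW.inter hU.isOpen) ⟨haW, haU⟩
  exact ⟨b, hbW.1, hbW.2, hbV⟩

lemma IsSemiRegularOn.add {f g : ℍ[ℝ] → ℍ[ℝ]} {Ω U V : Set ℍ[ℝ]} (hf : IsSemiRegularOn f Ω U)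
    (hg : IsSemiRegularOn g Ω V) : IsSemiRegularOn (fun q => f q + g q) Ω (U ∩ V) := by
  have hO := hf.isOpen.inter hg.isOpen
  have hC := hf.isCircular.inter hg.isCircular
  refine ⟨fun q hq => hf.subset hq.1, hO, hC,
    (hf.isSliceRegular.mono Set.inter_subset_left).add hO hC
      (hg.isSliceRegular.mono Set.inter_subset_right), fun p hp => ?_⟩
  obtain ⟨A, hA, hA', hpA, hAU, n, F, hF, hFf⟩ := hf.isPole_all hp.1
  obtain ⟨B, hB, hB', hpB, hBV, m, G, hG, hGg⟩ := hg.isPole_all hp.1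
  have hO' := hA.inter hB
  have hC' := hA'.inter hB'
  refine ⟨A ∩ B, hO', hC', ⟨hpA, hpB⟩,
    fun q hq => ⟨hAU ⟨hq.1.1, hq.2⟩, hBV ⟨hq.1.2, hq.2⟩⟩, m + n,
    fun q => Delta p q ^ m * F q + Delta p q ^ n * G q,
    (isSliceRegular_Delta_mul hO' hC' (hF.mono Set.inter_subset_left) p m).add hO' hC'
      (isSliceRegular_Delta_mul hO' hC' (hG.mono Set.inter_subset_right) p n), fun q hq => ?_⟩
  show Delta p q ^ m * F q + Delta p q ^ n * G q = Delta p q ^ (m + n) * (f q + g q)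
  rw [hFf q ⟨hq.1.1, hq.2⟩, hGg q ⟨hq.1.2, hq.2⟩, ← mul_assoc, ← mul_assoc, ← pow_add, ← pow_add,
    add_comm n m, mul_add]

lemma IsSemiRegularOn.neg {f : ℍ[ℝ] → ℍ[ℝ]} {Ω U : Set ℍ[ℝ]} (hf : IsSemiRegularOn f Ω U) :
    IsSemiRegularOn (fun q => -f q) Ω U := by
  refine ⟨hf.subset, hf.isOpen, hf.isCircular, hf.isSliceRegular.neg hf.isOpen hf.isCircular,
    fun p hp => ?_⟩
  obtain ⟨A, hA, hA', hpA, hAU, n, F, hF, hFf⟩ := hf.isPole p hp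
  exact ⟨A, hA, hA', hpA, hAU, n, fun q => -F q, hF.neg hA hA', fun q hq => by
    simp only [hFf q hq, mul_neg]⟩

lemma IsSemiRegularOn.starMul {f g : ℍ[ℝ] → ℍ[ℝ]} {Ω U V : Set ℍ[ℝ]}
    (hf : IsSemiRegularOn f Ω U) (hg : IsSemiRegularOn g Ω V) :
    IsSemiRegularOn (starMul f g) Ω (U ∩ V) := by
  have hO := hf.isOpen.inter hg.isOpen
  have hC := hf.isCircular.inter hg.isCircular
  refine ⟨fun q hq => hf.subset hq.1, hO, hC,
    (hf.isSliceRegular.mono Set.inter_subset_left).starMul hO hC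
      (hg.isSliceRegular.mono Set.inter_subset_right), fun p hp => ?_⟩
  obtain ⟨A, hA, hA', hpA, hAU, n, F, hF, hFf⟩ := hf.isPole_all hp.1
  obtain ⟨B, hB, hB', hpB, hBV, m, G, hG, hGg⟩ := hg.isPole_all hp.1
  have hO' := hA.inter hB
  have hC' := hA'.inter hB'
  refine ⟨A ∩ B, hO', hC', ⟨hpA, hpB⟩,
    fun q hq => ⟨hAU ⟨hq.1.1, hq.2⟩, hBV ⟨hq.1.2, hq.2⟩⟩, n + m, SliceFun.starMul F G,
    (hF.mono Set.inter_subset_left).starMul hO' hC' (hG.mono Set.inter_subset_right),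
    fun q hq => ?_⟩
  have hC'' := hC'.diff_sphere p
  obtain ⟨γ, δ, h⟩ := hg.isSliceRegular.isSlice
  have hVs : (A ∩ B) \ sphereThrough p ⊆ V := fun q hq => hBV ⟨hq.1.2, hq.2⟩
  have h' : HasComponents g ((A ∩ B) \ sphereThrough p) γ δ := h.mono hVs
  have hG' : HasComponents G ((A ∩ B) \ sphereThrough p)
      (fun z => ((deltaPoly p z ^ m).re : ℍ[ℝ]) * γ z - ((deltaPoly p z ^ m).im : ℍ[ℝ]) * δ z)
      (fun z => ((deltaPoly p z ^ m).re : ℍ[ℝ]) * δ z + ((deltaPoly p z ^ m).im : ℍ[ℝ]) * γ z) := by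
    intro I hI z hz
    rw [hGg _ ⟨hz.1.2, hz.2⟩, h' I hI z hz, Delta_pow_slicePt hI, slicePt_mul_components hI]
  obtain ⟨I, hI, e⟩ := exists_slicePt q
  rw [e] at hq ⊢
  rw [starMul_slicePt hC'' hG' hI hq, starMul_slicePt hC'' h' hI hq, hFf _ ⟨hq.1.1, hq.2⟩, pow_add,
    Delta_pow_slicePt hI, Delta_pow_slicePt hI]
  generalize f (slicePt I _) = a
  generalize γ _ = c
  generalize δ _ = d
  generalize deltaPoly p _ ^ n = u
  generalize deltaPoly p _ ^ m = w
  have hIu : I * slicePt I u = slicePt I u * I := by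
    have : slicePt I Complex.I = I := by simp [slicePt]
    have h := slicePt_commute hI Complex.I u
    rwa [this] at h
  have hc : ∀ r : ℝ, (r : ℍ[ℝ]) = r • (1 : ℍ[ℝ]) := fun r => by
    rw [← Quaternion.coe_mul_eq_smul, mul_one]
  have e1 : I * (slicePt I u * a) = slicePt I u * (I * a) := by
    rw [← mul_assoc, hIu, mul_assoc]
  have h2 : ∀ x : ℍ[ℝ], I * (I * x) = -x := fun x => by
    rw [← mul_assoc, sq_of_mem hI, neg_one_mul]
  have key : a * ((w.re : ℍ[ℝ]) * c - (w.im : ℍ[ℝ]) * d) +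
      I * a * ((w.re : ℍ[ℝ]) * d + (w.im : ℍ[ℝ]) * c) = slicePt I w * (a * c + I * a * d) := by
    simp only [slicePt, hc, add_mul, mul_add, mul_sub, smul_mul_assoc, mul_smul_comm, one_mul,
      mul_assoc, h2]
    module
  rw [e1, mul_assoc (slicePt I u) (slicePt I w), ← key]
  simp only [mul_assoc, mul_add]

lemma HasComponents_Delta_conj {f F : ℍ[ℝ] → ℍ[ℝ]} {U : Set ℍ[ℝ]} (hU : IsCircular U)
    (hf : ∃ α β, HasComponents f U α β) {p : ℍ[ℝ]} {n : ℕ}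
    (hF : ∀ q ∈ U, F q = Delta p q ^ n * f q) {q : ℍ[ℝ]} (hq : q ∈ U) :
    regConj F q = Delta p q ^ n * regConj f q := by
  obtain ⟨α, β, h⟩ := hf
  have hF' : HasComponents F U
      (fun z => ((deltaPoly p z ^ n).re : ℍ[ℝ]) * α z - ((deltaPoly p z ^ n).im : ℍ[ℝ]) * β z)
      (fun z => ((deltaPoly p z ^ n).re : ℍ[ℝ]) * β z + ((deltaPoly p z ^ n).im : ℍ[ℝ]) * α z) := by
    intro I hI z hz
    rw [hF _ hz, h I hI z hz, Delta_pow_slicePt hI, slicePt_mul_components hI]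
  obtain ⟨I, hI, e⟩ := exists_slicePt q
  rw [e] at hq ⊢
  rw [hF'.regConj hU I hI _ hq, h.regConj hU I hI _ hq, Delta_pow_slicePt hI,
    slicePt_mul_components hI]
  simp only [star_sub, star_add, star_mul, Quaternion.star_coe, Quaternion.coe_commutes]

lemma IsSemiRegularOn.regConj {f : ℍ[ℝ] → ℍ[ℝ]} {Ω U : Set ℍ[ℝ]} (hf : IsSemiRegularOn f Ω U) :
    IsSemiRegularOn (regConj f) Ω U := by
  refine ⟨hf.subset, hf.isOpen, hf.isCircular, hf.isSliceRegular.regConj hf.isOpen hf.isCircular,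
    fun p hp => ?_⟩
  obtain ⟨A, hA, hA', hpA, hAU, n, F, hF, hFf⟩ := hf.isPole p hp
  obtain ⟨α, β, h⟩ := hf.isSliceRegular.isSlice
  exact ⟨A, hA, hA', hpA, hAU, n, SliceFun.regConj F, hF.regConj hA hA',
    fun q hq => HasComponents_Delta_conj (hA'.diff_sphere p) ⟨α, β, h.mono hAU⟩ hFf hq⟩

lemma regConj_congr {f g : ℍ[ℝ] → ℍ[ℝ]} {U : Set ℍ[ℝ]} (hU : IsCircular U)
    (h : ∀ q ∈ U, f q = g q) {q : ℍ[ℝ]} (hq : q ∈ U) : regConj f q = regConj g q := by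
  have hs : star q ∈ U := hU q hq (mem_sphereThrough.2 (by simp))
  simp only [regConj, h q hq, h _ hs]

/-! ### The algebra of semi-regular functions -/

/-- The semi-regular functions on `Ω`, as functions `ℍ → ℍ`. -/
def SemiRegularFun (Ω : Set ℍ[ℝ]) : Type := {f : ℍ[ℝ] → ℍ[ℝ] // IsSemiRegular f Ω}

/-- Two semi-regular functions on `Ω` are identified if they agree on a circular open dense subset
of `Ω`; by continuity, this means that they agree wherever both are regular. -/
def semiRegularSetoid (Ω : Set ℍ[ℝ]) : Setoid (SemiRegularFun Ω) where
  r f g := ∃ U, IsCircularDense U Ω ∧ ∀ q ∈ U, f.1 q = g.1 q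
  iseqv :=
    { refl := fun f => by
        obtain ⟨U, hU⟩ := f.2
        exact ⟨U, hU.isCircularDense, fun _ _ => rfl⟩
      symm := fun ⟨U, hU, h⟩ => ⟨U, hU, fun q hq => (h q hq).symm⟩
      trans := fun ⟨U, hU, h⟩ ⟨V, hV, k⟩ =>
        ⟨U ∩ V, hU.inter hV, fun q hq => (h q hq.1).trans (k q hq.2)⟩ }

lemma isSemiRegular_add {f g : ℍ[ℝ] → ℍ[ℝ]} {Ω : Set ℍ[ℝ]} (hf : IsSemiRegular f Ω)
    (hg : IsSemiRegular g Ω) : IsSemiRegular (fun q => f q + g q) Ω :=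
  ⟨_, hf.choose_spec.add hg.choose_spec⟩

lemma isSemiRegular_neg {f : ℍ[ℝ] → ℍ[ℝ]} {Ω : Set ℍ[ℝ]} (hf : IsSemiRegular f Ω) :
    IsSemiRegular (fun q => -f q) Ω :=
  ⟨_, hf.choose_spec.neg⟩

lemma isSemiRegular_starMul {f g : ℍ[ℝ] → ℍ[ℝ]} {Ω : Set ℍ[ℝ]} (hf : IsSemiRegular f Ω)
    (hg : IsSemiRegular g Ω) : IsSemiRegular (starMul f g) Ω :=
  ⟨_, hf.choose_spec.starMul hg.choose_spec⟩

lemma isSemiRegular_regConj {f : ℍ[ℝ] → ℍ[ℝ]} {Ω : Set ℍ[ℝ]} (hf : IsSemiRegular f Ω) :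
    IsSemiRegular (regConj f) Ω :=
  ⟨_, hf.choose_spec.regConj⟩

lemma isSemiRegular_const (Ω : CircularDomain) (a : ℍ[ℝ]) :
    IsSemiRegularOn (fun _ => a) Ω.carrier Ω.carrier :=
  ⟨subset_rfl, Ω.isOpen, Ω.isCircular, isSliceRegular_const a Ω.isOpen, by simp⟩

/-- The algebra `SEM(Ω)` of slice semi-regular functions on `Ω`. -/
def SEM (Ω : CircularDomain) : Type := Quotient (semiRegularSetoid Ω.carrier)

namespace SEM

variable {Ω : CircularDomain}

/-- The element of `SEM(Ω)` given by a semi-regular function. -/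
def mk (f : ℍ[ℝ] → ℍ[ℝ]) (hf : IsSemiRegular f Ω.carrier) : SEM Ω :=
  Quotient.mk (semiRegularSetoid Ω.carrier) ⟨f, hf⟩

lemma mk_eq {f g : ℍ[ℝ] → ℍ[ℝ]} {hf : IsSemiRegular f Ω.carrier}
    {hg : IsSemiRegular g Ω.carrier} {U : Set ℍ[ℝ]} (hU : IsCircularDense U Ω.carrier)
    (h : ∀ q ∈ U, f q = g q) : mk f hf = mk g hg :=
  Quotient.sound ⟨U, hU, h⟩

lemma ind {P : SEM Ω → Prop}
    (h : ∀ (f : ℍ[ℝ] → ℍ[ℝ]) (U : Set ℍ[ℝ]) (hf : IsSemiRegularOn f Ω.carrier U), P (mk f ⟨U, hf⟩))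
    (a : SEM Ω) : P a := by
  induction a using Quotient.inductionOn with
  | _ f =>
    obtain ⟨f, U, hU⟩ := f
    exact h f U hU

/-- The constant function `a`. -/
def const (a : ℍ[ℝ]) : SEM Ω := mk (fun _ => a) ⟨_, isSemiRegular_const Ω a⟩

instance : Zero (SEM Ω) := ⟨const 0⟩

instance : One (SEM Ω) := ⟨const 1⟩

instance : Add (SEM Ω) :=
  ⟨Quotient.map₂ (fun f g => ⟨fun q => f.1 q + g.1 q, isSemiRegular_add f.2 g.2⟩)
    fun _ _ ⟨U, hU, h⟩ _ _ ⟨V, hV, k⟩ =>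
      ⟨U ∩ V, hU.inter hV, fun q hq => congrArg₂ (· + ·) (h q hq.1) (k q hq.2)⟩⟩

instance : Neg (SEM Ω) :=
  ⟨Quotient.map (fun f => ⟨fun q => -f.1 q, isSemiRegular_neg f.2⟩)
    fun _ _ ⟨U, hU, h⟩ => ⟨U, hU, fun q hq => congrArg (- ·) (h q hq)⟩⟩

/-- Multiplication in `SEM(Ω)` is the `*`-product. -/
instance : Mul (SEM Ω) :=
  ⟨Quotient.map₂ (fun f g => ⟨starMul f.1 g.1, isSemiRegular_starMul f.2 g.2⟩)
    fun _ _ ⟨U, hU, h⟩ _ _ ⟨V, hV, k⟩ =>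
      ⟨U ∩ V, hU.inter hV, fun _ hq => starMul_congr (hU.inter hV).isCircular
        (fun q hq => h q hq.1) (fun q hq => k q hq.2) hq⟩⟩

/-- The regular conjugate `f^c` of a semi-regular function. -/
def conj : SEM Ω → SEM Ω :=
  Quotient.map (fun f => ⟨regConj f.1, isSemiRegular_regConj f.2⟩)
    fun _ _ ⟨U, hU, h⟩ => ⟨U, hU, fun _ hq => regConj_congr hU.isCircular h hq⟩

lemma zero_def : (0 : SEM Ω) = mk (fun _ => 0) ⟨_, isSemiRegular_const Ω 0⟩ := rfl

lemma one_def : (1 : SEM Ω) = mk (fun _ => 1) ⟨_, isSemiRegular_const Ω 1⟩ := rfl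

lemma mk_add {f g : ℍ[ℝ] → ℍ[ℝ]} (hf : IsSemiRegular f Ω.carrier)
    (hg : IsSemiRegular g Ω.carrier) :
    mk f hf + mk g hg = mk (fun q => f q + g q) (isSemiRegular_add hf hg) := rfl

lemma mk_neg {f : ℍ[ℝ] → ℍ[ℝ]} (hf : IsSemiRegular f Ω.carrier) :
    -mk f hf = mk (fun q => -f q) (isSemiRegular_neg hf) := rfl

lemma mk_mul {f g : ℍ[ℝ] → ℍ[ℝ]} (hf : IsSemiRegular f Ω.carrier)
    (hg : IsSemiRegular g Ω.carrier) :
    mk f hf * mk g hg = mk (starMul f g) (isSemiRegular_starMul hf hg) := rfl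

lemma conj_mk {f : ℍ[ℝ] → ℍ[ℝ]} (hf : IsSemiRegular f Ω.carrier) :
    conj (mk f hf) = mk (regConj f) (isSemiRegular_regConj hf) := rfl

lemma isCircularDense_self (Ω : CircularDomain) : IsCircularDense Ω.carrier Ω.carrier :=
  (isSemiRegular_const Ω 0).isCircularDense

instance : Ring (SEM Ω) where
  add_assoc a b c := by
    induction a using SEM.ind; induction b using SEM.ind; induction c using SEM.ind
    exact mk_eq (isCircularDense_self Ω) fun q _ => add_assoc _ _ _
  zero_add a := by
    induction a using SEM.ind
    exact mk_eq (isCircularDense_self Ω) fun q _ => zero_add _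
  add_zero a := by
    induction a using SEM.ind
    exact mk_eq (isCircularDense_self Ω) fun q _ => add_zero _
  add_comm a b := by
    induction a using SEM.ind; induction b using SEM.ind
    exact mk_eq (isCircularDense_self Ω) fun q _ => add_comm _ _
  neg_add_cancel a := by
    induction a using SEM.ind
    exact mk_eq (isCircularDense_self Ω) fun q _ => neg_add_cancel _
  nsmul := nsmulRec
  zsmul := zsmulRec
  mul_assoc a b c := by
    induction a using SEM.ind
    induction b using SEM.ind with | h g V hg =>
    induction c using SEM.ind with | h h W hh =>
    have hd := hg.isCircularDense.inter hh.isCircularDense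
    obtain ⟨α, β, h1⟩ := hg.isSliceRegular.isSlice
    obtain ⟨γ, δ, h2⟩ := hh.isSliceRegular.isSlice
    exact mk_eq hd fun q hq => starMul_assoc hd.isCircular
      ⟨α, β, h1.mono Set.inter_subset_left⟩ ⟨γ, δ, h2.mono Set.inter_subset_right⟩ hq
  one_mul a := by
    induction a using SEM.ind
    exact mk_eq (isCircularDense_self Ω) fun q _ => by simp [starMul]
  mul_one a := by
    induction a using SEM.ind
    exact mk_eq (isCircularDense_self Ω) fun q _ => by
      unfold starMul
      split_ifs with h
      · exact h.symm
      · exact mul_one _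
  zero_mul a := by
    induction a using SEM.ind
    exact mk_eq (isCircularDense_self Ω) fun q _ => by simp [starMul]
  mul_zero a := by
    induction a using SEM.ind
    exact mk_eq (isCircularDense_self Ω) fun q _ => by simp [starMul]
  left_distrib a b c := by
    induction a using SEM.ind; induction b using SEM.ind; induction c using SEM.ind
    exact mk_eq (isCircularDense_self Ω) fun q _ => starMul_add q
  right_distrib a b c := by
    induction a using SEM.ind; induction b using SEM.ind
    induction c using SEM.ind with | h h W hh =>
    exact mk_eq hh.isCircularDense fun q hq =>
      add_starMul hh.isCircular hh.isSliceRegular.isSlice hq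

/-- The "real part" `f₀ = (f + f^c) / 2`. -/
def re (f : SEM Ω) : SEM Ω := const ((1 / 2 : ℝ) : ℍ[ℝ]) * (f + conj f)

/-- The "vector part" `f_v = f - f₀`. -/
def vec (f : SEM Ω) : SEM Ω := f - re f

/-- The symmetrized function `f^s = f * f^c`. -/
def symm (f : SEM Ω) : SEM Ω := f * conj f

/-- The equivalence relation `f ≃ g`: there is an invertible `h` with `f = h⁻¹ * g * h`. -/
def Equivalent (f g : SEM Ω) : Prop := ∃ h : (SEM Ω)ˣ, f = ↑h⁻¹ * g * ↑h

/-- Zero divisors of `SEM(Ω)`; they are not zero. -/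
def IsZeroDivisor (f : SEM Ω) : Prop := f ≠ 0 ∧ ∃ g : SEM Ω, g ≠ 0 ∧ (f * g = 0 ∨ g * f = 0)

end SEM

open SEM in
/-- The subring (in fact, field) `SEM_ℝ(Ω)` of slice preserving semi-regular functions on `Ω`. -/
def SEMReal (Ω : CircularDomain) : Subring (SEM Ω) where
  carrier := {a | ∃ (c : ℍ[ℝ] → ℍ[ℝ]) (U : Set ℍ[ℝ]) (hc : IsSemiRegularOn c Ω.carrier U),
    IsSlicePreserving c U ∧ a = mk c ⟨U, hc⟩}
  zero_mem' := ⟨_, _, isSemiRegular_const Ω 0,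
    fun I _ _ _ => by simpa using real_mem_line I 0, rfl⟩
  one_mem' := ⟨_, _, isSemiRegular_const Ω 1,
    fun I _ _ _ => by simpa using real_mem_line I 1, rfl⟩
  add_mem' := by
    rintro _ _ ⟨c, U, hc, h, rfl⟩ ⟨d, V, hd, k, rfl⟩
    exact ⟨_, _, hc.add hd, fun I hI q hq =>
      add_mem_line (h I hI q ⟨hq.1.1, hq.2⟩) (k I hI q ⟨hq.1.2, hq.2⟩), rfl⟩
  neg_mem' := by
    rintro _ ⟨c, U, hc, h, rfl⟩
    exact ⟨_, _, hc.neg, fun I hI q hq => neg_mem_line (h I hI q hq), rfl⟩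
  mul_mem' := by
    rintro _ _ ⟨c, U, hc, h, rfl⟩ ⟨d, V, hd, k, rfl⟩
    refine ⟨_, _, hc.starMul hd, fun I hI q hq => ?_, rfl⟩
    rw [h.starMul_eq hq.1.1]
    exact mul_mem_line hI (h I hI q ⟨hq.1.1, hq.2⟩) (k I hI q ⟨hq.1.2, hq.2⟩)

/-- Slice preserving functions are central. -/
lemma SEMReal.mul_comm {Ω : CircularDomain} {a : SEM Ω} (ha : a ∈ SEMReal Ω) (b : SEM Ω) :
    a * b = b * a := by
  obtain ⟨c, U, hc, h, rfl⟩ := ha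
  induction b using SEM.ind
  exact SEM.mk_eq hc.isCircularDense fun q hq =>
    h.starMul_comm hc.isCircular hc.isSliceRegular.isSlice hq

/-- The Sylvester operator `χ ↦ f * χ + χ * g`, a linear operator over `SEM_ℝ(Ω)`. -/
def sylvester {Ω : CircularDomain} (f g : SEM Ω) : SEM Ω →ₗ[SEMReal Ω] SEM Ω where
  toFun χ := f * χ + χ * g
  map_add' χ ψ := by rw [mul_add, add_mul]; abel
  map_smul' a χ := by
    simp only [Subring.smul_def, RingHom.id_apply, smul_eq_mul, mul_add, ← mul_assoc]
    rw [SEMReal.mul_comm a.2 f]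

end SliceFun

end

/-! The theorem is linear algebra in a quaternion algebra. The slice preserving functions form a
field `K`, and `quaternionEquiv` identifies the semi-regular functions with `ℍ[K]`; it carries
`conj`, `re`, `vec`, `symm` to the quaternionic conjugate, real part, imaginary part and norm `N`.

Let `s = f.re + g.re`, `u = f.im`, `v = g.im`. The operator is `s + A + B`, where `A` (left
multiplication by `u`) and `B` (right multiplication by `v`) commute and square to the scalars `-N
u`, `-N v`. The product of the four operators `s ± A ± B` is the scalar `D`, so `D ≠ 0` gives rank
4. If `D = 0` and `s ≠ 0`, the product of the other three factors is a nonzero operator, because `1,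
A, B, AB` are independent (`eq_zero_of_forall_smul_add`); so the kernel is nonzero. On it `A` and
`B` act as scalars, which bounds its dimension by 1 (`finrank_ker_sylvester_le_one`). If `D = 0` and
`s = 0`, then `N u = N v`, the kernel contains a unit `h` (`exists_isUnit_mem_ker_sylvester`), and
it equals `(K + K u) h`, of dimension 2. A nonzero element is a unit or a zero divisor according to
whether its norm is nonzero or zero, and `N ((p + q u) h) = (p² + q² N u) N h`. So zero divisors in
a kernel of dimension 2 are governed by whether `-N u` is a square.

Analysis enters in three places. Inverses of slice preserving functions have only poles, and
connectedness of the domain excludes partial vanishing (`IsSemiRegularOn.eq_zero_or_inv`), so `K` is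
a field. On a product domain `q_v / |q_v|` is a square root of `-1` in `K` (`exists_sq_eq_neg_one`).
On a slice domain, evaluation at real points shows that a sum of four squares in `K` vanishes only
trivially (`eq_zero_of_sum_sq_eq_zero`), so there are no zero divisors. -/

open scoped Quaternion

/-! ### Quaternion algebras over a field: primeness and independence -/

namespace Quaternion

section Field

variable {K : Type*} [Field K]

/-- The quaternion `i`. -/
def basisI (K : Type*) [Field K] : ℍ[K] := ⟨0, 1, 0, 0⟩

/-- The quaternion `j`. -/
def basisJ (K : Type*) [Field K] : ℍ[K] := ⟨0, 0, 1, 0⟩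

/-- The quaternion `k`. -/
def basisK (K : Type*) [Field K] : ℍ[K] := ⟨0, 0, 0, 1⟩

@[simp] lemma basisI_re : (basisI K).re = 0 := rfl
@[simp] lemma basisI_imI : (basisI K).imI = 1 := rfl
@[simp] lemma basisI_imJ : (basisI K).imJ = 0 := rfl
@[simp] lemma basisI_imK : (basisI K).imK = 0 := rfl
@[simp] lemma basisJ_re : (basisJ K).re = 0 := rfl
@[simp] lemma basisJ_imI : (basisJ K).imI = 0 := rfl
@[simp] lemma basisJ_imJ : (basisJ K).imJ = 1 := rfl
@[simp] lemma basisJ_imK : (basisJ K).imK = 0 := rfl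
@[simp] lemma basisK_re : (basisK K).re = 0 := rfl
@[simp] lemma basisK_imI : (basisK K).imI = 0 := rfl
@[simp] lemma basisK_imJ : (basisK K).imJ = 0 := rfl
@[simp] lemma basisK_imK : (basisK K).imK = 1 := rfl

lemma mul_self_of_re_eq_zero {u : ℍ[K]} (h : u.re = 0) : u * u = -((normSq u : K) : ℍ[K]) := by
  have : star u = -u := by ext <;> simp [h]
  rw [← self_mul_star, this, mul_neg, neg_neg]

/-- Recovers the real part using only left and right multiplications. Hence it can be applied inside
one-sided annihilators and kernels of homomorphisms. -/
lemma sum_conj_basis (a : ℍ[K]) :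
    a - basisI K * a * basisI K - basisJ K * a * basisJ K - basisK K * a * basisK K
      = ((4 * a.re : K) : ℍ[K]) := by
  (ext <;> simp); ring

lemma coe_mul_eq_zero {r : K} {a : ℍ[K]} (h : (r : ℍ[K]) * a = 0) : r = 0 ∨ a = 0 := by
  rw [coe_mul_eq_smul] at h
  exact smul_eq_zero.1 h

lemma four_ne_zero_of_two [NeZero (2 : K)] : (4 : K) ≠ 0 := by
  have : (4 : K) = 2 * 2 := by norm_num
  rw [this]; exact mul_ne_zero two_ne_zero two_ne_zero

/-- The quaternion algebra is a prime ring. -/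
lemma eq_zero_or_eq_zero_of_forall_mul_mul [NeZero (2 : K)] {a b : ℍ[K]}
    (h : ∀ x, a * x * b = 0) : a = 0 ∨ b = 0 := by
  by_contra! hab
  obtain ⟨ha, hb⟩ := hab
  -- Every term of `sum_conj_basis (a * y)` kills `b` from the left, so the scalar `4 * (a * y).re`
  -- does too. The trace form is nondegenerate, and testing `y = 1, i, j, k` then gives `a = 0`.
  have key : ∀ y, (a * y).re = 0 := fun y => by
    have e : (((4 * (a * y).re : K) : ℍ[K])) * b = 0 := by
      rw [← sum_conj_basis]
      have h' : ∀ e : ℍ[K], e * (a * y) * e * b = 0 := fun e => by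
        have := h (y * e)
        calc e * (a * y) * e * b = e * (a * (y * e) * b) := by simp only [mul_assoc]
          _ = 0 := by rw [this, mul_zero]
      have h1 : a * y * b = 0 := h y
      simp only [sub_mul, h', h1, sub_zero]
    rcases coe_mul_eq_zero e with h1 | h1
    · simpa [four_ne_zero_of_two] using h1
    · exact absurd h1 hb
  apply ha
  have h0 := key 1
  have h1 := key (basisI K)
  have h2 := key (basisJ K)
  have h3 := key (basisK K)
  simp at h0 h1 h2 h3
  ext <;> simp [*]

lemma exists_not_commute [NeZero (2 : K)] {a : ℍ[K]} (h : a.im ≠ 0) : ∃ z, z * a ≠ a * z := by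
  by_contra! hc
  apply h
  have h1 := hc (basisI K)
  have h2 := hc (basisJ K)
  have a1 := congrArg (fun q : ℍ[K] => q.imK) h1
  have a2 := congrArg (fun q : ℍ[K] => q.imJ) h1
  have a3 := congrArg (fun q : ℍ[K] => q.imK) h2
  simp only [imK_mul, imJ_mul, basisI_re, basisI_imI, basisI_imJ, basisI_imK, basisJ_re,
    basisJ_imI, basisJ_imJ, basisJ_imK] at a1 a2 a3
  have t : (2 : K) ≠ 0 := two_ne_zero
  have b1 : a.imJ = 0 := by
    have : 2 * a.imJ = 0 := by linear_combination a1
    simpa [t] using this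
  have b2 : a.imK = 0 := by
    have : 2 * a.imK = 0 := by linear_combination -a2
    simpa [t] using this
  have b3 : a.imI = 0 := by
    have : 2 * a.imI = 0 := by linear_combination -a3
    simpa [t] using this
  ext <;> simp [b1, b2, b3]

/-- Replacing `y` by `y * z` and subtracting the relation times `z` eliminates `a`, leaving `b * y *
(z * v - v * z) = 0` for all `y`. Primeness applies once `z` does not commute with `v`. -/
lemma eq_zero_of_forall_add [NeZero (2 : K)] {a b v : ℍ[K]} (hv : v.im ≠ 0)
    (h : ∀ y, a * y + b * y * v = 0) : a = 0 ∧ b = 0 := by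
  obtain ⟨z, hz⟩ := exists_not_commute hv
  have hb : b = 0 := by
    refine (eq_zero_or_eq_zero_of_forall_mul_mul (a := b) (b := z * v - v * z)
      fun y => ?_).resolve_right (sub_ne_zero.2 hz)
    have h1 := h (y * z)
    calc b * y * (z * v - v * z) = (a * (y * z) + b * (y * z) * v) - (a * y + b * y * v) * z := by
          noncomm_ring
      _ = 0 := by rw [h1, h y]; simp
  refine ⟨?_, hb⟩
  simpa [hb] using h 1

lemma coe_add_coe_mul_eq_zero {p q : K} {u : ℍ[K]} (hu : u.im ≠ 0)
    (h : (p : ℍ[K]) + q * u = 0) : p = 0 ∧ q = 0 := by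
  have hq : q = 0 := by
    by_contra hq
    apply hu
    have := congrArg Quaternion.im h
    rw [coe_mul_eq_smul] at this
    simpa [hq] using this
  refine ⟨?_, hq⟩
  have := congrArg (fun x : ℍ[K] => x.re) h
  simpa [hq] using this

/-- The operator `χ ↦ f χ + χ g`. -/
def sylvester (f g : ℍ[K]) : ℍ[K] →ₗ[K] ℍ[K] := LinearMap.mulLeft K f + LinearMap.mulRight K g

@[simp] lemma sylvester_apply (f g χ : ℍ[K]) : sylvester f g χ = f * χ + χ * g := rfl

end Field

end Quaternion

/-! ### Rank of `χ ↦ f χ + χ g` over a field -/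

namespace Quaternion

section Rank

variable {K : Type*} [Field K]

lemma im_mul_im_mul (f χ : ℍ[K]) : f.im * (f.im * χ) = -(normSq f.im • χ) := by
  rw [← mul_assoc, mul_self_of_re_eq_zero (re_im f), neg_mul, coe_mul_eq_smul]

lemma mul_im_mul_im (f χ : ℍ[K]) : χ * f.im * f.im = -(normSq f.im • χ) := by
  rw [mul_assoc, mul_self_of_re_eq_zero (re_im f), mul_neg, ← coe_commutes, coe_mul_eq_smul]

lemma sylvester_eq (f g χ : ℍ[K]) :
    sylvester f g χ = (f.re + g.re) • χ + f.im * χ + χ * g.im := by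
  conv_lhs => rw [sylvester_apply, ← re_add_im f, ← re_add_im g]
  rw [add_mul, mul_add, ← coe_commutes, coe_mul_eq_smul, coe_mul_eq_smul, add_smul]
  abel

/-- The determinant of the operator `χ ↦ f χ + χ g`. -/
def sylvesterDisc (f g : ℍ[K]) : K :=
  (f.re + g.re) ^ 2 * ((f.re + g.re) ^ 2 + 2 * (normSq f.im + normSq g.im)) +
    (normSq f.im - normSq g.im) ^ 2

/-- The adjugate of the operator `χ ↦ f χ + χ g`. -/
def sylvesterAdj (f g χ : ℍ[K]) : ℍ[K] :=
  ((f.re + g.re) * ((f.re + g.re) ^ 2 + normSq f.im + normSq g.im)) • χ +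
    (normSq g.im - normSq f.im - (f.re + g.re) ^ 2) • (f.im * χ) +
    (normSq f.im - normSq g.im - (f.re + g.re) ^ 2) • (χ * g.im) +
    (2 * (f.re + g.re)) • (f.im * χ * g.im)

/-- With `A`, `B` the multiplications by `f.im`, `g.im`, the operator is `s + A + B`, and
`sylvesterAdj` is the expanded product `(s + A - B)(s - A + B)(s - A - B)`. The full product is `(s²
+ N u + N v)² - 4 N u N v`, which is `sylvesterDisc`. -/
lemma sylvester_adj (f g χ : ℍ[K]) :
    sylvester f g (sylvesterAdj f g χ) = sylvesterDisc f g • χ := by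
  rw [sylvester_eq, sylvesterAdj, sylvesterDisc]
  generalize f.re + g.re = s
  simp only [mul_add, add_mul, smul_mul_assoc, mul_smul_comm, mul_assoc, im_mul_im_mul]
  simp only [← mul_assoc, mul_im_mul_im]
  simp only [mul_assoc, mul_neg, mul_smul_comm]
  module

lemma sylvester_injective_of_disc_ne_zero {f g : ℍ[K]} (h : sylvesterDisc f g ≠ 0) :
    LinearMap.ker (sylvester f g) = ⊥ := by
  rw [LinearMap.ker_eq_bot, LinearMap.injective_iff_surjective]
  intro χ
  refine ⟨sylvesterAdj f g ((sylvesterDisc f g)⁻¹ • χ), ?_⟩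
  rw [sylvester_adj, smul_inv_smul₀ h]

/-- The operators `1`, `χ ↦ u χ`, `χ ↦ χ v`, `χ ↦ u χ v` are linearly independent. -/
lemma eq_zero_of_forall_smul_add [NeZero (2 : K)] {u v : ℍ[K]} (hu : u.im ≠ 0) (hv : v.im ≠ 0)
    {p q r t : K} (h : ∀ χ : ℍ[K], p • χ + q • (u * χ) + r • (χ * v) + t • (u * χ * v) = 0) :
    p = 0 ∧ q = 0 ∧ r = 0 ∧ t = 0 := by
  -- The relation is grouped as `a χ + b χ v` with `a = p + q u` and `b = r + t u`.
  obtain ⟨h1, h2⟩ := eq_zero_of_forall_add (a := (p : ℍ[K]) + (q : ℍ[K]) * u)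
    (b := (r : ℍ[K]) + (t : ℍ[K]) * u) hv
    fun y => by
      rw [← h y]
      simp only [add_mul, coe_mul_eq_smul, smul_mul_assoc]
      abel
  obtain ⟨hp, hq⟩ := coe_add_coe_mul_eq_zero hu h1
  obtain ⟨hr, ht⟩ := coe_add_coe_mul_eq_zero hu h2
  exact ⟨hp, hq, hr, ht⟩

/-- When the discriminant vanishes, the adjugate takes values in the kernel. It is not the zero
operator, since its coefficient at `u χ v` is `2 s`. -/
lemma sylvester_ker_ne_bot [NeZero (2 : K)] {f g : ℍ[K]} (hf : f.im ≠ 0) (hg : g.im ≠ 0)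
    (h : sylvesterDisc f g = 0) (hs : f.re + g.re ≠ 0) : LinearMap.ker (sylvester f g) ≠ ⊥ := by
  intro hbot
  have h0 : ∀ χ, sylvesterAdj f g χ = 0 := fun χ => by
    have : sylvesterAdj f g χ ∈ LinearMap.ker (sylvester f g) := by
      rw [LinearMap.mem_ker, sylvester_adj, h, zero_smul]
    rwa [hbot, Submodule.mem_bot] at this
  obtain ⟨-, -, -, ht⟩ := eq_zero_of_forall_smul_add (by simpa using hf) (by simpa using hg) h0
  exact hs ((mul_eq_zero.1 ht).resolve_left two_ne_zero)

/-- If the right ideal `u ℍ[K]` were a line, it would be spanned by `u`, and `i`, `j` would act on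
it by scalars `a`, `b` with `a² = b² = -1`. Scalars commute while `i j = -j i`, so `2 a b = 0`, a
contradiction. -/
lemma finrank_ker_mulLeft_le [NeZero (2 : K)] {u : ℍ[K]} (hu : u ≠ 0) :
    Module.finrank K (LinearMap.ker (LinearMap.mulLeft K u)) ≤ 2 := by
  have h4 := LinearMap.finrank_range_add_finrank_ker (LinearMap.mulLeft K u)
  rw [Quaternion.finrank_eq_four] at h4
  suffices h : ¬ Module.finrank K (LinearMap.range (LinearMap.mulLeft K u)) ≤ 1 by omega
  intro h1
  obtain ⟨⟨w, hw⟩, h⟩ := finrank_le_one_iff.1 h1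
  have hx : ∀ x : ℍ[K], ∃ c : K, c • w = u * x := fun x => by
    obtain ⟨c, hc⟩ := h ⟨u * x, x, rfl⟩
    exact ⟨c, congrArg Subtype.val hc⟩
  obtain ⟨c, hc⟩ := hx 1
  rw [mul_one] at hc
  have hc0 : c ≠ 0 := by rintro rfl; exact hu (by rw [← hc, zero_smul])
  have hx' : ∀ x : ℍ[K], ∃ c : K, u * x = c • u := fun x => by
    obtain ⟨d, hd⟩ := hx x
    exact ⟨d * c⁻¹, by rw [← hd, ← hc, smul_smul, mul_assoc, inv_mul_cancel₀ hc0, mul_one]⟩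
  obtain ⟨a, ha⟩ := hx' (basisI K)
  obtain ⟨b, hb⟩ := hx' (basisJ K)
  have hii : basisI K * basisI K = -1 := by ext <;> simp
  have hjj : basisJ K * basisJ K = -1 := by ext <;> simp
  have hij : basisI K * basisJ K = -(basisJ K * basisI K) := by ext <;> simp
  have ea : (a * a) • u = -u := by
    rw [← smul_smul, ← ha, ← smul_mul_assoc, ← ha, mul_assoc, hii, mul_neg, mul_one]
  have eb : (b * b) • u = -u := by
    rw [← smul_smul, ← hb, ← smul_mul_assoc, ← hb, mul_assoc, hjj, mul_neg, mul_one]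
  have eab : (2 * (a * b)) • u = 0 := by
    have e1 : (a * b) • u = u * (basisI K * basisJ K) := by
      rw [← mul_assoc, ha, smul_mul_assoc, hb, smul_smul]
    have e2 : (a * b) • u = u * (basisJ K * basisI K) := by
      rw [← mul_assoc, hb, smul_mul_assoc, ha, smul_smul, mul_comm]
    rw [two_mul, add_smul]
    nth_rewrite 1 [e1]
    rw [e2, hij, mul_neg, neg_add_cancel]
  have hab : a * b = 0 :=
    (mul_eq_zero.1 ((smul_eq_zero.1 eab).resolve_right hu)).resolve_left two_ne_zero
  rcases mul_eq_zero.1 hab with h0 | h0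
  · rw [h0, zero_mul, zero_smul] at ea; exact hu (by simpa using ea.symm)
  · rw [h0, zero_mul, zero_smul] at eb; exact hu (by simpa using eb.symm)

/-- An eigenvector `χ` is annihilated by `u.im - a`, hence by the scalar `N (u.im - a)`, which must
vanish. -/
lemma mul_star_sub_coe {u χ : ℍ[K]} {a : K} (h : u.im * χ = a • χ) (hχ : χ ≠ 0) :
    (u.im - a) * star (u.im - (a : ℍ[K])) = 0 := by
  have hN : (normSq (u.im - (a : ℍ[K]))) • χ = 0 := by
    rw [← coe_mul_eq_smul, ← star_mul_self, mul_assoc, sub_mul, h, coe_mul_eq_smul, sub_self,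
      mul_zero]
  rw [self_mul_star, (smul_eq_zero.1 hN).resolve_right hχ, coe_zero]

lemma sub_coe_ne_zero {u : ℍ[K]} (h : u.im ≠ 0) (a : K) : u.im - (a : ℍ[K]) ≠ 0 := by
  intro h0
  have := congrArg Quaternion.im h0
  simp at this
  exact h (by simpa using this)

/-- For `s ≠ 0` all kernel elements are simultaneous eigenvectors of left multiplication by `f.im`
and right multiplication by `g.im`, with fixed eigenvalues. The left eigenspace alone has dimension
at most 2, and the condition on the right cuts it down strictly. -/
lemma finrank_ker_sylvester_le_one [NeZero (2 : K)] {f g : ℍ[K]} (hf : f.im ≠ 0) (hg : g.im ≠ 0)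
    (hs : f.re + g.re ≠ 0) : Module.finrank K (LinearMap.ker (sylvester f g)) ≤ 1 := by
  by_cases hbot : LinearMap.ker (sylvester f g) = ⊥
  · rw [hbot, finrank_bot]; exact zero_le_one
  obtain ⟨χ₀, hχ₀, h0⟩ := Submodule.exists_mem_ne_zero_of_ne_bot hbot
  set s := f.re + g.re with hsdef
  -- The left eigenvalue: multiplying `χ v = -(s χ + u χ)` once more by `v` gives `-N v χ = s² χ + 2
  -- s u χ - N u χ`, which is solved for `u χ`.
  set a : K := (normSq g.im - normSq f.im + s ^ 2) * (-(2 * s))⁻¹ with ha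
  have ht : -(2 * s) ≠ 0 := neg_ne_zero.2 (mul_ne_zero two_ne_zero hs)
  have key : ∀ χ ∈ LinearMap.ker (sylvester f g), f.im * χ = a • χ ∧ χ * g.im = (-s - a) • χ := by
    intro χ hχ
    rw [LinearMap.mem_ker, sylvester_eq] at hχ
    have e1 : χ * g.im = -(s • χ + f.im * χ) := eq_neg_of_add_eq_zero_right hχ
    have e2 : -(normSq g.im • χ) = (s ^ 2) • χ + (2 * s) • (f.im * χ) - normSq f.im • χ := by
      rw [← mul_im_mul_im, e1, neg_mul, add_mul, smul_mul_assoc, mul_assoc, e1, mul_neg, mul_add,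
        mul_smul_comm, im_mul_im_mul]
      module
    have e3 : (-(2 * s)) • (f.im * χ) = (normSq g.im - normSq f.im + s ^ 2) • χ := by
      rw [← sub_eq_zero] at e2 ⊢
      rw [← e2]
      module
    have e4 : f.im * χ = a • χ := by
      rw [ha, mul_comm, ← smul_smul, ← e3, inv_smul_smul₀ ht]
    exact ⟨e4, by rw [e1, e4]; module⟩
  obtain ⟨hk1, hk2⟩ := key χ₀ hχ₀
  have hu := sub_coe_ne_zero hf a
  have hlt : LinearMap.ker (sylvester f g) <
      LinearMap.ker (LinearMap.mulLeft K (f.im - (a : ℍ[K]))) := by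
    refine lt_of_le_of_ne (fun χ hχ => ?_) fun heq => ?_
    · rw [LinearMap.mem_ker, LinearMap.mulLeft_apply, sub_mul, (key χ hχ).1, coe_mul_eq_smul,
        sub_self]
    -- Since `u - a` has norm zero, `star (u - a) * x` is in the left eigenspace for every `x`. If
    -- that space were the whole kernel, these would all be right eigenvectors too, against
    -- primeness.
    · have hprime : ∀ x, star (f.im - (a : ℍ[K])) * x * (g.im - ((-s - a : K) : ℍ[K])) = 0 := by
        intro x
        have hm : star (f.im - (a : ℍ[K])) * x ∈ LinearMap.ker (sylvester f g) := by
          rw [heq, LinearMap.mem_ker, LinearMap.mulLeft_apply, ← mul_assoc,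
            mul_star_sub_coe hk1 h0, zero_mul]
        rw [mul_sub, (key _ hm).2, ← coe_commutes, coe_mul_eq_smul, sub_self]
      rcases eq_zero_or_eq_zero_of_forall_mul_mul hprime with h1 | h1
      · exact hu (star_eq_zero.1 h1)
      · exact sub_coe_ne_zero hg _ h1
  have := Submodule.finrank_lt_finrank_of_lt hlt
  have := finrank_ker_mulLeft_le hu
  omega

end Rank

end Quaternion

/-! ### Units and zero divisors in the kernel -/

namespace Quaternion

section Kernel

variable {K : Type*} [Field K]

lemma isUnit_iff_normSq_ne_zero {a : ℍ[K]} : IsUnit a ↔ normSq a ≠ 0 := by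
  refine ⟨fun h => (h.map (normSq : ℍ[K] →*₀ K)).ne_zero, fun h => ?_⟩
  refine ⟨⟨a, (normSq a)⁻¹ • star a, ?_, ?_⟩, rfl⟩
  · rw [mul_smul_comm, self_mul_star, smul_coe, inv_mul_cancel₀ h, coe_one]
  · rw [smul_mul_assoc, star_mul_self, smul_coe, inv_mul_cancel₀ h, coe_one]

lemma exists_mul_eq_zero_iff {a : ℍ[K]} (ha : a ≠ 0) :
    (∃ b : ℍ[K], b ≠ 0 ∧ (a * b = 0 ∨ b * a = 0)) ↔ normSq a = 0 := by
  constructor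
  · rintro ⟨b, hb, h⟩
    by_contra hN
    obtain ⟨u, rfl⟩ := isUnit_iff_normSq_ne_zero.2 hN
    rcases h with h | h
    · exact hb (by simpa using h)
    · exact hb (by simpa using h)
  · intro h
    exact ⟨star a, by simpa using ha, Or.inl (by rw [self_mul_star, h, coe_zero])⟩

lemma re_mul_comm (a b : ℍ[K]) : (a * b).re = (b * a).re := by
  simp only [re_mul]; ring

lemma eq_zero_of_forall_re_mul {a : ℍ[K]} (h : ∀ y, (a * y).re = 0) : a = 0 := by
  have h0 := h 1
  have h1 := h (basisI K)
  have h2 := h (basisJ K)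
  have h3 := h (basisK K)
  simp at h0 h1 h2 h3
  ext <;> simp [*]

/-- Imaginary quaternions of the same norm are conjugate, up to the sign. -/
lemma exists_isUnit_mem_ker_sylvester [NeZero (2 : K)] {f g : ℍ[K]} (hf : f.im ≠ 0)
    (hg : g.im ≠ 0) (hs : f.re + g.re = 0) (hN : normSq f.im = normSq g.im) :
    ∃ h ∈ LinearMap.ker (sylvester f g), IsUnit h := by
  -- As `u² = v² = -N u`, every `u x - x v` satisfies `u χ = -χ v`, so it lies in the kernel. It
  -- remains to find one of nonzero norm.
  suffices h : ∃ x : ℍ[K], normSq (f.im * x - x * g.im) ≠ 0 by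
    obtain ⟨x, hx⟩ := h
    refine ⟨f.im * x - x * g.im, ?_, isUnit_iff_normSq_ne_zero.2 hx⟩
    rw [LinearMap.mem_ker, sylvester_eq, hs, mul_sub, sub_mul, im_mul_im_mul, mul_im_mul_im, hN,
      ← mul_assoc]
    module
  by_contra! h
  -- Otherwise the image of `x ↦ u x - x v` is totally isotropic; polarization makes it orthogonal
  -- to itself for the trace form.
  have hpol : ∀ x y : ℍ[K],
      ((f.im * x - x * g.im) * star (f.im * y - y * g.im)).re = 0 := fun x y => by
    have hxy := h (x + y)
    have e : f.im * (x + y) - (x + y) * g.im =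
        (f.im * x - x * g.im) + (f.im * y - y * g.im) := by noncomm_ring
    rw [e, normSq_add, h x, h y, zero_add, zero_add] at hxy
    exact (mul_eq_zero.1 hxy).resolve_left two_ne_zero
  -- Moving one copy of `x ↦ u x - x v` to its adjoint turns orthogonality into `2 (N u x + u x v) =
  -- 0` for all `x`. The zero coefficients put this in the form of `eq_zero_of_forall_smul_add`,
  -- which would force `1 = 0`.
  have hx : ∀ x : ℍ[K], normSq f.im • x + (0 : K) • (f.im * x) + (0 : K) • (x * g.im) +
      (1 : K) • (f.im * x * g.im) = 0 := fun x => by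
    refine eq_zero_of_forall_re_mul fun y => ?_
    have h1 := hpol x (star y)
    have ef : star f.im = -f.im := by ext <;> simp
    have eg : star g.im = -g.im := by ext <;> simp
    rw [star_sub, star_mul, star_mul, star_star, ef, eg] at h1
    have e1 : ((f.im * x - x * g.im) * (y * -f.im - -g.im * y)).re =
        (((f.im * x - x * g.im) * g.im - f.im * (f.im * x - x * g.im)) * y).re := by
      generalize f.im * x - x * g.im = a
      have e2 : a * (y * -f.im - -g.im * y) = a * g.im * y - a * y * f.im := by noncomm_ring
      rw [e2, sub_mul, re_sub, re_sub, re_mul_comm (a * y), mul_assoc f.im]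
    have e3 : (f.im * x - x * g.im) * g.im - f.im * (f.im * x - x * g.im) =
        (2 : K) • (normSq f.im • x + (0 : K) • (f.im * x) + (0 : K) • (x * g.im) +
          (1 : K) • (f.im * x * g.im)) := by
      rw [sub_mul, mul_sub, mul_im_mul_im, im_mul_im_mul, ← hN, ← mul_assoc]
      module
    rw [e1, e3, smul_mul_assoc, re_smul, smul_eq_mul] at h1
    exact (mul_eq_zero.1 h1).resolve_left two_ne_zero
  exact one_ne_zero (eq_zero_of_forall_smul_add (by simpa using hf) (by simpa using hg) hx).2.2.2

/-- Commuting means that the cross product of the imaginary parts is zero, so `y.im` is proportional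
to `u.im`; the factor is read off at a nonzero coordinate of `u.im`. -/
lemma exists_eq_coe_add_of_commute [NeZero (2 : K)] {u y : ℍ[K]} (hu : u.im ≠ 0)
    (h : u * y = y * u) : ∃ p q : K, y = (p : ℍ[K]) + (q : ℍ[K]) * u := by
  have t : (2 : K) ≠ 0 := two_ne_zero
  have a1 := congrArg (fun q : ℍ[K] => q.imI) h
  have a2 := congrArg (fun q : ℍ[K] => q.imJ) h
  have a3 := congrArg (fun q : ℍ[K] => q.imK) h
  simp only [imI_mul, imJ_mul, imK_mul] at a1 a2 a3
  have b1 : u.imJ * y.imK = u.imK * y.imJ := mul_left_cancel₀ t (by linear_combination a1)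
  have b2 : u.imK * y.imI = u.imI * y.imK := mul_left_cancel₀ t (by linear_combination a2)
  have b3 : u.imI * y.imJ = u.imJ * y.imI := mul_left_cancel₀ t (by linear_combination a3)
  have key : ∀ q : K, y.imI = q * u.imI → y.imJ = q * u.imJ → y.imK = q * u.imK →
      ∃ p q : K, y = (p : ℍ[K]) + (q : ℍ[K]) * u := fun q h1 h2 h3 =>
    ⟨y.re - q * u.re, q, by rw [coe_mul_eq_smul]; ext <;> simp [h1, h2, h3]⟩
  by_cases hI : u.imI = 0
  · by_cases hJ : u.imJ = 0
    · by_cases hK : u.imK = 0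
      · exact absurd (by ext <;> simp [hI, hJ, hK]) hu
      · refine key (y.imK / u.imK) ?_ ?_ ?_ <;> field_simp
        · linear_combination b2
        · linear_combination -b1
    · refine key (y.imJ / u.imJ) ?_ ?_ ?_ <;> field_simp
      · linear_combination -b3
      · linear_combination b1
  · refine key (y.imI / u.imI) ?_ ?_ ?_ <;> field_simp
    · linear_combination b3
    · linear_combination -b2

lemma mem_ker_sylvester_iff {f g : ℍ[K]} (hs : f.re + g.re = 0) {χ : ℍ[K]} :
    χ ∈ LinearMap.ker (sylvester f g) ↔ f.im * χ = -(χ * g.im) := by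
  rw [LinearMap.mem_ker, sylvester_eq, hs, zero_smul, zero_add, eq_neg_iff_add_eq_zero]

lemma coe_add_coe_mul_mem_ker {f g h : ℍ[K]} (hs : f.re + g.re = 0)
    (hh : h ∈ LinearMap.ker (sylvester f g)) (p q : K) :
    ((p : ℍ[K]) + (q : ℍ[K]) * f.im) * h ∈ LinearMap.ker (sylvester f g) := by
  rw [mem_ker_sylvester_iff hs] at hh ⊢
  have e : f.im * ((p : ℍ[K]) + (q : ℍ[K]) * f.im) = ((p : ℍ[K]) + (q : ℍ[K]) * f.im) * f.im := by
    simp only [mul_add, add_mul, coe_mul_eq_smul, mul_smul_comm, smul_mul_assoc, ← coe_commutes]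
  rw [← mul_assoc, e, mul_assoc, hh, mul_neg, mul_assoc]

/-- For `χ` and the unit `h` both in the kernel, `χ h⁻¹` commutes with `f.im`, and the centralizer
of `f.im` is `K + K f.im`. -/
lemma exists_eq_of_mem_ker_sylvester [NeZero (2 : K)] {f g : ℍ[K]} (hf : f.im ≠ 0)
    (hs : f.re + g.re = 0) {h : (ℍ[K])ˣ} (hh : (h : ℍ[K]) ∈ LinearMap.ker (sylvester f g))
    {χ : ℍ[K]} (hχ : χ ∈ LinearMap.ker (sylvester f g)) :
    ∃ p q : K, χ = ((p : ℍ[K]) + (q : ℍ[K]) * f.im) * h := by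
  rw [mem_ker_sylvester_iff hs] at hh hχ
  have hinv : g.im * (↑h⁻¹ : ℍ[K]) = -(↑h⁻¹ * f.im) := by
    have : (h : ℍ[K]) * (g.im * ↑h⁻¹) = h * (-(↑h⁻¹ * f.im)) := by
      rw [mul_neg, ← mul_assoc, ← mul_assoc, Units.mul_inv, one_mul, ← neg_eq_iff_eq_neg,
        ← neg_mul, ← hh, mul_assoc, Units.mul_inv, mul_one]
    exact (Units.mul_right_inj h).1 this
  obtain ⟨p, q, e⟩ := exists_eq_coe_add_of_commute (u := f.im) (y := χ * ↑h⁻¹) (by simpa using hf)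
    (by rw [← mul_assoc, hχ, neg_mul, mul_assoc, mul_assoc, hinv, mul_neg, neg_neg])
  exact ⟨p, q, by rw [← e, mul_assoc, Units.inv_mul, mul_one]⟩

lemma finrank_ker_sylvester_eq_two [NeZero (2 : K)] {f g : ℍ[K]} (hf : f.im ≠ 0) (hg : g.im ≠ 0)
    (hs : f.re + g.re = 0) (hN : normSq f.im = normSq g.im) :
    Module.finrank K (LinearMap.ker (sylvester f g)) = 2 := by
  obtain ⟨_, hh, ⟨h, rfl⟩⟩ := exists_isUnit_mem_ker_sylvester hf hg hs hN
  have hmul : ∀ p q : K, ((p : ℍ[K]) + (q : ℍ[K]) * f.im) * h =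
      p • (h : ℍ[K]) + q • (f.im * h) := fun p q => by
    simp only [add_mul, coe_mul_eq_smul, smul_mul_assoc]
  have hspan : LinearMap.ker (sylvester f g) =
      Submodule.span K (Set.range ![(h : ℍ[K]), f.im * h]) := by
    ext χ
    rw [Matrix.range_cons, Matrix.range_cons, Matrix.range_empty, Set.union_empty,
      Set.singleton_union, Submodule.mem_span_pair]
    constructor
    · intro hχ
      obtain ⟨p, q, e⟩ := exists_eq_of_mem_ker_sylvester hf hs hh hχ
      exact ⟨p, q, by rw [e, hmul]⟩
    · rintro ⟨p, q, rfl⟩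
      rw [← hmul]
      exact coe_add_coe_mul_mem_ker hs hh p q
  have hli : LinearIndependent K ![(h : ℍ[K]), f.im * h] := by
    rw [LinearIndependent.pair_iff]
    intro p q hpq
    rw [← hmul] at hpq
    exact coe_add_coe_mul_eq_zero (by simpa using hf) ((Units.mul_left_eq_zero h).1 hpq)
  rw [hspan, finrank_span_eq_card hli, Fintype.card_fin]

lemma rank_sylvester_add (f g : ℍ[K]) {n m : ℕ} (hn : n + m = 4)
    (h : Module.finrank K (LinearMap.ker (sylvester f g)) = m) : (sylvester f g).rank = n := by
  have h4 := LinearMap.finrank_range_add_finrank_ker (sylvester f g)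
  rw [Quaternion.finrank_eq_four, h] at h4
  rw [LinearMap.rank, ← Module.finrank_eq_rank]
  congr 1
  omega

lemma rank_sylvester_eq_four {f g : ℍ[K]} (h : sylvesterDisc f g ≠ 0) :
    (sylvester f g).rank = (4 : ℕ) :=
  rank_sylvester_add f g (m := 0) rfl (by
    rw [sylvester_injective_of_disc_ne_zero h, finrank_bot])

lemma rank_sylvester_eq_three [NeZero (2 : K)] {f g : ℍ[K]} (hf : f.im ≠ 0) (hg : g.im ≠ 0)
    (h : sylvesterDisc f g = 0) (hs : f.re + g.re ≠ 0) : (sylvester f g).rank = (3 : ℕ) := by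
  refine rank_sylvester_add f g (m := 1) rfl (le_antisymm
    (finrank_ker_sylvester_le_one hf hg hs) ?_)
  rw [Nat.one_le_iff_ne_zero, Ne, Submodule.finrank_eq_zero]
  exact sylvester_ker_ne_bot hf hg h hs

lemma rank_sylvester_eq_two [NeZero (2 : K)] {f g : ℍ[K]} (hf : f.im ≠ 0) (hg : g.im ≠ 0)
    (hs : f.re + g.re = 0) (hN : normSq f.im = normSq g.im) : (sylvester f g).rank = (2 : ℕ) :=
  rank_sylvester_add f g (m := 2) rfl (finrank_ker_sylvester_eq_two hf hg hs hN)

/-- A unit in the kernel makes `f` conjugate to `-g`, and conjugation preserves the real part.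
Multiplying by `star h` instead of `h⁻¹` only brings in the factor `normSq h`. -/
lemma re_add_re_eq_zero_of_isUnit_mem_ker [NeZero (2 : K)] {f g h : ℍ[K]} (hu : IsUnit h)
    (hh : h ∈ LinearMap.ker (sylvester f g)) : f.re + g.re = 0 := by
  have e : f * (h * star h) = -(h * g * star h) := by
    rw [LinearMap.mem_ker, sylvester_apply] at hh
    rw [← mul_assoc, eq_neg_of_add_eq_zero_left hh, neg_mul]
  have e2 := congrArg (fun x : ℍ[K] => x.re) e
  simp only [re_neg] at e2
  rw [re_mul_comm (h * g), ← mul_assoc (star h), star_mul_self, self_mul_star, re_mul_comm f,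
    coe_mul_eq_smul, coe_mul_eq_smul, re_smul, re_smul, smul_eq_mul, smul_eq_mul] at e2
  have hN := isUnit_iff_normSq_ne_zero.1 hu
  have : normSq h * (f.re + g.re) = 0 := by rw [mul_add, e2, neg_add_cancel]
  exact (mul_eq_zero.1 this).resolve_left hN

/-- The three possibilities for the rank of `χ ↦ f χ + χ g`. -/
lemma sylvester_cases [NeZero (2 : K)] {f g : ℍ[K]} (hf : f.im ≠ 0) (hg : g.im ≠ 0) :
    ((sylvester f g).rank = (4 : ℕ) ∧ sylvesterDisc f g ≠ 0 ∧
      LinearMap.ker (sylvester f g) = ⊥ ∧ ¬(f.re + g.re = 0 ∧ normSq f.im = normSq g.im) ∧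
      ¬∃ h ∈ LinearMap.ker (sylvester f g), IsUnit h) ∨
    ((sylvester f g).rank = (3 : ℕ) ∧ sylvesterDisc f g = 0 ∧
      LinearMap.ker (sylvester f g) ≠ ⊥ ∧ f.re + g.re ≠ 0 ∧
      ¬∃ h ∈ LinearMap.ker (sylvester f g), IsUnit h) ∨
    ((sylvester f g).rank = (2 : ℕ) ∧ sylvesterDisc f g = 0 ∧ f.re + g.re = 0 ∧
      normSq f.im = normSq g.im ∧ ∃ h ∈ LinearMap.ker (sylvester f g), IsUnit h) := by
  by_cases hD : sylvesterDisc f g = 0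
  · by_cases hs : f.re + g.re = 0
    · have hN : normSq f.im = normSq g.im := by
        have : (normSq f.im - normSq g.im) ^ 2 = 0 := by
          rw [sylvesterDisc, hs] at hD
          linear_combination hD
        exact sub_eq_zero.1 (pow_eq_zero_iff two_ne_zero |>.1 this)
      exact Or.inr (Or.inr ⟨rank_sylvester_eq_two hf hg hs hN, hD, hs, hN,
        exists_isUnit_mem_ker_sylvester hf hg hs hN⟩)
    · exact Or.inr (Or.inl ⟨rank_sylvester_eq_three hf hg hD hs, hD,
        sylvester_ker_ne_bot hf hg hD hs, hs,
        fun ⟨h, hh, hu⟩ => hs (re_add_re_eq_zero_of_isUnit_mem_ker hu hh)⟩)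
  · have hbot := sylvester_injective_of_disc_ne_zero hD
    refine Or.inl ⟨rank_sylvester_eq_four hD, hD, hbot, fun ⟨hs, hN⟩ => hD ?_, ?_⟩
    · rw [sylvesterDisc, hs, hN]; ring
    · rintro ⟨h, hh, hu⟩
      rw [hbot, Submodule.mem_bot] at hh
      exact hu.ne_zero hh

/-- On the kernel `(K + K f.im) h` the norm is `(p² + q² N f.im) N h`. Since `-1` is a square, it
has a nontrivial zero exactly when `N f.im` is a square. The three alternatives only split this
according to `f.im - g.im`, which itself belongs to the kernel. -/
lemma exists_normSq_eq_zero_mem_ker_iff [NeZero (2 : K)] {f g : ℍ[K]} (hf : f.im ≠ 0)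
    (hg : g.im ≠ 0) (hs : f.re + g.re = 0) (hN : normSq f.im = normSq g.im)
    (hι : ∃ ι : K, ι ^ 2 = -1) :
    (∃ χ ∈ LinearMap.ker (sylvester f g), χ ≠ 0 ∧ normSq χ = 0) ↔
      (f.im = g.im ∧ ∃ ρ : K, ρ ^ 2 = normSq f.im) ∨
      (f.im ≠ g.im ∧ normSq (f.im - g.im) = 0) ∨
      (normSq (f.im - g.im) ≠ 0 ∧ ∃ ρ : K, ρ ^ 2 = normSq f.im) := by
  obtain ⟨ι, hι⟩ := hι
  obtain ⟨_, hh, ⟨h, rfl⟩⟩ := exists_isUnit_mem_ker_sylvester hf hg hs hN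
  have hnorm : ∀ p q : K, normSq ((p : ℍ[K]) + (q : ℍ[K]) * f.im) = p ^ 2 + q ^ 2 * normSq f.im :=
    fun p q => by
      simp only [coe_mul_eq_smul, normSq_def', re_add, imI_add, imJ_add, imK_add, re_coe, imI_coe,
        imJ_coe, imK_coe, re_smul, imI_smul, imJ_smul, imK_smul, re_im, smul_eq_mul]
      ring
  have hh0 : normSq (h : ℍ[K]) ≠ 0 := isUnit_iff_normSq_ne_zero.1 h.isUnit
  have hfwd : (∃ χ ∈ LinearMap.ker (sylvester f g), χ ≠ 0 ∧ normSq χ = 0) →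
      ∃ ρ : K, ρ ^ 2 = normSq f.im := by
    rintro ⟨χ, hχ, h0, hχN⟩
    obtain ⟨p, q, rfl⟩ := exists_eq_of_mem_ker_sylvester hf hs hh hχ
    rw [map_mul, hnorm] at hχN
    have e := (mul_eq_zero.1 hχN).resolve_right hh0
    have hq : q ≠ 0 := by
      rintro rfl
      have hp : p = 0 := by simpa using e
      exact h0 (by simp [hp])
    -- From `p² + q² N u = 0` and `ι² = -1`: `N u = -(p / q)² = (ι p / q)²`.
    refine ⟨ι * p / q, ?_⟩
    field_simp
    linear_combination p ^ 2 * hι - e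
  have hbwd : (∃ ρ : K, ρ ^ 2 = normSq f.im) →
      ∃ χ ∈ LinearMap.ker (sylvester f g), χ ≠ 0 ∧ normSq χ = 0 := by
    rintro ⟨ρ, hρ⟩
    refine ⟨_, coe_add_coe_mul_mem_ker hs hh (ι * ρ) 1, fun h0 => ?_, ?_⟩
    · have := (Units.mul_left_eq_zero h).1 h0
      exact one_ne_zero (coe_add_coe_mul_eq_zero (by simpa using hf) this).2
    · rw [map_mul, hnorm, ← hρ, mul_pow, hι]; ring
  constructor
  · intro hχ
    have hρ := hfwd hχ
    by_cases h1 : f.im = g.im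
    · exact Or.inl ⟨h1, hρ⟩
    · by_cases h2 : normSq (f.im - g.im) = 0
      · exact Or.inr (Or.inl ⟨h1, h2⟩)
      · exact Or.inr (Or.inr ⟨h2, hρ⟩)
  · rintro (⟨-, hρ⟩ | ⟨h1, h2⟩ | ⟨-, hρ⟩)
    · exact hbwd hρ
    -- Here no square root has to be exhibited: `u - v` is a kernel element because `u² = v²`.
    · refine ⟨f.im - g.im, ?_, sub_ne_zero.2 h1, h2⟩
      rw [mem_ker_sylvester_iff hs, mul_sub, sub_mul, mul_self_of_re_eq_zero (re_im f),
        mul_self_of_re_eq_zero (re_im g), hN]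
      abel
    · exact hbwd hρ

end Kernel

end Quaternion

/-! ### Slice preserving functions as holomorphic functions -/

namespace SliceFun

lemma slicePt_injective {I : ℍ[ℝ]} (hI : I ∈ imagUnits) : Function.Injective (slicePt I) := by
  intro z w h
  have h1 : z.re = w.re := by rw [← slicePt_re hI, h, slicePt_re hI]
  have h2 : (z.im - w.im) • I = 0 := by
    have := congrArg Quaternion.im h
    rw [slicePt_im hI, slicePt_im hI] at this
    rw [sub_smul, this, sub_self]
  exact Complex.ext h1 (sub_eq_zero.1 ((smul_eq_zero.1 h2).resolve_right (ne_zero_of_mem hI)))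

lemma slicePt_zero (I : ℍ[ℝ]) : slicePt I 0 = 0 := by simp [slicePt]

lemma slicePt_eq_zero {I : ℍ[ℝ]} (hI : I ∈ imagUnits) {z : ℂ} : slicePt I z = 0 ↔ z = 0 :=
  ⟨fun h => slicePt_injective hI (by rw [h, slicePt_zero]), fun h => by rw [h, slicePt_zero]⟩

lemma slicePt_inv {I : ℍ[ℝ]} (hI : I ∈ imagUnits) (z : ℂ) : slicePt I z⁻¹ = (slicePt I z)⁻¹ := by
  by_cases hz : z = 0
  · simp [hz, slicePt_zero]
  · exact eq_inv_of_mul_eq_one_left (by rw [← slicePt_mul hI, inv_mul_cancel₀ hz, slicePt_one])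

/-- `f` is induced by the complex function `P` on `U`. -/
def IsInduced (f : ℍ[ℝ] → ℍ[ℝ]) (P : ℂ → ℂ) (U : Set ℍ[ℝ]) : Prop :=
  ∀ I ∈ imagUnits, ∀ z, slicePt I z ∈ U → f (slicePt I z) = slicePt I (P z)

lemma IsInduced.hasComponents {f : ℍ[ℝ] → ℍ[ℝ]} {P : ℂ → ℂ} {U : Set ℍ[ℝ]}
    (h : IsInduced f P U) :
    HasComponents f U (fun z => ((P z).re : ℍ[ℝ])) (fun z => ((P z).im : ℍ[ℝ])) :=
  fun I hI z hz => by rw [h I hI z hz, slicePt_eq]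

lemma IsInduced.isSlicePreserving {f : ℍ[ℝ] → ℍ[ℝ]} {P : ℂ → ℂ} {U : Set ℍ[ℝ]}
    (h : IsInduced f P U) : IsSlicePreserving f U := by
  rintro I hI _ ⟨hq, z, rfl⟩
  exact ⟨P z, (h I hI z hq).symm⟩

lemma IsInduced.isSliceRegular {f : ℍ[ℝ] → ℍ[ℝ]} {P : ℂ → ℂ} {U : Set ℍ[ℝ]} (hU : IsOpen U)
    (h : IsInduced f P U)
    (hP : ∀ I ∈ imagUnits, ∀ z, slicePt I z ∈ U → DifferentiableAt ℂ P z) :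
    IsSliceRegular f U :=
  IsSliceRegular.of_stem hU h.hasComponents fun I hI z hz => isStemAt_of_holomorphic (hP I hI z hz)

/-- The point `x + I y` is also `x + (-I)(-y)`, and both descriptions must give the same value. -/
lemma IsInduced.star_eq {f : ℍ[ℝ] → ℍ[ℝ]} {P : ℂ → ℂ} {U : Set ℍ[ℝ]}
    (h : IsInduced f P U) {I : ℍ[ℝ]} (hI : I ∈ imagUnits) {z : ℂ} (hz : slicePt I z ∈ U) :
    P (star z) = star (P z) := by
  have hz' : slicePt (-I) (star z) ∈ U := by rwa [slicePt_neg, star_star]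
  have e := h (-I) (neg_mem hI) _ hz'
  rw [slicePt_neg, star_star, h I hI z hz, slicePt_neg] at e
  rw [← star_star (P (star z))]
  exact congrArg star (slicePt_injective hI e).symm

/-- The real parts of the components of a slice regular function are the components of a
holomorphic function. -/
lemma IsStemAt.differentiableAt_re {α β : ℂ → ℍ[ℝ]} {z : ℂ} (h : IsStemAt α β z) :
    DifferentiableAt ℂ (fun w => (⟨(α w).re, (β w).re⟩ : ℂ)) z := by
  let r : ℍ[ℝ] →L[ℝ] ℝ := LinearMap.toContinuousLinearMap
    { toFun := fun q => q.re, map_add' := fun _ _ => by simp, map_smul' := fun _ _ => by simp }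
  have hr : ∀ q, r q = q.re := fun q => rfl
  have hd : HasFDerivAt (fun w => (⟨(α w).re, (β w).re⟩ : ℂ))
      (Complex.ofRealCLM ∘L r ∘L fderiv ℝ α z +
        Complex.I • (Complex.ofRealCLM ∘L r ∘L fderiv ℝ β z)) z := by
    have h1 := (Complex.ofRealCLM ∘L r).hasFDerivAt.comp z h.left.hasFDerivAt
    have h2 := ((Complex.ofRealCLM ∘L r).hasFDerivAt.comp z h.right.hasFDerivAt).const_smul
      Complex.I
    refine (h1.add h2).congr_of_eventuallyEq (Filter.Eventually.of_forall fun w => ?_)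
    apply Complex.ext <;> simp [hr]
  rw [differentiableAt_complex_iff_differentiableAt_real]
  refine ⟨hd.differentiableAt, ?_⟩
  rw [hd.fderiv]
  simp only [add_apply, smul_apply, ContinuousLinearMap.comp_apply, hr, h.cr_one, h.cr_I,
    Complex.ofRealCLM_apply, smul_eq_mul, Quaternion.re_neg, mul_add, ← mul_assoc,
    Complex.I_mul_I]
  push_cast
  ring

/-- The smaller set `V` serves extensions across a sphere: these are regular on all of `U`, but are
known to be slice preserving only off the sphere. The same `P` is holomorphic on all of `U`. -/
lemma IsSliceRegular.exists_holomorphic {f : ℍ[ℝ] → ℍ[ℝ]} {U : Set ℍ[ℝ]} (hU : IsCircular U)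
    (hf : IsSliceRegular f U) :
    ∃ P : ℂ → ℂ, (∀ I ∈ imagUnits, ∀ z, slicePt I z ∈ U → DifferentiableAt ℂ P z) ∧
      ∀ V ⊆ U, IsCircular V → IsSlicePreserving f V → IsInduced f P V := by
  obtain ⟨α, β, h1, h2⟩ := hf.exists_stem hU
  refine ⟨_, fun I hI z hz => (h2 I hI z hz).differentiableAt_re, fun V hV hVc hp I hI z hz => ?_⟩
  obtain ⟨e1, e2⟩ := (h1.mono hV).real hVc hp hI hz
  rw [h1 I hI z (hV hz), slicePt_eq, ← e1, ← e2]

end SliceFun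

/-! ### Local inverses at poles and removable singularities -/

namespace SliceFun

/-- The point `x + i |y|` of the upper half-plane representing the sphere through `x + I y`. -/
noncomputable def upperPt (q : ℍ[ℝ]) : ℂ := ⟨q.re, ‖q.im‖⟩

lemma continuous_upperPt : Continuous upperPt := by
  have h : upperPt = fun q : ℍ[ℝ] => (q.re : ℂ) + (‖q.im‖ : ℂ) * Complex.I := by
    funext q
    apply Complex.ext <;> simp [upperPt]
  have h1 : Continuous fun q : ℍ[ℝ] => q.re := Quaternion.continuous_re
  have h2 : Continuous fun q : ℍ[ℝ] => q.im := Quaternion.continuous_im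
  rw [h]
  fun_prop

lemma upperPt_eq_iff {p q : ℍ[ℝ]} : upperPt q = upperPt p ↔ q ∈ sphereThrough p := by
  rw [mem_sphereThrough, upperPt, upperPt, Complex.mk.injEq]

lemma isClosed_sphereThrough (p : ℍ[ℝ]) : IsClosed (sphereThrough p) := by
  have : sphereThrough p = upperPt ⁻¹' {upperPt p} := by
    ext q; exact upperPt_eq_iff.symm
  rw [this]
  exact isClosed_singleton.preimage continuous_upperPt

lemma isCircular_preimage_upperPt (S : Set ℂ) : IsCircular (upperPt ⁻¹' S) := by
  intro p hp q hq
  rwa [Set.mem_preimage, upperPt_eq_iff.2 hq]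

lemma upperPt_slicePt {I : ℍ[ℝ]} (hI : I ∈ imagUnits) (z : ℂ) :
    upperPt (slicePt I z) = z ∨ upperPt (slicePt I z) = star z := by
  rw [upperPt, slicePt_re hI, norm_slicePt_im hI]
  rcases abs_choice z.im with h | h
  · exact Or.inl (Complex.ext rfl h)
  · exact Or.inr (Complex.ext (by simp) (by simpa using h))

/-- The two roots represent the same sphere, so powers of `Delta p` can absorb zeros and poles at
both points. -/
lemma deltaPoly_eq (p : ℍ[ℝ]) (z : ℂ) :
    deltaPoly p z = (z - upperPt p) * (z - star (upperPt p)) := by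
  have hn : ‖p‖ ^ 2 = p.re ^ 2 + ‖p.im‖ ^ 2 := by
    rw [sq, sq ‖p.im‖, ← Quaternion.normSq_eq_norm_mul_self, ← Quaternion.normSq_eq_norm_mul_self,
      Quaternion.normSq_def', Quaternion.normSq_def']
    simp
    ring
  rw [deltaPoly, hn]
  apply Complex.ext
  · simp [upperPt, sq]; ring
  · simp [upperPt, sq]; ring

lemma deltaPoly_star (p : ℍ[ℝ]) (z : ℂ) : deltaPoly p (star z) = star (deltaPoly p z) := by
  rw [deltaPoly_eq, deltaPoly_eq]
  simp only [star_mul', star_sub, star_star]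
  ring

lemma deltaPoly_eq_zero_iff (p : ℍ[ℝ]) {I : ℍ[ℝ]} (hI : I ∈ imagUnits) (z : ℂ) :
    deltaPoly p z = 0 ↔ slicePt I z ∈ sphereThrough p := by
  rw [← upperPt_eq_iff, deltaPoly_eq, mul_eq_zero, sub_eq_zero, sub_eq_zero]
  constructor
  · rintro (h | h)
    · rcases upperPt_slicePt hI z with e | e
      · rw [e, h]
      · rw [upperPt, upperPt, slicePt_re hI, norm_slicePt_im hI, h]
        simp [upperPt]
    · rw [upperPt, upperPt, slicePt_re hI, norm_slicePt_im hI, h]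
      simp [upperPt]
  · intro h
    rcases upperPt_slicePt hI z with e | e
    · exact Or.inl (e.symm.trans h)
    · exact Or.inr (by rw [← h, e, star_star])

lemma exists_upperPt (q : ℍ[ℝ]) : ∃ I ∈ imagUnits, q = slicePt I (upperPt q) := exists_slicePt q

/-- Near a pole or removable singularity, a slice preserving function vanishes identically, or its
inverse has a pole or removable singularity. -/
lemma IsInduced.eq_zero_or_inv {c : ℍ[ℝ] → ℍ[ℝ]} {P : ℂ → ℂ} {U : Set ℍ[ℝ]}
    (hc : IsInduced c P U) {p : ℍ[ℝ]} (hp : IsPoleOrRemovable c U p) :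
    ∃ V : Set ℍ[ℝ], IsOpen V ∧ IsCircular V ∧ p ∈ V ∧ V \ sphereThrough p ⊆ U ∧
      ((∀ q ∈ V \ sphereThrough p, c q = 0) ∨
        ((∀ q ∈ V \ sphereThrough p, c q ≠ 0) ∧ ∃ (m : ℕ) (H : ℍ[ℝ] → ℍ[ℝ]), IsSliceRegular H V ∧
          ∀ q ∈ V \ sphereThrough p, H q = Delta p q ^ m * (c q)⁻¹)) := by
  obtain ⟨V, hVo, hVc, hpV, hVU, n, G, hG, hGc⟩ := hp
  obtain ⟨Q, hQd, hQ⟩ := hG.exists_holomorphic hVc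
  have hGi : IsInduced G (fun z => deltaPoly p z ^ n * P z) (V \ sphereThrough p) :=
    fun I hI z hz => by
      rw [hGc _ hz, Delta_pow_slicePt hI, hc I hI z (hVU hz), slicePt_mul hI]
  have hQP : ∀ I ∈ imagUnits, ∀ z, slicePt I z ∈ V → deltaPoly p z ≠ 0 →
      slicePt I z ∈ U ∧ Q z = deltaPoly p z ^ n * P z := by
    intro I hI z hz hd
    rw [Ne, deltaPoly_eq_zero_iff p hI] at hd
    refine ⟨hVU ⟨hz, hd⟩, slicePt_injective hI ?_⟩
    rw [← hQ _ Set.sdiff_subset (hVc.diff_sphere p) hGi.isSlicePreserving I hI z ⟨hz, hd⟩,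
      hGi I hI z ⟨hz, hd⟩]
  obtain ⟨I₀, hI₀, ep⟩ := exists_upperPt p
  set z₀ := upperPt p with hz₀
  have hev : ∀ᶠ z in nhds z₀, slicePt I₀ z ∈ V := eventually_slicePt_mem hVo (by rwa [← ep])
  have hQa : AnalyticAt ℂ Q z₀ := by
    rw [Complex.analyticAt_iff_eventually_differentiableAt]
    filter_upwards [hev] with z hz using hQd I₀ hI₀ z hz
  have hnbhd : ∀ ε > 0, IsOpen (V ∩ upperPt ⁻¹' Metric.ball z₀ ε) ∧
      IsCircular (V ∩ upperPt ⁻¹' Metric.ball z₀ ε) ∧ p ∈ V ∩ upperPt ⁻¹' Metric.ball z₀ ε :=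
    fun ε hε => ⟨hVo.inter (Metric.isOpen_ball.preimage continuous_upperPt),
      hVc.inter (isCircular_preimage_upperPt _), hpV, Metric.mem_ball_self hε⟩
  -- The dichotomy is that of isolated zeros for the holomorphic `Q = deltaPoly p ^ n * P`, which
  -- extends across `z₀`.
  by_cases hzero : ∀ᶠ z in nhds z₀, Q z = 0
  · obtain ⟨ε, hε, hball⟩ := Metric.eventually_nhds_iff_ball.1 hzero
    obtain ⟨h1, h2, h3⟩ := hnbhd ε hε
    refine ⟨_, h1, h2, h3, fun q hq => hVU ⟨hq.1.1, hq.2⟩, Or.inl fun q hq => ?_⟩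
    obtain ⟨I, hI, e⟩ := exists_upperPt q
    have hd : deltaPoly p (upperPt q) ≠ 0 := by
      rw [Ne, deltaPoly_eq_zero_iff p hI, ← e]; exact hq.2
    obtain ⟨hqU, hq0⟩ := hQP I hI (upperPt q) (by rw [← e]; exact hq.1.1) hd
    rw [hball _ hq.1.2] at hq0
    have hP : P (upperPt q) = 0 :=
      (mul_eq_zero.1 hq0.symm).resolve_left (pow_ne_zero _ hd)
    rw [e, hc I hI _ hqU, hP, slicePt_zero]
  · obtain ⟨k, h, ha, hh0, heq⟩ := hQa.exists_eventuallyEq_pow_smul_nonzero_iff.2 hzero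
    obtain ⟨ε, hε, hball⟩ := Metric.eventually_nhds_iff_ball.1
      (hev.and (heq.and ((ha.continuousAt.eventually_ne hh0).and
        (ha.eventually_analyticAt.mono fun z hz => hz.differentiableAt))))
    obtain ⟨h1, h2, h3⟩ := hnbhd ε hε
    -- If `k` is the order of `Q` at `z₀`, the power `k` would already remove the pole of `1 / P`.
    -- One more factor makes the extension vanish at the zeros of `deltaPoly p`, so it agrees there
    -- with `R`, whose value is `0` whatever `P` is.
    set R : ℂ → ℂ := fun z => deltaPoly p z ^ (k + 1) * (P z)⁻¹ with hR
    have hRb : ∀ z ∈ Metric.ball z₀ ε, R z =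
        (z - z₀) ^ (n + 1) * (z - star z₀) ^ (n + k + 1) * (h z)⁻¹ := by
      intro z hz
      obtain ⟨hzV, hzQ, hz0, -⟩ := hball z hz
      by_cases hd : deltaPoly p z = 0
      · have : R z = 0 := by rw [hR]; simp [hd]
        rw [this]
        rw [deltaPoly_eq, mul_eq_zero] at hd
        rw [← hz₀] at hd
        rcases hd with hd | hd <;> rw [hd] <;> simp
      · obtain ⟨-, e⟩ := hQP I₀ hI₀ z hzV hd
        rw [hzQ, smul_eq_mul] at e
        have hd' := hd
        rw [deltaPoly_eq, ← hz₀, mul_eq_zero, not_or] at hd'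
        have hP : P z = (z - z₀) ^ k * h z / deltaPoly p z ^ n := by
          rw [e]; field_simp
        obtain ⟨e1, e2⟩ := hd'
        rw [hR]
        simp only [hP, deltaPoly_eq, ← hz₀]
        generalize z - z₀ = a at *
        generalize z - star z₀ = b at *
        field_simp
        ring
    have hRd : ∀ z ∈ Metric.ball z₀ ε, DifferentiableAt ℂ R z := by
      intro z hz
      obtain ⟨-, -, hz0, hhd⟩ := hball z hz
      have : DifferentiableAt ℂ
          (fun z => (z - z₀) ^ (n + 1) * (z - star z₀) ^ (n + k + 1) * (h z)⁻¹) z := by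
        have := hhd.inv hz0
        fun_prop
      refine this.congr_of_eventuallyEq ?_
      filter_upwards [Metric.isOpen_ball.mem_nhds hz] with w hw using hRb w hw
    have hRs : ∀ z ∈ Metric.ball z₀ ε, R (star z) = star (R z) := by
      intro z hz
      simp only [hR, deltaPoly_star, star_mul', star_pow, star_inv₀]
      by_cases hd : deltaPoly p z = 0
      · simp [hd]
      · rw [hc.star_eq hI₀ (hQP I₀ hI₀ z (hball z hz).1 hd).1]
    refine ⟨_, h1, h2, h3, fun q hq => hVU ⟨hq.1.1, hq.2⟩, Or.inr ⟨fun q hq => ?_, k + 1,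
      fun q => Delta p q ^ (k + 1) * (c q)⁻¹, ?_, fun q _ => rfl⟩⟩
    · obtain ⟨I, hI, e⟩ := exists_upperPt q
      have hd : deltaPoly p (upperPt q) ≠ 0 := by
        rw [Ne, deltaPoly_eq_zero_iff p hI, ← e]; exact hq.2
      obtain ⟨hqU, hqQ⟩ := hQP I hI (upperPt q) (by rw [← e]; exact hq.1.1) hd
      obtain ⟨-, hzQ, hz0, -⟩ := hball _ hq.1.2
      rw [e, hc I hI _ hqU, Ne, slicePt_eq_zero hI]
      intro hP
      rw [hP, mul_zero, hzQ, smul_eq_mul] at hqQ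
      rw [deltaPoly_eq, ← hz₀, mul_ne_zero_iff] at hd
      exact mul_ne_zero (pow_ne_zero _ hd.1) hz0 hqQ
    · have hi : IsInduced (fun q => Delta p q ^ (k + 1) * (c q)⁻¹) R
          (V ∩ upperPt ⁻¹' Metric.ball z₀ ε) := by
        intro I hI z hz
        simp only [Delta_pow_slicePt hI, hR]
        by_cases hd : deltaPoly p z = 0
        · simp [hd, slicePt_zero]
        · rw [hc I hI z (hQP I hI z hz.1 hd).1, ← slicePt_inv hI, ← slicePt_mul hI]
      refine hi.isSliceRegular h1 fun I hI z hz => ?_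
      have hz2 : upperPt (slicePt I z) ∈ Metric.ball z₀ ε := hz.2
      rcases upperPt_slicePt hI z with e | e <;> rw [e] at hz2
      · exact hRd z hz2
      -- Only the ball around `z₀`, in the closed upper half-plane, is controlled; a point whose
      -- conjugate lies in it is handled by the reflection `R (star z) = star (R z)`.
      · have hcc := (hRd _ hz2).conj_conj
        have e' : (starRingEnd ℂ) (star z) = z := star_star z
        rw [e'] at hcc
        refine hcc.congr_of_eventuallyEq ?_
        have hopen : ∀ᶠ w in nhds z, star w ∈ Metric.ball z₀ ε :=
          continuous_star.continuousAt.eventually (Metric.isOpen_ball.mem_nhds hz2)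
        filter_upwards [hopen] with w hw
        have := hRs _ hw
        rw [star_star] at this
        rw [this]
        rfl

end SliceFun

/-! ### Global dichotomy: zero or invertible -/

namespace SliceFun

/-- A real translation of `a` changes its real part, and each sphere allows only one value of it. -/
lemma exists_mem_not_mem_spheres {V : Set ℍ[ℝ]} (hV : IsOpen V) {a : ℍ[ℝ]} (ha : a ∈ V)
    (p p' : ℍ[ℝ]) : ∃ q ∈ V, q ∉ sphereThrough p ∧ q ∉ sphereThrough p' := by
  have hc : Continuous fun t : ℝ => a + (t : ℍ[ℝ]) := by
    have := Quaternion.continuous_coe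
    fun_prop
  have hev : ∀ᶠ t : ℝ in nhds 0, a + (t : ℍ[ℝ]) ∈ V :=
    hc.continuousAt.eventually (hV.mem_nhds (by simpa using ha))
  obtain ⟨ε, hε, hball⟩ := Metric.eventually_nhds_iff_ball.1 hev
  have hfin : ({p.re - a.re, p'.re - a.re} : Set ℝ).Finite := by simp
  have hinf : (Metric.ball (0 : ℝ) ε).Infinite := by
    rw [Real.ball_eq_Ioo]
    exact Set.Ioo_infinite (by linarith)
  obtain ⟨t, ht, ht'⟩ := hinf.exists_notMem_finite hfin
  refine ⟨_, hball t ht, fun h => ht' ?_, fun h => ht' ?_⟩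
  · rw [mem_sphereThrough] at h
    left
    rw [← h.1]; simp
  · rw [mem_sphereThrough] at h
    right
    rw [← h.1]; simp

/-- By continuity of `P`, approaching `z` along the real direction, which leaves the sphere through
`p` at once. -/
lemma IsInduced.eq_zero_of_punctured {c : ℍ[ℝ] → ℍ[ℝ]} {P : ℂ → ℂ} {U V : Set ℍ[ℝ]}
    (hU : IsOpen U) (hc : IsInduced c P U)
    (hP : ∀ I ∈ imagUnits, ∀ z, slicePt I z ∈ U → DifferentiableAt ℂ P z) {p : ℍ[ℝ]}
    (hpU : p ∈ U) (hV : IsOpen V) (hpV : p ∈ V) (h : ∀ q ∈ V \ sphereThrough p, c q = 0) :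
    c p = 0 := by
  obtain ⟨I, hI, e⟩ := exists_upperPt p
  set z := upperPt p with hz
  have hs : ContinuousAt (fun t : ℝ => z + (t : ℂ)) 0 := by fun_prop
  have hz0 : z + ((0 : ℝ) : ℂ) = z := by simp
  have hcont : ContinuousAt (fun t : ℝ => P (z + (t : ℂ))) 0 := by
    refine ContinuousAt.comp (g := P) (f := fun t : ℝ => z + (t : ℂ)) ?_ hs
    rw [hz0]
    exact (hP I hI z (by rwa [← e])).continuousAt
  have hev : ∀ᶠ t : ℝ in nhds 0, slicePt I (z + (t : ℂ)) ∈ U ∩ V :=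
    hs.eventually (p := fun w => slicePt I w ∈ U ∩ V) (by
      simp only [hz0]
      exact eventually_slicePt_mem (hU.inter hV) (by rw [← e]; exact ⟨hpU, hpV⟩))
  have hev' : (fun t : ℝ => P (z + (t : ℂ))) =ᶠ[nhdsWithin 0 {0}ᶜ] fun _ => 0 := by
    filter_upwards [hev.filter_mono nhdsWithin_le_nhds, self_mem_nhdsWithin] with t ht ht0
    have hn : slicePt I (z + (t : ℂ)) ∉ sphereThrough p := by
      rw [mem_sphereThrough, slicePt_re hI]
      intro h'
      exact ht0 (by simpa [hz, upperPt] using h'.1)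
    have := h _ ⟨ht.2, hn⟩
    rw [hc I hI _ ht.1] at this
    exact (slicePt_eq_zero hI).1 this
  have h0 := ((hcont.eventuallyEq_nhds_iff_eventuallyEq_nhdsNE continuousAt_const).1 hev').eq_of_nhds
  have h0' : P z = 0 := by simpa using h0
  rw [e, hc I hI z (by rwa [← e]), h0', slicePt_zero]

/-- A slice preserving semi-regular function vanishes identically, or it has a semi-regular
inverse. -/
lemma IsSemiRegularOn.eq_zero_or_inv {Ω : CircularDomain} {c : ℍ[ℝ] → ℍ[ℝ]} {U : Set ℍ[ℝ]}
    (hc : IsSemiRegularOn c Ω.carrier U) (hp : IsSlicePreserving c U) :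
    (∀ q ∈ U, c q = 0) ∨ ∃ W ⊆ U, IsSemiRegularOn (fun q => (c q)⁻¹) Ω.carrier W ∧
      IsSlicePreserving (fun q => (c q)⁻¹) W ∧ ∀ q ∈ W, c q ≠ 0 := by
  obtain ⟨P, hPd, hP⟩ := hc.isSliceRegular.exists_holomorphic hc.isCircular
  have hcP := hP U subset_rfl hc.isCircular hp
  have hloc := fun p (hpΩ : p ∈ Ω.carrier) => hcP.eq_zero_or_inv (hc.isPole_all hpΩ)
  -- `A` and `B` collect the points near which `c`, off one sphere, is identically zero,
  -- respectively nowhere zero. They are open, disjoint and cover the connected domain, so one of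
  -- them contains it.
  set A : Set ℍ[ℝ] := ⋃₀ {V | IsOpen V ∧ ∃ p, ∀ q ∈ V \ sphereThrough p, c q = 0} with hA
  set B : Set ℍ[ℝ] := ⋃₀ {V | IsOpen V ∧ ∃ p, ∀ q ∈ V \ sphereThrough p, c q ≠ 0} with hB
  have hdisj : Disjoint A B := by
    rw [Set.disjoint_left]
    rintro a ⟨V, ⟨hV, p, hVp⟩, haV⟩ ⟨V', ⟨hV', p', hVp'⟩, haV'⟩
    obtain ⟨q, hq, hqp, hqp'⟩ := exists_mem_not_mem_spheres (hV.inter hV') ⟨haV, haV'⟩ p p'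
    exact hVp' q ⟨hq.2, hqp'⟩ (hVp q ⟨hq.1, hqp⟩)
  have hcov : Ω.carrier ⊆ A ∪ B := fun p hpΩ => by
    obtain ⟨V, hV, -, hpV, -, h | ⟨h, -⟩⟩ := hloc p hpΩ
    · exact Or.inl ⟨V, ⟨hV, p, h⟩, hpV⟩
    · exact Or.inr ⟨V, ⟨hV, p, h⟩, hpV⟩
  rcases Ω.isConnected.isPreconnected.subset_or_subset (isOpen_sUnion fun V hV => hV.1)
    (isOpen_sUnion fun V hV => hV.1) hdisj hcov with hΩ | hΩ
  · refine Or.inl fun p hpU => ?_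
    obtain ⟨V, hV, -, hpV, -, h | ⟨h, -⟩⟩ := hloc p (hc.subset hpU)
    · exact hcP.eq_zero_of_punctured hc.isOpen hPd hpU hV hpV h
    · exact absurd (⟨V, ⟨hV, p, h⟩, hpV⟩ : p ∈ B)
        (Set.disjoint_left.1 hdisj (hΩ (hc.subset hpU)))
  -- The largest circular open part of `U` without zeros of `c`. The local result puts a punctured
  -- neighbourhood of each point of the domain in it, so its complement consists of poles and
  -- removable singularities of the inverse.
  · set W : Set ℍ[ℝ] := ⋃₀ {V | IsOpen V ∧ IsCircular V ∧ V ⊆ U ∧ ∀ q ∈ V, c q ≠ 0} with hW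
    have hWU : W ⊆ U := Set.sUnion_subset fun V hV => hV.2.2.1
    have hWo : IsOpen W := isOpen_sUnion fun V hV => hV.1
    have hWc : IsCircular W := by
      rintro p ⟨V, hV, hpV⟩ q hq
      exact ⟨V, hV, hV.2.1 p hpV hq⟩
    have hW0 : ∀ q ∈ W, c q ≠ 0 := by
      rintro q ⟨V, hV, hq⟩
      exact hV.2.2.2 q hq
    have hi : IsInduced (fun q => (c q)⁻¹) (fun z => (P z)⁻¹) W := fun I hI z hz => by
      simp only [hcP I hI z (hWU hz), slicePt_inv hI]
    refine Or.inr ⟨W, hWU, ⟨hWU.trans hc.subset, hWo, hWc,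
      hi.isSliceRegular hWo fun I hI z hz => (hPd I hI z (hWU hz)).inv fun h0 => ?_,
      fun p hpΩ => ?_⟩, hi.isSlicePreserving, hW0⟩
    · refine hW0 _ hz ?_
      rw [hcP I hI z (hWU hz), h0, slicePt_zero]
    · obtain ⟨V, hV, hVc, hpV, hVU, h | ⟨h, m, H, hH, hHc⟩⟩ := hloc p hpΩ.1
      · exact absurd (hΩ hpΩ.1) (Set.disjoint_left.1 hdisj (⟨V, ⟨hV, p, h⟩, hpV⟩ : p ∈ A))
      · exact ⟨V, hV, hVc, hpV, fun q hq => ⟨V \ sphereThrough p,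
          ⟨hV.sdiff (isClosed_sphereThrough p), hVc.diff_sphere p, hVU, h⟩, hq⟩, m, H, hH, hHc⟩

end SliceFun

/-! ### The field of slice preserving semi-regular functions -/

namespace SliceFun

variable {Ω : CircularDomain}

lemma SEM.const_eq_of_eq {a b : ℍ[ℝ]} (h : (SEM.const a : SEM Ω) = SEM.const b) : a = b := by
  obtain ⟨U, hU, hab⟩ := Quotient.exact h
  obtain ⟨p, hp⟩ := Ω.isConnected.nonempty
  obtain ⟨q, -, hq⟩ := mem_closure_iff.1 (hU.dense hp) Set.univ isOpen_univ trivial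
  exact hab q hq

instance : Nontrivial (SEM Ω) :=
  ⟨0, 1, fun h => zero_ne_one (α := ℍ[ℝ]) (SEM.const_eq_of_eq h)⟩

lemma SEM.mk_mul_mk_inv {c : ℍ[ℝ] → ℍ[ℝ]} {U W : Set ℍ[ℝ]} (hc : IsSemiRegularOn c Ω.carrier U)
    (hp : IsSlicePreserving c U) (hWU : W ⊆ U)
    (hW : IsSemiRegularOn (fun q => (c q)⁻¹) Ω.carrier W) (h0 : ∀ q ∈ W, c q ≠ 0) :
    SEM.mk c ⟨U, hc⟩ * SEM.mk _ ⟨W, hW⟩ = 1 :=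
  SEM.mk_eq hW.isCircularDense fun q hq => by
    rw [hp.starMul_eq (hWU hq), mul_inv_cancel₀ (h0 q hq)]

/-- If `c` did not vanish on all of `U`, it would have a `*`-inverse, which the class `0` cannot
have in a nontrivial ring. -/
lemma SEM.mk_eq_zero_iff {c : ℍ[ℝ] → ℍ[ℝ]} {U : Set ℍ[ℝ]} (hc : IsSemiRegularOn c Ω.carrier U)
    (hp : IsSlicePreserving c U) : SEM.mk c ⟨U, hc⟩ = 0 ↔ ∀ q ∈ U, c q = 0 := by
  refine ⟨fun h => ?_, fun h => SEM.mk_eq hc.isCircularDense h⟩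
  refine (hc.eq_zero_or_inv hp).resolve_right ?_
  rintro ⟨W, hWU, hW, -, h0⟩
  have := SEM.mk_mul_mk_inv hc hp hWU hW h0
  rw [h, zero_mul] at this
  exact zero_ne_one this

lemma SEMReal.exists_mul_eq_one (a : SEMReal Ω) (ha : a ≠ 0) : ∃ b : SEMReal Ω, a * b = 1 := by
  obtain ⟨_, c, U, hc, hp, rfl⟩ := a
  rcases hc.eq_zero_or_inv hp with h | ⟨W, hWU, hW, hWp, h0⟩
  · exact absurd (Subtype.ext ((SEM.mk_eq_zero_iff hc hp).2 h)) ha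
  · exact ⟨⟨_, _, W, hW, hWp, rfl⟩, Subtype.ext (SEM.mk_mul_mk_inv hc hp hWU hW h0)⟩

open Classical in
/-- The inverse of a slice preserving semi-regular function. -/
noncomputable def SEMReal.inverse (a : SEMReal Ω) : SEMReal Ω :=
  if h : a = 0 then 0 else (SEMReal.exists_mul_eq_one a h).choose

lemma SEMReal.mul_inverse (a : SEMReal Ω) (h : a ≠ 0) : a * SEMReal.inverse a = 1 := by
  rw [SEMReal.inverse, dif_neg h]
  exact (SEMReal.exists_mul_eq_one a h).choose_spec

/-- `SEM_ℝ(Ω)` is a field. -/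
noncomputable instance : Field (SEMReal Ω) :=
  { (inferInstance : Ring (SEMReal Ω)) with
    mul_comm := fun a b => Subtype.ext (SEMReal.mul_comm a.2 b)
    exists_pair_ne := ⟨0, 1, fun h => zero_ne_one (α := SEM Ω) (congrArg Subtype.val h)⟩
    inv := SEMReal.inverse
    mul_inv_cancel := SEMReal.mul_inverse
    inv_zero := dif_pos rfl
    nnqsmul := _
    nnqsmul_def := fun _ _ => rfl
    qsmul := _
    qsmul_def := fun _ _ => rfl }

noncomputable instance : Algebra (SEMReal Ω) (SEM Ω) where
  algebraMap := (SEMReal Ω).subtype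
  commutes' a b := SEMReal.mul_comm a.2 b
  smul_def' _ _ := rfl

end SliceFun

/-! ### Constants, conjugation and real parts in the ring of semi-regular functions -/

open Quaternion (basisI basisJ basisK)

namespace SliceFun

lemma HasComponents.add {f g : ℍ[ℝ] → ℍ[ℝ]} {U : Set ℍ[ℝ]} {α β γ δ : ℂ → ℍ[ℝ]}
    (hf : HasComponents f U α β) (hg : HasComponents g U γ δ) :
    HasComponents (fun q => f q + g q) U (fun z => α z + γ z) (fun z => β z + δ z) := by
  intro I hI z hz
  simp only [hf I hI z hz, hg I hI z hz, mul_add]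
  abel

lemma HasComponents.neg {f : ℍ[ℝ] → ℍ[ℝ]} {U : Set ℍ[ℝ]} {α β : ℂ → ℍ[ℝ]}
    (hf : HasComponents f U α β) :
    HasComponents (fun q => -f q) U (fun z => -α z) (fun z => -β z) := by
  intro I hI z hz
  simp only [hf I hI z hz, mul_neg]
  abel

lemma hasComponents_const (a : ℍ[ℝ]) (U : Set ℍ[ℝ]) :
    HasComponents (fun _ => a) U (fun _ => a) (fun _ => 0) :=
  fun I _ z _ => by simp

lemma HasComponents.isSlicePreserving {f : ℍ[ℝ] → ℍ[ℝ]} {U : Set ℍ[ℝ]} {a b : ℂ → ℝ}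
    (hf : HasComponents f U (fun z => (a z : ℍ[ℝ])) (fun z => (b z : ℍ[ℝ]))) :
    IsSlicePreserving f U := by
  rintro I hI _ ⟨hq, z, rfl⟩
  exact ⟨⟨a z, b z⟩, by rw [hf I hI z hq, slicePt_eq]⟩

lemma HasComponents.eq {f g : ℍ[ℝ] → ℍ[ℝ]} {U : Set ℍ[ℝ]} {α β γ δ : ℂ → ℍ[ℝ]}
    (hf : HasComponents f U α β) (hg : HasComponents g U γ δ) (h1 : ∀ z, α z = γ z)
    (h2 : ∀ z, β z = δ z) : ∀ q ∈ U, f q = g q := by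
  intro q hq
  obtain ⟨I, hI, e⟩ := exists_slicePt q
  rw [e] at hq ⊢
  rw [hf I hI _ hq, hg I hI _ hq, h1, h2]

namespace SEM

variable {Ω : CircularDomain}

lemma const_add (a b : ℍ[ℝ]) : (const (a + b) : SEM Ω) = const a + const b := rfl

lemma const_neg (a : ℍ[ℝ]) : (const (-a) : SEM Ω) = -const a := rfl

lemma const_one : (const 1 : SEM Ω) = 1 := rfl

lemma const_mul (a b : ℍ[ℝ]) : (const (a * b) : SEM Ω) = const a * const b := by
  refine mk_eq (isCircularDense_self Ω) fun q _ => ?_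
  change a * b = starMul (fun _ => a) (fun _ => b) q
  unfold starMul
  split_ifs with h
  · change a = 0 at h
    rw [h, zero_mul]
  · rfl

lemma conj_add (f g : SEM Ω) : conj (f + g) = conj f + conj g := by
  induction f using SEM.ind
  induction g using SEM.ind
  refine mk_eq (isCircularDense_self Ω) fun q _ => ?_
  simp only [regConj]
  simp only [smul_add, smul_sub, star_add, star_sub, mul_add, add_mul, mul_sub, sub_mul]
  abel

lemma conj_const (a : ℍ[ℝ]) : conj (const a : SEM Ω) = const (star a) := by
  refine mk_eq (isCircularDense_self Ω) fun q _ => ?_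
  have : (1 / 2 : ℝ) • (a + a) = a := by rw [← two_smul ℝ a, smul_smul]; norm_num
  simp only [regConj, this, sub_self, smul_zero, star_zero, mul_zero, zero_mul, add_zero]

lemma conj_mul (f g : SEM Ω) : conj (f * g) = conj g * conj f := by
  induction f using SEM.ind with | h f U hf =>
  induction g using SEM.ind with | h g V hg =>
  have hd := hf.isCircularDense.inter hg.isCircularDense
  obtain ⟨α, β, h1⟩ := hf.isSliceRegular.isSlice
  obtain ⟨γ, δ, h2⟩ := hg.isSliceRegular.isSlice
  have h1' := h1.mono (Set.inter_subset_left (t := V))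
  have h2' := h2.mono (Set.inter_subset_right (s := U))
  refine mk_eq hd (((h1'.starMul hd.isCircular h2').regConj hd.isCircular).eq
    ((h2'.regConj hd.isCircular).starMul hd.isCircular (h1'.regConj hd.isCircular))
    (fun z => by simp only [star_sub, star_mul]) fun z => ?_)
  simp only [star_add, star_mul]
  abel

lemma conj_of_mem {a : SEM Ω} (ha : a ∈ SEMReal Ω) : conj a = a := by
  obtain ⟨c, U, hc, hp, rfl⟩ := ha
  obtain ⟨α, β, h⟩ := hc.isSliceRegular.isSlice
  refine mk_eq hc.isCircularDense fun q hq => ?_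
  obtain ⟨I, hI, e⟩ := exists_slicePt q
  rw [e] at hq ⊢
  obtain ⟨e1, e2⟩ := h.real hc.isCircular hp hI hq
  have real_star : ∀ a : ℍ[ℝ], a = (a.re : ℍ[ℝ]) → star a = a := fun a ha =>
    (congrArg star ha).trans ((Quaternion.star_coe _).trans ha.symm)
  refine (h.regConj hc.isCircular I hI _ hq).trans ?_
  simp only [h I hI _ hq, real_star _ e1, real_star _ e2]

lemma re_mem (f : SEM Ω) : re f ∈ SEMReal Ω := by
  induction f using SEM.ind with | h f U hf =>
  obtain ⟨α, β, h⟩ := hf.isSliceRegular.isSlice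
  have h1 := (hasComponents_const ((1 / 2 : ℝ) : ℍ[ℝ]) U).starMul hf.isCircular
    (h.add (h.regConj hf.isCircular))
  have hU : Ω.carrier ∩ (U ∩ U) = U := by
    rw [Set.inter_self, Set.inter_eq_right]; exact hf.subset
  have hs := (isSemiRegular_const Ω ((1 / 2 : ℝ) : ℍ[ℝ])).starMul (hf.add hf.regConj)
  rw [hU] at hs
  refine ⟨_, U, hs, HasComponents.isSlicePreserving (a := fun z => (α z).re)
    (b := fun z => (β z).re) fun I hI z hz => ?_, rfl⟩
  rw [h1 I hI z hz]
  have key : ∀ a : ℍ[ℝ], ((1 / 2 : ℝ) : ℍ[ℝ]) * (a + star a) = (a.re : ℍ[ℝ]) := fun a => by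
    rw [Quaternion.coe_mul_eq_smul]
    ext <;> simp
    ring
  simp only [key, zero_mul, sub_zero, add_zero]

/-- The regular conjugate in terms of the ring structure. -/
lemma conj_eq (f : SEM Ω) : conj f + conj f = -(f + const (basisI ℝ) * f * const (basisI ℝ) +
    const (basisJ ℝ) * f * const (basisJ ℝ) + const (basisK ℝ) * f * const (basisK ℝ)) := by
  induction f using SEM.ind with | h f U hf =>
  obtain ⟨α, β, h⟩ := hf.isSliceRegular.isSlice
  have hC := hf.isCircular
  have hc := h.regConj hC
  have hq : ∀ a : ℍ[ℝ], HasComponents (starMul (starMul (fun _ => a) f) fun _ => a) U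
      (fun z => a * α z * a) (fun z => a * β z * a) := fun a => by
    have := ((hasComponents_const a U).starMul hC h).starMul hC (hasComponents_const a U)
    simpa only [zero_mul, mul_zero, sub_zero, add_zero, zero_add] using this
  have hsum := ((h.add (hq (basisI ℝ))).add (hq (basisJ ℝ))).add (hq (basisK ℝ))
  -- The identity is one of real quaternions; it transfers because `*`-multiplication by constants
  -- acts on each component separately.
  have key : ∀ a : ℍ[ℝ], star a + star a = -(a + basisI ℝ * a * basisI ℝ +
      basisJ ℝ * a * basisJ ℝ +
      basisK ℝ * a * basisK ℝ) := fun a => by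
    ext <;> simp
  exact mk_eq hf.isCircularDense
    ((hc.add hc).eq hsum.neg (fun z => key (α z)) (fun z => key (β z)))

end SEM

end SliceFun

/-! ### Identification with the quaternion algebra -/

namespace SliceFun

variable {Ω : CircularDomain}

lemma const_half_mul_two : (SEM.const ((1 / 2 : ℝ) : ℍ[ℝ]) : SEM Ω) * 2 = 1 := by
  have e : (2 : SEM Ω) = SEM.const ((2 : ℝ) : ℍ[ℝ]) := by
    have : ((2 : ℝ) : ℍ[ℝ]) = 1 + 1 := by
      rw [← one_add_one_eq_two, Quaternion.coe_add, Quaternion.coe_one]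
    rw [this, SEM.const_add, SEM.const_one, one_add_one_eq_two]
  rw [e, ← SEM.const_mul, ← Quaternion.coe_mul, ← SEM.const_one]
  norm_num

instance : NeZero (2 : SEMReal Ω) := ⟨fun h => by
  have h2 : (2 : SEM Ω) = 0 := congrArg Subtype.val h
  have := const_half_mul_two (Ω := Ω)
  rw [h2, mul_zero] at this
  exact zero_ne_one this⟩

/-- The basis `1, i, j, k` of `SEM(Ω)` over `SEM_ℝ(Ω)`. -/
noncomputable def quaternionBasis (Ω : CircularDomain) :
    QuaternionAlgebra.Basis (SEM Ω) (-1 : SEMReal Ω) 0 (-1) where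
  i := SEM.const (basisI ℝ)
  j := SEM.const (basisJ ℝ)
  k := SEM.const (basisK ℝ)
  i_mul_i := by
    rw [← SEM.const_mul, neg_smul, one_smul, zero_smul, add_zero, ← SEM.const_one, ← SEM.const_neg]
    congr 1
    ext <;> simp
  j_mul_j := by
    rw [← SEM.const_mul, neg_smul, one_smul, ← SEM.const_one, ← SEM.const_neg]
    congr 1
    ext <;> simp
  i_mul_j := by
    rw [← SEM.const_mul]
    congr 1
    ext <;> simp
  j_mul_i := by
    rw [← SEM.const_mul, zero_smul, zero_sub, ← SEM.const_neg]
    congr 1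
    ext <;> simp

/-- The homomorphism from the quaternion algebra over `SEM_ℝ(Ω)` to `SEM(Ω)`. -/
noncomputable def ofQuaternion (Ω : CircularDomain) : ℍ[SEMReal Ω] →ₐ[SEMReal Ω] SEM Ω :=
  (quaternionBasis Ω).liftHom

lemma ofQuaternion_apply (x : ℍ[SEMReal Ω]) :
    ofQuaternion Ω x = (x.re : SEM Ω) + (x.imI : SEM Ω) * SEM.const (basisI ℝ) +
      (x.imJ : SEM Ω) * SEM.const (basisJ ℝ) + (x.imK : SEM Ω) * SEM.const (basisK ℝ) := rfl

lemma ofQuaternion_coe (a : SEMReal Ω) : ofQuaternion Ω (a : ℍ[SEMReal Ω]) = a :=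
  (ofQuaternion Ω).commutes a

/-- By `sum_conj_basis`, an element of the kernel has real part zero, the map being injective on
scalars. The kernel is an ideal, so this applies to all products `x * y`, and the trace form is
nondegenerate. -/
lemma ofQuaternion_injective : Function.Injective (ofQuaternion Ω) := by
  have hre : ∀ x : ℍ[SEMReal Ω], ofQuaternion Ω x = 0 → x.re = 0 := fun x hx => by
    have h := congrArg (ofQuaternion Ω) (Quaternion.sum_conj_basis x)
    rw [ofQuaternion_coe] at h
    simp only [map_sub, map_mul, hx, mul_zero, zero_mul, sub_zero] at h
    have h4 : 4 * x.re = 0 := Subtype.ext h.symm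
    exact (mul_eq_zero.1 h4).resolve_left Quaternion.four_ne_zero_of_two
  rw [injective_iff_map_eq_zero]
  intro x hx
  exact Quaternion.eq_zero_of_forall_re_mul fun y => hre _ (by rw [map_mul, hx, zero_mul])

lemma two_mul_re (f : SEM Ω) : 2 * f.re = f + f.conj := by
  have : (2 : SEM Ω) * SEM.const ((1 / 2 : ℝ) : ℍ[ℝ]) = 1 := by
    rw [two_mul, ← mul_two, const_half_mul_two]
  rw [SEM.re, ← mul_assoc, this, one_mul]

lemma eq_of_two_mul_eq {f g : SEM Ω} (h : 2 * f = 2 * g) : f = g := by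
  have := congrArg (SEM.const ((1 / 2 : ℝ) : ℍ[ℝ]) * ·) h
  simpa only [← mul_assoc, const_half_mul_two, one_mul] using this

lemma ofQuaternion_surjective : Function.Surjective (ofQuaternion Ω) := by
  intro f
  -- The coordinate of a quaternion `x` along a basis unit `a` is the real part of `-a x`. Added up,
  -- the four doubled terms give `2 f` through `SEM.conj_eq`.
  let c (a : ℍ[ℝ]) : SEMReal Ω := ⟨(SEM.const (-a) * f).re, SEM.re_mem _⟩
  refine ⟨⟨⟨f.re, SEM.re_mem f⟩, c (basisI ℝ), c (basisJ ℝ), c (basisK ℝ)⟩, ?_⟩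
  have hc : ∀ a : ℍ[ℝ], star a = -a → a * a = -1 →
      2 * ((c a : SEM Ω) * SEM.const a) = -(SEM.const a * f * SEM.const a) - f.conj := by
    intro a ha haa
    rw [← mul_assoc, show ((c a : SEM Ω)) = (SEM.const (-a) * f).re from rfl, two_mul_re,
      SEM.conj_mul, SEM.conj_const, star_neg, ha, neg_neg, add_mul, mul_assoc f.conj,
      ← SEM.const_mul, haa, SEM.const_neg, SEM.const_neg, SEM.const_one, neg_mul, neg_mul,
      mul_neg, mul_one, sub_eq_add_neg]
  refine (ofQuaternion_apply _).trans (eq_of_two_mul_eq ?_)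
  have hI := hc (basisI ℝ) (by ext <;> simp) (by ext <;> simp)
  have hJ := hc (basisJ ℝ) (by ext <;> simp) (by ext <;> simp)
  have hK := hc (basisK ℝ) (by ext <;> simp) (by ext <;> simp)
  have hcj := SEM.conj_eq f
  change 2 * (f.re + (c (basisI ℝ) : SEM Ω) * SEM.const (basisI ℝ) +
    (c (basisJ ℝ) : SEM Ω) * SEM.const (basisJ ℝ) +
    (c (basisK ℝ) : SEM Ω) * SEM.const (basisK ℝ)) = 2 * f
  rw [mul_add, mul_add, mul_add, hI, hJ, hK, two_mul_re, two_mul]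
  have hcj' : SEM.const (basisI ℝ) * f * SEM.const (basisI ℝ) =
      -(f.conj + f.conj) - f - SEM.const (basisJ ℝ) * f * SEM.const (basisJ ℝ) -
        SEM.const (basisK ℝ) * f * SEM.const (basisK ℝ) := by
    rw [hcj]; abel
  rw [hcj']
  abel

/-- `SEM(Ω)` is the quaternion algebra over the field `SEM_ℝ(Ω)`. -/
noncomputable def quaternionEquiv (Ω : CircularDomain) : ℍ[SEMReal Ω] ≃ₐ[SEMReal Ω] SEM Ω :=
  AlgEquiv.ofBijective (ofQuaternion Ω) ⟨ofQuaternion_injective, ofQuaternion_surjective⟩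

lemma quaternionEquiv_coe (a : SEMReal Ω) : quaternionEquiv Ω (a : ℍ[SEMReal Ω]) = a :=
  ofQuaternion_coe a

lemma conj_quaternionEquiv (x : ℍ[SEMReal Ω]) :
    (quaternionEquiv Ω x).conj = quaternionEquiv Ω (star x) := by
  have hc : ∀ (a : SEMReal Ω) (b : ℍ[ℝ]), star b = -b →
      ((a : SEM Ω) * SEM.const b).conj = ((-a : SEMReal Ω) : SEM Ω) * SEM.const b := by
    intro a b hb
    rw [SEM.conj_mul, SEM.conj_const, SEM.conj_of_mem a.2, hb, ← SEMReal.mul_comm a.2,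
      SEM.const_neg, mul_neg, Subring.coe_neg, neg_mul]
  change (ofQuaternion Ω x).conj = ofQuaternion Ω (star x)
  rw [ofQuaternion_apply, ofQuaternion_apply, SEM.conj_add, SEM.conj_add, SEM.conj_add,
    SEM.conj_of_mem x.re.2, hc _ _ (by ext <;> simp), hc _ _ (by ext <;> simp),
    hc _ _ (by ext <;> simp)]
  simp only [Quaternion.re_star, Quaternion.imI_star, Quaternion.imJ_star, Quaternion.imK_star]

lemma re_quaternionEquiv (x : ℍ[SEMReal Ω]) : (quaternionEquiv Ω x).re = x.re := by
  apply eq_of_two_mul_eq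
  rw [two_mul_re, conj_quaternionEquiv, ← map_add, Quaternion.self_add_star, map_mul,
    quaternionEquiv_coe, map_ofNat]

lemma vec_quaternionEquiv (x : ℍ[SEMReal Ω]) :
    (quaternionEquiv Ω x).vec = quaternionEquiv Ω x.im := by
  rw [SEM.vec, re_quaternionEquiv, ← quaternionEquiv_coe, ← map_sub, Quaternion.sub_re_self]

lemma symm_quaternionEquiv (x : ℍ[SEMReal Ω]) :
    (quaternionEquiv Ω x).symm = (Quaternion.normSq x : SEMReal Ω) := by
  rw [SEM.symm, conj_quaternionEquiv, ← map_mul, Quaternion.self_mul_star, quaternionEquiv_coe]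

lemma quaternionEquiv_mem_iff (x : ℍ[SEMReal Ω]) :
    quaternionEquiv Ω x ∈ SEMReal Ω ↔ x.im = 0 := by
  constructor
  · intro h
    have : quaternionEquiv Ω x = quaternionEquiv Ω ((⟨_, h⟩ : SEMReal Ω) : ℍ[SEMReal Ω]) := by
      rw [quaternionEquiv_coe]
    rw [(quaternionEquiv Ω).injective this, Quaternion.im_coe]
  · intro h
    rw [← Quaternion.re_add_im x, h, add_zero, quaternionEquiv_coe]
    exact x.re.2

end SliceFun

/-! ### Product domains and slice domains -/

namespace SliceFun

variable {Ω : CircularDomain}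

/-- Off the real axis the inducing function is locally constant, hence holomorphic, with values the
two square roots of `-1`. -/
lemma isInduced_unitIm {U : Set ℍ[ℝ]} (hU : ∀ x : ℝ, (x : ℍ[ℝ]) ∉ U) :
    IsInduced unitIm (fun z => if 0 < z.im then Complex.I else -Complex.I) U := by
  intro I hI z hz
  have h0 : z.im ≠ 0 := fun h0 => hU z.re (by simpa [slicePt, h0] using hz)
  rw [unitIm, norm_slicePt_im hI, slicePt_im hI, smul_smul]
  dsimp only
  split_ifs with h
  · rw [abs_of_pos h, inv_mul_cancel₀ h0]
    simp [slicePt]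
  · have h' : z.im < 0 := lt_of_le_of_ne (not_lt.1 h) h0
    rw [abs_of_neg h', inv_neg, neg_mul, inv_mul_cancel₀ h0]
    simp [slicePt]

/-- On a product domain, `-1` is a square in `SEM_ℝ(Ω)`. -/
lemma exists_sq_eq_neg_one (hΩ : Ω.IsProductDomain) : ∃ ι : SEMReal Ω, ι ^ 2 = -1 := by
  have hi := isInduced_unitIm hΩ
  have hr : IsSemiRegularOn unitIm Ω.carrier Ω.carrier := by
    refine ⟨subset_rfl, Ω.isOpen, Ω.isCircular, hi.isSliceRegular Ω.isOpen fun I hI z hz => ?_,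
      by simp⟩
    have h0 : z.im ≠ 0 := fun h0 => hΩ z.re (by simpa [slicePt, h0] using hz)
    rcases lt_or_gt_of_ne h0 with h | h
    · refine (differentiableAt_const (-Complex.I)).congr_of_eventuallyEq ?_
      filter_upwards [Complex.continuous_im.continuousAt.eventually (Iio_mem_nhds h)] with w hw
      exact if_neg (not_lt.2 (le_of_lt hw))
    · refine (differentiableAt_const Complex.I).congr_of_eventuallyEq ?_
      filter_upwards [Complex.continuous_im.continuousAt.eventually (Ioi_mem_nhds h)] with w hw
      exact if_pos hw
  refine ⟨⟨_, _, _, hr, hi.isSlicePreserving, rfl⟩, Subtype.ext ?_⟩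
  rw [sq]
  refine SEM.mk_eq (SEM.isCircularDense_self Ω) fun q hq => ?_
  rw [hi.isSlicePreserving.starMul_eq hq]
  obtain ⟨I, hI, e⟩ := exists_slicePt q
  rw [e] at hq ⊢
  change unitIm _ * unitIm _ = -1
  rw [hi I hI _ hq]
  dsimp only
  split_ifs <;> simp [slicePt, sq_of_mem hI]

lemma IsSlicePreserving.eq_re {c : ℍ[ℝ] → ℍ[ℝ]} {U : Set ℍ[ℝ]} (hc : IsSlicePreserving c U)
    {x : ℝ} (hx : (x : ℍ[ℝ]) ∈ U) : c x = ((c x).re : ℍ[ℝ]) :=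
  mem_lines_real (hc _ i_mem _ ⟨hx, real_mem_line _ x⟩) (hc _ j_mem _ ⟨hx, real_mem_line _ x⟩)

/-- On a slice domain, `SEM_ℝ(Ω)` is formally real. -/
lemma eq_zero_of_sum_sq_eq_zero (hΩ : ¬Ω.IsProductDomain) {a b c d : SEMReal Ω}
    (h : a * a + b * b + c * c + d * d = 0) : a = 0 := by
  obtain ⟨_, a, A, ha, hpa, rfl⟩ := a
  obtain ⟨_, b, B, hb, hpb, rfl⟩ := b
  obtain ⟨_, c, C, hc, hpc, rfl⟩ := c
  obtain ⟨_, d, D, hd, hpd, rfl⟩ := d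
  have h' := congrArg Subtype.val h
  rw [CircularDomain.IsProductDomain] at hΩ
  push Not at hΩ
  obtain ⟨x, hx⟩ := hΩ
  set s : ℍ[ℝ] → ℍ[ℝ] := fun q => starMul a a q + starMul b b q + starMul c c q + starMul d d q
    with hs
  have hsr : IsSemiRegularOn s Ω.carrier (((A ∩ A) ∩ (B ∩ B)) ∩ (C ∩ C) ∩ (D ∩ D)) :=
    (((ha.starMul ha).add (hb.starMul hb)).add (hc.starMul hc)).add (hd.starMul hd)
  have hmul : ∀ {f : ℍ[ℝ] → ℍ[ℝ]} {U : Set ℍ[ℝ]}, IsSlicePreserving f U → ∀ q ∈ U,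
      starMul f f q = f q * f q := fun hf q hq => hf.starMul_eq hq
  have hline : ∀ {f : ℍ[ℝ] → ℍ[ℝ]} {U : Set ℍ[ℝ]}, IsSlicePreserving f U → ∀ I ∈ imagUnits,
      ∀ q ∈ U, q ∈ complexLine I → starMul f f q ∈ complexLine I := fun hf I hI q hq hqI => by
    rw [hmul hf q hq]
    exact mul_mem_line hI (hf I hI q ⟨hq, hqI⟩) (hf I hI q ⟨hq, hqI⟩)
  have hsp : IsSlicePreserving s (((A ∩ A) ∩ (B ∩ B)) ∩ (C ∩ C) ∩ (D ∩ D)) :=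
    fun I hI q ⟨⟨⟨⟨hA, hB⟩, hC⟩, hD⟩, hq⟩ => add_mem_line (add_mem_line (add_mem_line
      (hline hpa I hI q hA.1 hq) (hline hpb I hI q hB.1 hq)) (hline hpc I hI q hC.1 hq))
      (hline hpd I hI q hD.1 hq)
  have hs0 : ∀ q ∈ ((A ∩ A) ∩ (B ∩ B)) ∩ (C ∩ C) ∩ (D ∩ D), s q = 0 :=
    (SEM.mk_eq_zero_iff hsr hsp).1 h'
  -- If `a` is not zero, it has no zeros on `W`. Real points close to `x` lie both in `W` and in the
  -- common set of regularity; there the four functions have real values with squares adding up to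
  -- zero, so `a` vanishes, a contradiction.
  rcases ha.eq_zero_or_inv hpa with h0 | ⟨W, -, hW, -, hW0⟩
  · exact Subtype.ext ((SEM.mk_eq_zero_iff ha hpa).2 h0)
  · exfalso
    obtain ⟨V, hV, -, hxV, hVU, -⟩ := hsr.isPole_all hx
    obtain ⟨V', hV', -, hxV', hVW, -⟩ := hW.isPole_all hx
    have hcont : ContinuousAt (fun t : ℝ => (t : ℍ[ℝ])) x := Quaternion.continuous_coe.continuousAt
    have hev : ∀ᶠ t : ℝ in nhds x, (t : ℍ[ℝ]) ∈ V ∩ V' :=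
      hcont.eventually ((hV.inter hV').mem_nhds ⟨hxV, hxV'⟩)
    obtain ⟨t, ht, htx⟩ := ((hev.filter_mono nhdsWithin_le_nhds).and
      (self_mem_nhdsWithin (a := x) (s := {x}ᶜ))).exists
    have htS : (t : ℍ[ℝ]) ∉ sphereThrough x := fun hS =>
      htx (by simpa using (mem_sphereThrough.1 hS).1)
    have htU := hVU ⟨ht.1, htS⟩
    have hst := hs0 _ htU
    obtain ⟨⟨⟨hA, hB⟩, hC⟩, hD⟩ := htU
    simp only [hs] at hst
    rw [hmul hpa _ hA.1, hmul hpb _ hB.1, hmul hpc _ hC.1, hmul hpd _ hD.1, hpa.eq_re hA.1,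
      hpb.eq_re hB.1, hpc.eq_re hC.1, hpd.eq_re hD.1] at hst
    have hre := congrArg (fun q : ℍ[ℝ] => q.re) hst
    simp only [← Quaternion.coe_mul, ← Quaternion.coe_add, Quaternion.re_coe,
      Quaternion.re_zero] at hre
    have ha0 : (a t).re = 0 := by
      nlinarith [mul_self_nonneg (a t).re, mul_self_nonneg (b t).re, mul_self_nonneg (c t).re,
        mul_self_nonneg (d t).re]
    exact hW0 _ (hVW ⟨ht.2, htS⟩) (by rw [hpa.eq_re hA.1, ha0, Quaternion.coe_zero])

/-- The norm is a sum of four squares, so on a slice domain every nonzero semi-regular function is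
`*`-invertible. -/
lemma eq_zero_of_normSq_eq_zero (hΩ : ¬Ω.IsProductDomain) {x : ℍ[SEMReal Ω]}
    (h : Quaternion.normSq x = 0) : x = 0 := by
  rw [Quaternion.normSq_def'] at h
  have h0 : x.re = 0 := eq_zero_of_sum_sq_eq_zero hΩ (b := x.imI) (c := x.imJ) (d := x.imK)
    (by linear_combination h)
  have h1 : x.imI = 0 := eq_zero_of_sum_sq_eq_zero hΩ (b := x.re) (c := x.imJ) (d := x.imK)
    (by linear_combination h)
  have h2 : x.imJ = 0 := eq_zero_of_sum_sq_eq_zero hΩ (b := x.re) (c := x.imI) (d := x.imK)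
    (by linear_combination h)
  have h3 : x.imK = 0 := eq_zero_of_sum_sq_eq_zero hΩ (b := x.re) (c := x.imI) (d := x.imJ)
    (by linear_combination h)
  ext1 <;> assumption

end SliceFun

/-! ### Transfer to semi-regular functions and the main theorem -/

namespace SliceFun

variable {Ω : CircularDomain}

lemma sylvester_quaternionEquiv (F G x : ℍ[SEMReal Ω]) :
    sylvester (quaternionEquiv Ω F) (quaternionEquiv Ω G) (quaternionEquiv Ω x) =
      quaternionEquiv Ω (Quaternion.sylvester F G x) := by
  rw [Quaternion.sylvester_apply, map_add, map_mul, map_mul]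
  rfl

lemma mem_ker_sylvester_quaternionEquiv {F G x : ℍ[SEMReal Ω]} :
    quaternionEquiv Ω x ∈ LinearMap.ker (sylvester (quaternionEquiv Ω F) (quaternionEquiv Ω G)) ↔
      x ∈ LinearMap.ker (Quaternion.sylvester F G) := by
  rw [LinearMap.mem_ker, LinearMap.mem_ker, sylvester_quaternionEquiv,
    EmbeddingLike.map_eq_zero_iff]

lemma exists_mem_ker_sylvester_iff {F G : ℍ[SEMReal Ω]} (p : SEM Ω → Prop) :
    (∃ χ ∈ LinearMap.ker (sylvester (quaternionEquiv Ω F) (quaternionEquiv Ω G)), p χ) ↔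
      ∃ x ∈ LinearMap.ker (Quaternion.sylvester F G), p (quaternionEquiv Ω x) := by
  constructor
  · rintro ⟨χ, hχ, h⟩
    obtain ⟨x, rfl⟩ := (quaternionEquiv Ω).surjective χ
    exact ⟨x, mem_ker_sylvester_quaternionEquiv.1 hχ, h⟩
  · rintro ⟨x, hx, h⟩
    exact ⟨_, mem_ker_sylvester_quaternionEquiv.2 hx, h⟩

lemma ker_sylvester_eq_bot_iff {F G : ℍ[SEMReal Ω]} :
    LinearMap.ker (sylvester (quaternionEquiv Ω F) (quaternionEquiv Ω G)) = ⊥ ↔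
      LinearMap.ker (Quaternion.sylvester F G) = ⊥ := by
  have h := exists_mem_ker_sylvester_iff (F := F) (G := G) fun χ => χ ≠ 0
  simp only [ne_eq, EmbeddingLike.map_eq_zero_iff] at h
  rw [← not_iff_not, ← Ne, ← Ne, Submodule.ne_bot_iff, Submodule.ne_bot_iff]
  exact h

lemma rank_sylvester_quaternionEquiv (F G : ℍ[SEMReal Ω]) :
    (sylvester (quaternionEquiv Ω F) (quaternionEquiv Ω G)).rank =
      (Quaternion.sylvester F G).rank := by
  have h : LinearMap.range (sylvester (quaternionEquiv Ω F) (quaternionEquiv Ω G)) =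
      (LinearMap.range (Quaternion.sylvester F G)).map
        (quaternionEquiv Ω).toLinearEquiv.toLinearMap := by
    ext χ
    constructor
    · rintro ⟨ψ, rfl⟩
      obtain ⟨x, rfl⟩ := (quaternionEquiv Ω).surjective ψ
      exact ⟨_, ⟨x, rfl⟩, (sylvester_quaternionEquiv F G x).symm⟩
    · rintro ⟨_, ⟨x, rfl⟩, rfl⟩
      exact ⟨quaternionEquiv Ω x, sylvester_quaternionEquiv F G x⟩
  rw [LinearMap.rank, h]
  exact LinearEquiv.rank_map_eq (quaternionEquiv Ω).toLinearEquiv _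

lemma isUnit_quaternionEquiv_iff {x : ℍ[SEMReal Ω]} : IsUnit (quaternionEquiv Ω x) ↔ IsUnit x :=
  MulEquiv.isUnit_map (quaternionEquiv Ω)

lemma isZeroDivisor_quaternionEquiv_iff {x : ℍ[SEMReal Ω]} :
    (quaternionEquiv Ω x).IsZeroDivisor ↔ x ≠ 0 ∧ Quaternion.normSq x = 0 := by
  rw [SEM.IsZeroDivisor, Ne, EmbeddingLike.map_eq_zero_iff]
  refine and_congr_right fun hx => ?_
  rw [← Quaternion.exists_mul_eq_zero_iff hx, (quaternionEquiv Ω).surjective.exists]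
  simp only [← map_mul, ne_eq, EmbeddingLike.map_eq_zero_iff]

/-- The relation `f = h⁻¹ * (-g) * h` is `f * h⁻¹ + h⁻¹ * g = 0`, so the unit in the kernel is the
inverse of the conjugating element. -/
lemma equivalent_neg_iff (f g : SEM Ω) :
    f.Equivalent (-g) ↔ ∃ χ ∈ LinearMap.ker (sylvester f g), IsUnit χ := by
  constructor
  · rintro ⟨h, e⟩
    refine ⟨↑h⁻¹, ?_, h⁻¹.isUnit⟩
    change f * ↑h⁻¹ + ↑h⁻¹ * g = 0
    rw [e, mul_assoc, Units.mul_inv, mul_one, mul_neg, neg_add_cancel]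
  · rintro ⟨_, hχ, h, rfl⟩
    change f * h + h * g = 0 at hχ
    refine ⟨h⁻¹, ?_⟩
    rw [inv_inv, mul_neg, ← eq_neg_of_add_eq_zero_left hχ, mul_assoc, Units.mul_inv, mul_one]

end SliceFun

open SliceFun in
theorem mainTheorem1 (Ω : CircularDomain) (f g : SEM Ω)
    (hf : f ∉ SEMReal Ω) (hg : g ∉ SEMReal Ω) :
    1 < (sylvester f g).rank ∧
    ((sylvester f g).rank = 4 ↔
      (f.re + g.re) ^ 2 * ((f.re + g.re) ^ 2 + 2 * (f.vec.symm + g.vec.symm)) +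
        (f.vec.symm - g.vec.symm) ^ 2 ≠ 0) ∧
    (((sylvester f g).rank = 3 ↔
        (f.re + g.re) ^ 2 * ((f.re + g.re) ^ 2 + 2 * (f.vec.symm + g.vec.symm)) +
          (f.vec.symm - g.vec.symm) ^ 2 = 0 ∧ f.re + g.re ≠ 0) ∧
      ((sylvester f g).rank = 3 ↔
        LinearMap.ker (sylvester f g) ≠ ⊥ ∧
          ∀ χ ∈ LinearMap.ker (sylvester f g), χ ≠ 0 → χ.IsZeroDivisor) ∧
      ((sylvester f g).rank = 3 → Ω.IsProductDomain)) ∧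
    (((sylvester f g).rank = 2 ↔ f.Equivalent (-g)) ∧
      ((sylvester f g).rank = 2 ↔ f.re + g.re = 0 ∧ f.vec.symm = g.vec.symm) ∧
      ((sylvester f g).rank = 2 ↔ ∃ χ ∈ LinearMap.ker (sylvester f g), IsUnit χ)) ∧
    ((sylvester f g).rank = 2 →
      ((∃ χ ∈ LinearMap.ker (sylvester f g), χ.IsZeroDivisor) ↔
        Ω.IsProductDomain ∧
          ((f.vec = g.vec ∧ ∃ ρ ∈ SEMReal Ω, ρ ^ 2 = f.vec.symm) ∨
            (f.vec ≠ g.vec ∧ (f.vec - g.vec).symm = 0) ∨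
            ((f.vec - g.vec).symm ≠ 0 ∧ ∃ ρ ∈ SEMReal Ω, ρ ^ 2 = f.vec.symm)))) := by

  obtain ⟨F, rfl⟩ := (quaternionEquiv Ω).surjective f
  obtain ⟨G, rfl⟩ := (quaternionEquiv Ω).surjective g
  rw [quaternionEquiv_mem_iff] at hf hg
  have hcoe : ∀ a b : SEMReal Ω, (a : SEM Ω) = b ↔ a = b := fun _ _ => Subtype.coe_inj
  have hcoe0 : ∀ a : SEMReal Ω, (a : SEM Ω) = 0 ↔ a = 0 := fun a => hcoe a 0
  have hD : ((quaternionEquiv Ω F).re + (quaternionEquiv Ω G).re) ^ 2 *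
        (((quaternionEquiv Ω F).re + (quaternionEquiv Ω G).re) ^ 2 +
          2 * ((quaternionEquiv Ω F).vec.symm + (quaternionEquiv Ω G).vec.symm)) +
        ((quaternionEquiv Ω F).vec.symm - (quaternionEquiv Ω G).vec.symm) ^ 2 =
      (Quaternion.sylvesterDisc F G : SEMReal Ω) := by
    simp only [re_quaternionEquiv, vec_quaternionEquiv, symm_quaternionEquiv]
    rfl
  have hρ : (∃ ρ ∈ SEMReal Ω, ρ ^ 2 = (quaternionEquiv Ω F).vec.symm) ↔
      ∃ ρ : SEMReal Ω, ρ ^ 2 = Quaternion.normSq F.im := by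
    rw [vec_quaternionEquiv, symm_quaternionEquiv]
    exact ⟨fun ⟨ρ, h, e⟩ => ⟨⟨ρ, h⟩, Subtype.ext e⟩,
      fun ⟨ρ, e⟩ => ⟨ρ, ρ.2, congrArg Subtype.val e⟩⟩
  rw [hD, hρ, equivalent_neg_iff, exists_mem_ker_sylvester_iff IsUnit,
    exists_mem_ker_sylvester_iff SEM.IsZeroDivisor, rank_sylvester_quaternionEquiv]
  simp only [ne_eq, ker_sylvester_eq_bot_iff]
  -- Every nonzero element is either a unit or a zero divisor, so a kernel whose nonzero elements
  -- are all zero divisors is one without units.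
  have hall : (∀ χ ∈ LinearMap.ker (sylvester (quaternionEquiv Ω F) (quaternionEquiv Ω G)),
      ¬χ = 0 → χ.IsZeroDivisor) ↔
      ¬∃ x ∈ LinearMap.ker (Quaternion.sylvester F G), IsUnit x := by
    constructor
    · rintro h ⟨x, hx, hu⟩
      have := h _ (mem_ker_sylvester_quaternionEquiv.2 hx)
        (by rw [EmbeddingLike.map_eq_zero_iff]; exact hu.ne_zero)
      exact Quaternion.isUnit_iff_normSq_ne_zero.1 hu (isZeroDivisor_quaternionEquiv_iff.1 this).2
    · intro h χ hχ h0
      obtain ⟨x, rfl⟩ := (quaternionEquiv Ω).surjective χ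
      rw [EmbeddingLike.map_eq_zero_iff] at h0
      refine isZeroDivisor_quaternionEquiv_iff.2 ⟨h0, ?_⟩
      by_contra hN
      exact h ⟨x, mem_ker_sylvester_quaternionEquiv.1 hχ,
        Quaternion.isUnit_iff_normSq_ne_zero.2 hN⟩
  rw [hall]
  simp only [re_quaternionEquiv, vec_quaternionEquiv, symm_quaternionEquiv, ← Subring.coe_add,
    ← map_sub, hcoe, hcoe0, isUnit_quaternionEquiv_iff, isZeroDivisor_quaternionEquiv_iff,
    EmbeddingLike.apply_eq_iff_eq]
  have n43 : ((4 : ℕ) : Cardinal.{0}) ≠ 3 := by norm_num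
  have n42 : ((4 : ℕ) : Cardinal.{0}) ≠ 2 := by norm_num
  have n34 : ((3 : ℕ) : Cardinal.{0}) ≠ 4 := by norm_num
  have n32 : ((3 : ℕ) : Cardinal.{0}) ≠ 2 := by norm_num
  have n24 : ((2 : ℕ) : Cardinal.{0}) ≠ 4 := by norm_num
  have n23 : ((2 : ℕ) : Cardinal.{0}) ≠ 3 := by norm_num
  rcases Quaternion.sylvester_cases hf hg with ⟨hr, hD0, hker, hs, hu⟩ | ⟨hr, hD0, hker, hs, hu⟩ |
    ⟨hr, hD0, hs, hN, hu⟩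
  · rw [hr]
    simp only [hD0, hker, hs, n43, n42]
    norm_num
  -- In rank 3 the kernel is nonzero and has no units, whereas on a slice domain every nonzero
  -- element is a unit.
  · have hprod : Ω.IsProductDomain := by
      by_contra hΩ
      obtain ⟨x, hx, h0⟩ := Submodule.exists_mem_ne_zero_of_ne_bot hker
      refine hu ⟨x, hx, Quaternion.isUnit_iff_normSq_ne_zero.2 fun hN => ?_⟩
      exact h0 (eq_zero_of_normSq_eq_zero hΩ hN)
    rw [hr]
    simp only [hD0, hker, hs, hu, n34, n32, hprod]
    norm_num
  · have hzd : (∃ x ∈ LinearMap.ker (Quaternion.sylvester F G), ¬x = 0 ∧ Quaternion.normSq x = 0) ↔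
        Ω.IsProductDomain ∧
          ((F.im = G.im ∧ ∃ ρ : SEMReal Ω, ρ ^ 2 = Quaternion.normSq F.im) ∨
            (¬F.im = G.im ∧ Quaternion.normSq (F.im - G.im) = 0) ∨
            (¬Quaternion.normSq (F.im - G.im) = 0 ∧
              ∃ ρ : SEMReal Ω, ρ ^ 2 = Quaternion.normSq F.im)) := by
      -- The algebraic criterion needs a square root of `-1`, which a product domain supplies; on a
      -- slice domain both sides are false.
      by_cases hΩ : Ω.IsProductDomain
      · rw [Quaternion.exists_normSq_eq_zero_mem_ker_iff hf hg hs hN (exists_sq_eq_neg_one hΩ)]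
        simp only [hΩ, true_and, ne_eq]
      · simp only [hΩ, false_and, iff_false]
        rintro ⟨x, -, h0, hx⟩
        exact h0 (eq_zero_of_normSq_eq_zero hΩ hx)
    rw [hr, hzd]
    simp only [hD0, hs, hN, hu, n24, n23]
    norm_num
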